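/- **Setting.** Let $\Omega_1=\{x=(x_i)_{i\ge1}: x_1\ge x_2\ge\dots\ge0,\ \sum_i x_i=1\}$ with the Borel $\sigma$-algebra of the product topology, and let $B(\Omega_1)$ be the space of bounded Borel functions on $\Omega_1$. For $i\ne j$ let $M_{ij}x$ be obtained from $x$ by replacing $x_i,x_j$ by $x_i+x_j$ and reordering, and for $0<u<1$ let $S_i^ux$ be obtained by replacing $x_i$ by $ux_i$ and $(1-u)x_i$ and reordering. Let $K_1,F_1$ be measurable, symmetric, nonnegative functions on $\{(x,y):x,y>0,\ x+y\le1\}$ such that $x\mapsto\sum_{i\ne j}K_1(x_i,x_j)\mathbf 1_{\{x_ix_j>0\}}$ and $x\mapsto\sum_i x_i\int_0^1F_1(ux_i,(1-u)x_i)\,du$ are bounded on $\Omega_1$ (here $K_1(x,y)=0$ if $xy=0$, and in the second sum only indices with $x_i>0$ count). Set, for $\Phi\in B(\Omega_1)$, $$L_1^\sharp\Phi(x)=\tfrac12\sum_{i\ne j}K_1(x_i,x_j)\bigl(\Phi(M_{ij}x)-\Phi(x)\bigr)+\tfrac12\sum_i x_i\int_0^1F_1(ux_i,(1-u)x_i)\bigl(\Phi(S_i^ux)-\Phi(x)\bigr)\,du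 .$$ A bounded operator $L$ on $B(\Omega_1)$ is said to *generate* a Markov process $(X(t))_{t\ge0}$ on $\Omega_1$ if $E[\Phi(X(s+t))\mid X(r),r\le s]=(e^{tL}\Phi)(X(s))$ a.s. for all $s,t\ge0$ and $\Phi\in B(\Omega_1)$. The process generated by $L$ is *reversible* with respect to a probability measure $\mu$ on $\Omega_1$ if (a) $e^{tL}\Phi(x)=\int\Phi(y)\,p_t(x,dy)$ $(t\ge0)$ for Markov kernels $p_t$ satisfying $\int_A p_t(x,B)\,\mu(dx)=\int_B p_t(x,A)\,\mu(dx)$ for all Borel sets $A,B$; and (b) for every process generated by $L$ with $X(0)$ of law $\mu$, every $T\ge0$ and all $t_1,\dots,t_n\in[0,T]$, the vectors $(X(t_1),\dots,X(t_n))$ and $(X(T-t_1),\dots,X(T-t_n))$ have the same law. Let $\mathcal N$ be the space of $\{0,1,2,\dots\}$-valued Radon measures on $(0,\infty)$, with the Borel $\sigma$-algebra of the vague topology. For a random element $X=(X_i)$ of $\Omega_1$ put $\xi=\sum_i\mathbf 1_{\{X_i>0\}}\delta_{X_i}$, $\xi^{[1]}=\xi$ and $\xi^{[2]}=\sum_{i\ne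 j}\mathbf 1_{\{X_iX_j>0\}}\delta_{(X_i,X_j)}$. For $k=1,2$, the $k$th correlation measure of $\xi$ is $E[\xi^{[k]}(\cdot)]$ on $(0,\infty)^k$; its Lebesgue density $q_k$, if it exists, is the $k$th correlation function; and the $k$th-order reduced Palm distributions are probability measures $P_{z_1,\dots,z_k}$ on $\mathcal N$, depending measurably on $(z_1,\dots,z_k)\in(0,\infty)^k$, such that for all measurable $G\ge0$ $$E\Bigl[\int G(z_1,\dots,z_k,\xi)\,\xi^{[k]}(dz_1\cdots dz_k)\Bigr]=\int E[\xi^{[k]}](dz_1\cdots dz_k)\int_{\mathcal N}G(z_1,\dots,z_k,\eta+\delta_{z_1}+\dots+\delta_{z_k})\,P_{z_1,\dots,z_k}(d\eta).$$ For $\theta>0$, $\mathrm{PD}(\theta)$ denotes the Poisson–Dirichlet distribution on $\Omega_1$, i.e. the law of the decreasing rearrangement of $V_n\prod_{j<n}(1-V_j)$, $n\ge1$, with $V_1,V_2,\dots$ i.i.d. $\mathrm{Beta}(1,\theta)$. **Theorem 2.3.** (i) Let $X$ be a random element of $\Omega_1$ such that the first and second correlation functions $q_1,q_2$ of $\xi$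 exist and satisfy, as an equality between measures on $\mathcal N$, $$K_1(x_1,x_2)\,q_2(x_1,x_2)\,P_{x_1,x_2}=F_1(x_1,x_2)\,q_1(x_1+x_2)\,P_{x_1+x_2}$$ for a.e. $(x_1,x_2)$ with $x_1,x_2>0$, $x_1+x_2<1$, where $P_{x_1,x_2}$ and $P_{x_1+x_2}$ are the reduced Palm distributions of $\xi$. Then the process generated by $L_1^\sharp$ is reversible with respect to the law of $X$. (ii) Let $\theta>0$ and let $Q$ be a bounded, measurable, symmetric, nonnegative function on $\{(x,y):x,y>0,\ x+y\le1\}$. Then $\mathrm{PD}(\theta)$ is a reversible distribution of the process generated by $$L_1^{(Q,\theta)}\Phi(x)=\tfrac12\sum_{i\ne j}x_ix_jQ(x_i,x_j)\bigl(\Phi(M_{ij}x)-\Phi(x)\bigr)+\tfrac\theta2\sum_i x_i^2\int_0^1Q(ux_i,(1-u)x_i)\bigl(\Phi(S_i^ux)-\Phi(x)\bigr)\,du ,$$ where the sums run over ordered pairs $i\ne j$ with $x_ix_j>0$ and over $i$ with $x_i>0$, respectively. -/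

import Mathlib

open MeasureTheory ProbabilityTheory Set Filter Topology
open scoped ENNReal NNReal

universe u

noncomputable section

namespace CoagFrag

/-! ### The simplex and the ranking of sequences -/

/-- The infinite-dimensional simplex `Ω₁`: non-increasing sequences of nonnegative reals with
sum `1`. Its σ-algebra is the one induced by the product σ-algebra of `ℕ → ℝ`, that is, the Borel
σ-algebra of the product topology. -/
abbrev Omega1 : Type := {x : ℕ → ℝ // Antitone x ∧ (∀ i, 0 ≤ x i) ∧ HasSum x 1}

/-- The decreasing rearrangement of a summable sequence of nonnegative reals: its `n`-th term
(`n = 0, 1, …`) is the least `t ≥ 0` such that at most `n` terms of `w` exceed `t`. -/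
def rankSeq (w : ℕ → ℝ) (n : ℕ) : ℝ :=
  sInf {t : ℝ | 0 ≤ t ∧ {k | t < w k}.encard ≤ n}

theorem finite_superlevel {w : ℕ → ℝ} (h : Summable w) {t : ℝ} (ht : 0 < t) :
    {k | t < w k}.Finite := by
  have h1 : ∀ᶠ k in cofinite, w k < t := h.tendsto_cofinite_zero.eventually_lt_const ht
  refine (Filter.eventually_cofinite.1 h1).subset fun k hk => ?_
  simpa using le_of_lt hk

theorem rankSeq_set_nonempty {w : ℕ → ℝ} (h0 : ∀ i, 0 ≤ w i) (h : Summable w) (n : ℕ) :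
    {t : ℝ | 0 ≤ t ∧ {k | t < w k}.encard ≤ n}.Nonempty := by
  refine ⟨∑' k, w k, tsum_nonneg h0, ?_⟩
  have : {k | ∑' k, w k < w k} = ∅ := by
    ext k
    simpa using h.le_tsum k fun j _ => h0 j
  rw [this]
  simp

theorem rankSeq_nonneg (w : ℕ → ℝ) (n : ℕ) : 0 ≤ rankSeq w n :=
  Real.sInf_nonneg fun _ ht => ht.1

/-- The defining property of the rearrangement: the `n`-th term exceeds `t` iff more than `n` terms
of the original sequence do. -/
theorem rankSeq_le_iff {w : ℕ → ℝ} (h0 : ∀ i, 0 ≤ w i) (h : Summable w) (n : ℕ) {t : ℝ}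
    (ht : 0 ≤ t) : rankSeq w n ≤ t ↔ {k | t < w k}.encard ≤ n := by
  constructor
  · intro hle
    by_contra hcon
    have hlt : ((n + 1 : ℕ) : ℕ∞) ≤ {k | t < w k}.encard := by
      push_cast
      exact Order.add_one_le_of_lt (not_le.1 hcon)
    obtain ⟨s, hs, hcard⟩ := Set.exists_subset_encard_eq hlt
    have hfin : s.Finite := Set.finite_of_encard_eq_coe hcard
    have hne : hfin.toFinset.Nonempty := by
      rw [Set.Finite.toFinset_nonempty, Set.nonempty_iff_ne_empty]
      rintro rfl
      simp at hcard
      norm_cast at hcard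
    obtain ⟨k0, hk0, hmin⟩ := hfin.toFinset.exists_min_image w hne
    have htk : t < w k0 := hs (hfin.mem_toFinset.1 hk0)
    have hge : w k0 ≤ rankSeq w n := by
      refine le_csInf (rankSeq_set_nonempty h0 h n) ?_
      rintro r ⟨_, hr⟩
      by_contra hrk
      have hsub : s ⊆ {k | r < w k} := fun k hk =>
        lt_of_lt_of_le (not_le.1 hrk) (hmin k (hfin.mem_toFinset.2 hk))
      have := (Set.encard_le_encard hsub).trans hr
      rw [hcard] at this
      norm_cast at this
      omega
    linarith
  · intro hle
    exact csInf_le ⟨0, fun _ hr => hr.1⟩ ⟨ht, hle⟩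

theorem rankSeq_antitone {w : ℕ → ℝ} (h0 : ∀ i, 0 ≤ w i) (h : Summable w) :
    Antitone (rankSeq w) := by
  intro m n hmn
  rw [rankSeq_le_iff h0 h n (rankSeq_nonneg w m)]
  exact ((rankSeq_le_iff h0 h m (rankSeq_nonneg w m)).1 le_rfl).trans (by exact_mod_cast hmn)

/-- A sequence and its rearrangement have the same number of terms above each level. -/
theorem encard_rankSeq {w : ℕ → ℝ} (h0 : ∀ i, 0 ≤ w i) (h : Summable w) {t : ℝ} (ht : 0 < t) :
    {n | t < rankSeq w n}.encard = {k | t < w k}.encard := by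
  have hfin := finite_superlevel h ht
  have hset : {n | t < rankSeq w n} = ((Finset.range hfin.toFinset.card : Finset ℕ) : Set ℕ) := by
    ext n
    simp only [Set.mem_ofPred_eq, Finset.coe_range, Set.mem_Iio]
    rw [← not_le, rankSeq_le_iff h0 h n ht.le, hfin.encard_eq_coe_toFinset_card]
    norm_cast
    omega
  rw [hset, Set.encard_coe_eq_coe_finsetCard, Finset.card_range, hfin.encard_eq_coe_toFinset_card]

theorem tsum_ofReal_rankSeq {w : ℕ → ℝ} (h0 : ∀ i, 0 ≤ w i) (h : Summable w) :
    ∑' n, ENNReal.ofReal (rankSeq w n) = ∑' n, ENNReal.ofReal (w n) := by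
  rw [← lintegral_count, ← lintegral_count,
    lintegral_eq_lintegral_meas_lt _ (ae_of_all _ (rankSeq_nonneg w)) (by fun_prop),
    lintegral_eq_lintegral_meas_lt _ (ae_of_all _ h0) (by fun_prop)]
  refine setLIntegral_congr_fun measurableSet_Ioi fun t ht => ?_
  simp only [Measure.count_apply (MeasurableSet.of_discrete)]
  rw [encard_rankSeq h0 h ht]

theorem hasSum_rankSeq {w : ℕ → ℝ} (h0 : ∀ i, 0 ≤ w i) {a : ℝ} (h : HasSum w a) :
    HasSum (rankSeq w) a := by
  have h1 := tsum_ofReal_rankSeq h0 h.summable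
  rw [← ENNReal.ofReal_tsum_of_nonneg h0 h.summable, h.tsum_eq] at h1
  have hs : Summable (rankSeq w) := by
    have := ENNReal.summable_toReal (f := fun n => ENNReal.ofReal (rankSeq w n))
      (by rw [h1]; exact ENNReal.ofReal_ne_top)
    simpa [ENNReal.toReal_ofReal, rankSeq_nonneg] using this
  rw [← ENNReal.ofReal_tsum_of_nonneg (rankSeq_nonneg w) hs,
    ENNReal.ofReal_eq_ofReal_iff (tsum_nonneg (rankSeq_nonneg w)) (h.nonneg h0)] at h1
  rw [← h1]
  exact hs.hasSum

/-- The one-block sequence `(1, 0, 0, …)`. -/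
def oneBlock : Omega1 :=
  ⟨fun n => if n = 0 then 1 else 0, by
    intro m n hmn
    dsimp only
    split_ifs <;> first | omega | norm_num, by
    intro i
    dsimp only
    split_ifs <;> norm_num, by
    simpa using hasSum_ite_eq (0 : ℕ) (1 : ℝ)⟩

open Classical in
/-- The element of `Ω₁` obtained by reordering a sequence of nonnegative reals with sum `1`.
(Other sequences are sent to an irrelevant default value.) -/
def rank (w : ℕ → ℝ) : Omega1 :=
  if h : (∀ i, 0 ≤ w i) ∧ HasSum w 1 then
    ⟨rankSeq w, rankSeq_antitone h.1 h.2.summable, rankSeq_nonneg w, hasSum_rankSeq h.1 h.2⟩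
  else oneBlock

theorem measurableSet_prob : MeasurableSet {w : ℕ → ℝ | (∀ i, 0 ≤ w i) ∧ HasSum w 1} := by
  have h : {w : ℕ → ℝ | (∀ i, 0 ≤ w i) ∧ HasSum w 1} =
      (⋂ i, {w | 0 ≤ w i}) ∩ {w | ∑' i, ENNReal.ofReal (w i) = 1} := by
    ext w
    simp only [Set.mem_ofPred_eq, Set.mem_inter_iff, Set.mem_iInter]
    refine and_congr_right fun h0 => ⟨fun h => ?_, fun h => ?_⟩
    · rw [← ENNReal.ofReal_tsum_of_nonneg h0 h.summable, h.tsum_eq, ENNReal.ofReal_one]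
    · have hs : Summable w := by
        have := ENNReal.summable_toReal (f := fun n => ENNReal.ofReal (w n)) (by rw [h]; simp)
        simpa [ENNReal.toReal_ofReal, h0] using this
      rw [← ENNReal.ofReal_tsum_of_nonneg h0 hs, ENNReal.ofReal_eq_one] at h
      rw [← h]
      exact hs.hasSum
  rw [h]
  refine (MeasurableSet.iInter fun i => measurableSet_le measurable_const
    (measurable_pi_apply i)).inter (measurableSet_eq_fun ?_ measurable_const)
  exact Measurable.tsum fun i => (measurable_pi_apply i).ennreal_ofReal

theorem measurable_rank : Measurable rank := by
  refine Measurable.subtype_mk (f := fun w => (rank w).1) (measurable_pi_iff.2 fun n => ?_)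
  refine measurable_of_Iic fun t => ?_
  have hE : MeasurableSet {w : ℕ → ℝ | {k | t < w k}.encard ≤ n} := by
    have : {w : ℕ → ℝ | {k | t < w k}.encard ≤ n} =
        {w : ℕ → ℝ | ∑' k, (if t < w k then (1 : ℝ≥0∞) else 0) ≤ n} := by
      ext w
      have : ({k | t < w k}.encard : ℝ≥0∞) = ∑' k, (if t < w k then (1 : ℝ≥0∞) else 0) := by
        rw [← Measure.count_apply MeasurableSet.of_discrete,
          ← lintegral_indicator_one MeasurableSet.of_discrete, lintegral_count]
        rfl
      simp only [Set.mem_ofPred_eq]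
      rw [← this]
      norm_cast
    rw [this]
    refine measurableSet_le (Measurable.tsum fun k => ?_) measurable_const
    exact Measurable.ite (measurableSet_lt measurable_const (measurable_pi_apply k))
      measurable_const measurable_const
  by_cases ht : 0 ≤ t
  · have : (fun w => (rank w).1 n) ⁻¹' Iic t =
        ({w : ℕ → ℝ | (∀ i, 0 ≤ w i) ∧ HasSum w 1} ∩ {w | {k | t < w k}.encard ≤ n}) ∪
        ({w : ℕ → ℝ | (∀ i, 0 ≤ w i) ∧ HasSum w 1}ᶜ ∩ {_w | oneBlock.1 n ≤ t}) := by
      ext w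
      by_cases hw : (∀ i, 0 ≤ w i) ∧ HasSum w 1
      · have hr : (rank w).1 = rankSeq w := by rw [rank, dif_pos hw]
        simp [hr, rankSeq_le_iff hw.1 hw.2.summable n ht, hw.1, hw.2]
      · have hr : rank w = oneBlock := by rw [rank, dif_neg hw]
        simp only [Set.mem_preimage, hr, Set.mem_Iic, Set.mem_union, Set.mem_inter_iff,
          Set.mem_ofPred_eq, hw, Set.mem_compl_iff]
        simp
    rw [this]
    exact (measurableSet_prob.inter hE).union
      (measurableSet_prob.compl.inter (MeasurableSet.const _))
  · have : (fun w => (rank w).1 n) ⁻¹' Iic t = ∅ := by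
      ext w
      have := (rank w).2.2.1 n
      simp only [Set.mem_preimage, Set.mem_Iic, Set.mem_empty_iff_false, iff_false, not_le]
      linarith [not_le.1 ht]
    rw [this]
    exact MeasurableSet.empty

/-! ### Split and merge transformations and the generators -/

/-- `M_{ij} x` (for `i ≠ j`): replace `x_i, x_j` by `x_i + x_j`, then reorder. -/
def merge (x : Omega1) (i j : ℕ) : Omega1 :=
  rank fun k => if k = i then x.1 i + x.1 j else if k = j then 0 else x.1 k

/-- `S_i^u x` (for `0 ≤ u ≤ 1`): replace `x_i` by `u x_i` and `(1 - u) x_i`, then reorder. -/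
def split (x : Omega1) (i : ℕ) (u : ℝ) : Omega1 :=
  rank fun k => match k with
    | 0 => (1 - u) * x.1 i
    | k + 1 => if k = i then u * x.1 i else x.1 k

/-- The operator `L₁^♯` with coagulation rate `K` and fragmentation rate `F`. The first sum is over
ordered pairs of distinct indices with `x_i, x_j > 0`. -/
def opSharp (K F : ℝ → ℝ → ℝ) (Φ : Omega1 → ℝ) (x : Omega1) : ℝ :=
  1 / 2 * ∑' p : ℕ × ℕ, (if p.1 ≠ p.2 ∧ 0 < x.1 p.1 ∧ 0 < x.1 p.2 then
      K (x.1 p.1) (x.1 p.2) * (Φ (merge x p.1 p.2) - Φ x) else 0)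
  + 1 / 2 * ∑' i : ℕ, x.1 i *
      ∫ u in (0 : ℝ)..1, F (u * x.1 i) ((1 - u) * x.1 i) * (Φ (split x i u) - Φ x)

/-- The operator `L₁^{(Q,θ)}`. -/
def opQ (Q : ℝ → ℝ → ℝ) (θ : ℝ) (Φ : Omega1 → ℝ) (x : Omega1) : ℝ :=
  1 / 2 * ∑' p : ℕ × ℕ, (if p.1 ≠ p.2 ∧ 0 < x.1 p.1 ∧ 0 < x.1 p.2 then
      x.1 p.1 * x.1 p.2 * Q (x.1 p.1) (x.1 p.2) * (Φ (merge x p.1 p.2) - Φ x) else 0)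
  + θ / 2 * ∑' i : ℕ, x.1 i ^ 2 *
      ∫ u in (0 : ℝ)..1, Q (u * x.1 i) ((1 - u) * x.1 i) * (Φ (split x i u) - Φ x)

/-- `H` is a measurable, symmetric, nonnegative function on `{(x, y) : x, y > 0, x + y ≤ 1}`
(its values elsewhere play no role). -/
structure IsRate (H : ℝ → ℝ → ℝ) : Prop where
  measurable : Measurable (Function.uncurry H)
  symm : ∀ x y, 0 < x → 0 < y → x + y ≤ 1 → H x y = H y x
  nonneg : ∀ x y, 0 < x → 0 < y → x + y ≤ 1 → 0 ≤ H x y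

/-- The total coagulation rate `x ↦ ∑_{i ≠ j} K(x_i, x_j) 1_{x_i x_j > 0}` is bounded on `Ω₁`. -/
def BoundedCoagRate (K : ℝ → ℝ → ℝ) : Prop :=
  ∃ C : ℝ≥0, ∀ x : Omega1, ∑' p : ℕ × ℕ, (if p.1 ≠ p.2 ∧ 0 < x.1 p.1 ∧ 0 < x.1 p.2 then
      ENNReal.ofReal (K (x.1 p.1) (x.1 p.2)) else 0) ≤ C

/-- The total fragmentation rate `x ↦ ∑_i x_i ∫₀¹ F(u x_i, (1 - u) x_i) du` is bounded on `Ω₁`. -/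
def BoundedFragRate (F : ℝ → ℝ → ℝ) : Prop :=
  ∃ C : ℝ≥0, ∀ x : Omega1, ∑' i : ℕ, ENNReal.ofReal (x.1 i) *
      ∫⁻ u in Ioo (0 : ℝ) 1, ENNReal.ofReal (F (u * x.1 i) ((1 - u) * x.1 i)) ≤ C

/-! ### Processes generated by a bounded operator, reversibility -/

/-- `Φ` belongs to the space `B(Ω₁)` of bounded Borel functions. -/
def IsBddMeas (Φ : Omega1 → ℝ) : Prop := Measurable Φ ∧ ∃ C : ℝ, ∀ x, |Φ x| ≤ C

/-- The semigroup `e^{tL} = ∑ₙ tⁿ Lⁿ / n!` of a bounded operator `L`. -/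
def expSemigroup (L : (Omega1 → ℝ) → Omega1 → ℝ) (t : ℝ) (Φ : Omega1 → ℝ) (x : Omega1) : ℝ :=
  ∑' n : ℕ, t ^ n / (n.factorial : ℝ) * (L^[n] Φ) x

/-- `p` is the transition function with generator `L`: each `p t` is a Markov kernel, and
`∫ Φ(y) p_t(x, dy) = (e^{tL} Φ)(x)` for every bounded Borel function `Φ`. -/
def IsTransitionFunction (L : (Omega1 → ℝ) → Omega1 → ℝ) (p : ℝ≥0 → Kernel Omega1 Omega1) :
    Prop :=
  ∀ t, IsMarkovKernel (p t) ∧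
    ∀ Φ, IsBddMeas Φ → ∀ x, ∫ y, Φ y ∂(p t x) = expSemigroup L t Φ x

/-- `X` is a Markov process (with respect to its own filtration) with generator `L`:
`E[Φ(X_{s+t}) | X_r, r ≤ s] = (e^{tL} Φ)(X_s)` a.s. for every bounded Borel function `Φ`. -/
structure IsGeneratedBy {S : Type u} [MeasurableSpace S] (L : (Omega1 → ℝ) → Omega1 → ℝ)
    (P : Measure S) (X : ℝ≥0 → S → Omega1) : Prop where
  measurable : ∀ t, Measurable (X t)
  markov : ∀ s t : ℝ≥0, ∀ Φ, IsBddMeas Φ →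
    P[fun ω => Φ (X (s + t) ω) | ⨆ r : {r : ℝ≥0 // r ≤ s}, MeasurableSpace.comap (X r) inferInstance]
      =ᵐ[P] fun ω => expSemigroup L t Φ (X s ω)

/-- The process `X` is reversible: for every `T` the finite-dimensional distributions of
`(X_t)_{0 ≤ t ≤ T}` and of `(X_{T-t})_{0 ≤ t ≤ T}` agree. -/
def IsReversibleProcess {S : Type u} [MeasurableSpace S]
    (P : Measure S) (X : ℝ≥0 → S → Omega1) : Prop :=
  ∀ (T : ℝ≥0) (n : ℕ) (t : Fin n → ℝ≥0), (∀ i, t i ≤ T) →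
    P.map (fun ω i => X (t i) ω) = P.map (fun ω i => X (T - t i) ω)

/-- The process generated by `L` is reversible with respect to `μ`: `L` has a transition function,
this transition function is in detailed balance with `μ`, and every process generated by `L`
whose initial distribution is `μ` is invariant in law under time reversal. -/
def ReversibleWrt (L : (Omega1 → ℝ) → Omega1 → ℝ) (μ : Measure Omega1) : Prop :=
  (∃ p : ℝ≥0 → Kernel Omega1 Omega1, IsTransitionFunction L p ∧ ∀ t, (p t).IsReversible μ) ∧
  ∀ (S : Type u) [MeasurableSpace S] (P : Measure S) [IsProbabilityMeasure P]
    (X : ℝ≥0 → S → Omega1), IsGeneratedBy L P X → P.map (X 0) = μ → IsReversibleProcess P X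

/-! ### Point configurations, correlation measures, Palm distributions -/

/-- `η` is a `{0, 1, 2, …}`-valued Radon measure on `(0, ∞)`, extended by `0` to `ℝ`. -/
def IsPointConfig (η : Measure ℝ) : Prop :=
  η (Iic 0) = 0 ∧ (∀ a b : ℝ, 0 < a → η (Icc a b) < ∞) ∧
    ∀ B, MeasurableSet B → ∃ n : ℕ∞, η B = (n : ℝ≥0∞)

/-- The space `𝒩` of point configurations on `(0, ∞)`. Its σ-algebra is generated by the
evaluations `η ↦ η B`, `B` Borel; this is the Borel σ-algebra of the vague topology. -/
abbrev PointConfig : Type := {η : Measure ℝ // IsPointConfig η}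

/-- `1_{z > 0} δ_z`. -/
def pointMass (z : ℝ) : Measure ℝ := (Measure.dirac z).restrict (Ioi 0)

theorem pointMass_apply (z : ℝ) {B : Set ℝ} (hB : MeasurableSet B) :
    pointMass z B = (B ∩ Ioi 0).indicator 1 z := by
  rw [pointMass, Measure.restrict_apply hB, Measure.dirac_apply' _ (hB.inter measurableSet_Ioi)]

theorem sum_pointMass_apply (x : ℕ → ℝ) {B : Set ℝ} (hB : MeasurableSet B) :
    Measure.sum (fun i => pointMass (x i)) B = ({i | x i ∈ B ∩ Ioi 0}.encard : ℝ≥0∞) := by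
  rw [Measure.sum_apply _ hB, ← Measure.count_apply MeasurableSet.of_discrete,
    ← lintegral_indicator_one MeasurableSet.of_discrete, lintegral_count]
  refine tsum_congr fun i => ?_
  rw [pointMass_apply _ hB]
  rfl

/-- The point configuration `Ξ(x) = ∑_i 1_{x_i > 0} δ_{x_i}` of `x ∈ Ω₁`. -/
def config (x : Omega1) : PointConfig :=
  ⟨Measure.sum fun i => pointMass (x.1 i), by
    refine ⟨?_, fun a b ha => ?_, fun B hB => ⟨_, sum_pointMass_apply x.1 hB⟩⟩
    · rw [sum_pointMass_apply _ measurableSet_Iic, Set.Iic_inter_Ioi]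
      simp
    · rw [sum_pointMass_apply _ measurableSet_Icc]
      have hfin : {i | x.1 i ∈ Icc a b ∩ Ioi 0}.Finite := by
        refine (finite_superlevel x.2.2.2.summable (half_pos ha)).subset fun i hi => ?_
        have := hi.1.1
        simp only [Set.mem_ofPred_eq]
        linarith
      rw [hfin.encard_eq_coe_toFinset_card]
      simp⟩

open Classical in
/-- The configuration `η + δ_z`, for `z > 0`. -/
def addPoint (η : PointConfig) (z : ℝ) : PointConfig :=
  ⟨η.1 + pointMass z, by
    obtain ⟨h1, h2, h3⟩ := η.2
    refine ⟨?_, fun a b ha => ?_, fun B hB => ?_⟩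
    · rw [Measure.add_apply, h1, pointMass_apply _ measurableSet_Iic]
      simp
    · rw [Measure.add_apply, pointMass_apply _ measurableSet_Icc]
      refine ENNReal.add_lt_top.2 ⟨h2 a b ha, ?_⟩
      rw [Set.indicator_apply]
      split_ifs <;> simp
    · obtain ⟨n, hn⟩ := h3 B hB
      rw [Measure.add_apply, hn, pointMass_apply _ hB, Set.indicator_apply]
      split_ifs
      · exact ⟨n + 1, by simp⟩
      · exact ⟨n, by simp⟩⟩

theorem measurable_pointMass : Measurable pointMass := by
  refine Measure.measurable_of_measurable_coe _ fun B hB => ?_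
  simp_rw [pointMass_apply _ hB]
  exact measurable_one.indicator (hB.inter measurableSet_Ioi)

theorem measurable_config : Measurable config := by
  refine Measurable.subtype_mk (Measure.measurable_of_measurable_coe _ fun B hB => ?_)
  simp_rw [Measure.sum_apply _ hB]
  exact Measurable.tsum fun i => (Measure.measurable_coe hB).comp
    (measurable_pointMass.comp ((measurable_pi_apply i).comp measurable_subtype_coe))

/-- The modified product counting measure `ξ^{[2]} = ∑_{i ≠ j} δ_{(x_i, x_j)}` of `ξ = Ξ(x)`, the
sum being over ordered pairs of distinct indices with `x_i, x_j > 0`. -/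
def config2 (x : Omega1) : Measure (ℝ × ℝ) :=
  Measure.sum fun p : ℕ × ℕ =>
    if p.1 ≠ p.2 then (Measure.dirac (x.1 p.1, x.1 p.2)).restrict (Ioi 0 ×ˢ Ioi 0) else 0

theorem measurable_config2 : Measurable config2 := by
  refine Measure.measurable_of_measurable_coe _ fun B hB => ?_
  simp_rw [config2, Measure.sum_apply _ hB]
  refine Measurable.tsum fun p => ?_
  split_ifs
  · have hm : Measurable fun x : Omega1 => (x.1 p.1, x.1 p.2) :=
      ((measurable_pi_apply p.1).comp measurable_subtype_coe).prodMk
        ((measurable_pi_apply p.2).comp measurable_subtype_coe)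
    have hC : MeasurableSet (B ∩ Ioi (0 : ℝ) ×ˢ Ioi (0 : ℝ)) :=
      hB.inter (measurableSet_Ioi.prod measurableSet_Ioi)
    simp_rw [Measure.restrict_apply hB, Measure.dirac_apply' _ hC]
    exact (measurable_one.indicator hC).comp hm
  · simp

/-- First correlation measure: the mean measure of `ξ = Ξ(X)`, where `X` has law `μ`. -/
def corr1 (μ : Measure Omega1) : Measure ℝ := μ.bind fun x => (config x).1

/-- Second correlation measure: the mean measure of `ξ^{[2]}`, where `X` has law `μ`. -/
def corr2 (μ : Measure Omega1) : Measure (ℝ × ℝ) := μ.bind config2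

/-- `q₁` is the first correlation function, a density of the first correlation measure. -/
def IsCorrFun1 (μ : Measure Omega1) (q₁ : ℝ → ℝ≥0∞) : Prop :=
  Measurable q₁ ∧ corr1 μ = (volume.restrict (Ioi 0)).withDensity q₁

/-- `q₂` is the second correlation function, a density of the second correlation measure. -/
def IsCorrFun2 (μ : Measure Omega1) (q₂ : ℝ × ℝ → ℝ≥0∞) : Prop :=
  Measurable q₂ ∧ corr2 μ = (volume.restrict (Ioi 0 ×ˢ Ioi 0)).withDensity q₂

/-- `P₁ v` (`v > 0`) is the first-order reduced Palm distribution at `v` of `ξ = Ξ(X)`, where `X`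
has law `μ`. -/
def IsPalm1 (μ : Measure Omega1) (P₁ : Kernel ℝ PointConfig) : Prop :=
  ∀ G : ℝ × PointConfig → ℝ≥0∞, Measurable G →
    ∫⁻ x, ∫⁻ v, G (v, config x) ∂(config x).1 ∂μ =
      ∫⁻ v, ∫⁻ η, G (v, addPoint η v) ∂(P₁ v) ∂(corr1 μ)

/-- `P₂ (v₁, v₂)` (`v₁, v₂ > 0`) is the second-order reduced Palm distribution at `(v₁, v₂)` of
`ξ = Ξ(X)`, where `X` has law `μ`. -/
def IsPalm2 (μ : Measure Omega1) (P₂ : Kernel (ℝ × ℝ) PointConfig) : Prop :=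
  ∀ G : (ℝ × ℝ) × PointConfig → ℝ≥0∞, Measurable G →
    ∫⁻ x, ∫⁻ v, G (v, config x) ∂(config2 x) ∂μ =
      ∫⁻ v, ∫⁻ η, G (v, addPoint (addPoint η v.1) v.2) ∂(P₂ v) ∂(corr2 μ)

/-! ### The Poisson–Dirichlet distribution -/

/-- Stick breaking: `v ↦ (v₀, (1 - v₀) v₁, (1 - v₀)(1 - v₁) v₂, …)`. -/
def stickBreaking (v : ℕ → ℝ) (n : ℕ) : ℝ := v n * ∏ j ∈ Finset.range n, (1 - v j)

theorem measurable_stickBreaking : Measurable stickBreaking := by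
  refine measurable_pi_iff.2 fun n => ?_
  unfold stickBreaking
  fun_prop

/-- The Poisson–Dirichlet distribution `PD(θ)`, `θ > 0`: the law of the decreasing rearrangement of
the stick-breaking sequence built from i.i.d. `Beta(1, θ)` variables. -/
def PD (θ : ℝ) : Measure Omega1 :=
  (Measure.infinitePi fun _ : ℕ => betaMeasure 1 θ).map fun v => rank (stickBreaking v)

end CoagFrag

end

noncomputable section

namespace CoagFrag

/-! ### Point measures of sequences -/

/-! The generator has the form `L Φ x = ∫ (Φ y - Φ x) J(x, dy)` with a jump kernel `J` of bounded
total mass, so everything reduces to the symmetry of `μ(dx) J(x, dy)`. Since `J` is half the sum of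
a coagulation and a fragmentation part, it suffices that the coagulation flux from `x` to `y` equals
the fragmentation flux from `y` to `x`; this is `DetailedBalance`.

From `J` to the process: if `C` bounds the total rate, then `L = C (κ - 1)` with a Markov kernel `κ`
that inherits reversibility, and `e^{tL}` is the Poisson mixture of the powers of `κ`
(`integral_poissonized`), hence a reversible Markov kernel. Reversible kernels are self-adjoint for
the pairing by `μ`, and moving them one at a time across this pairing reverses the
finite-dimensional laws (`lintegral_pathDensity_reverse`).

Detailed balance from Palm distributions: a ranked state is determined by its point measure
(`omega_ext`), so a merger exchanges the atoms `v₁, v₂` for one atom `v₁ + v₂`, and a split does the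
opposite. Coagulation jumps are integrals against `ξ^{[2]}`, fragmentation jumps integrals against
`ξ`, and `z dz du` becomes `dv₁ dv₂` for `v = (u z, (1 - u) z)`. The Palm formulas then turn both
fluxes into integrals, over `v` and a remaining configuration `η`, of one function of `η + δ_{v₁} +
δ_{v₂}` and `η + δ_{v₁ + v₂}`; the hypothesis says that the weights agree
(`detailedBalance_of_palm`).

For Poisson–Dirichlet, detailed balance is proved directly from size-biased picks. A sample is a
Beta block `V` together with an independent sample scaled by `1 - V` (`lintegral_PD`), and the block
`V` has the law of a size-biased pick, jointly with the state (`pickMeasure_PD`): both joint laws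
solve the same recursion, which contracts by `E(1 - V) < 1`. That the insertion law solves it rests
on the symmetry of `θ² (1 - a - b)^(θ - 1)`. Two picks without replacement compute the coagulation
flux, one pick the fragmentation flux, and both give the same integral (`detailedBalance_PD`). -/

theorem measure_ext_of_Ioi_rat {η₁ η₂ : Measure ℝ} (h₁ : η₁ (Iic 0) = 0) (h₂ : η₂ (Iic 0) = 0)
    (hfin : ∀ q : ℚ, 0 < q → η₁ (Ioi (q : ℝ)) ≠ ∞)
    (heq : ∀ q : ℚ, 0 < q → η₁ (Ioi (q : ℝ)) = η₂ (Ioi (q : ℝ))) : η₁ = η₂ := by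
  have hself : ∀ η : Measure ℝ, η (Iic 0) = 0 → η.restrict (Ioi 0) = η := fun η h => by
    refine Measure.restrict_eq_self_of_ae_mem ?_
    rw [ae_iff]
    convert h using 2
    ext x
    simp
  -- The measures may be infinite near `0`, so uniqueness is applied on the half-lines above `1 / (n
  -- + 1)`, where they are finite; intersecting with such a half-line only replaces `q` by a
  -- maximum.
  have hU : Ioi (0 : ℝ) = ⋃ n : ℕ, Ioi (((1 / (n + 1) : ℚ)) : ℝ) := by
    ext x
    simp only [mem_Ioi, mem_iUnion]
    constructor
    · intro hx
      obtain ⟨n, hn⟩ := exists_nat_one_div_lt hx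
      exact ⟨n, by push_cast; exact hn⟩
    · rintro ⟨n, hn⟩
      refine lt_trans ?_ hn
      push_cast
      positivity
  rw [← hself η₁ h₁, ← hself η₂ h₂, hU, Measure.restrict_iUnion_congr]
  intro n
  have hr : (0 : ℚ) < 1 / (n + 1) := by positivity
  have hfi : IsFiniteMeasure (η₁.restrict (Ioi (((1 / (n + 1) : ℚ)) : ℝ))) :=
    ⟨by simpa using (hfin _ hr).lt_top⟩
  refine ext_of_generate_finite _ (Real.borel_eq_generateFrom_Ioi_rat ▸ BorelSpace.measurable_eq)
    Real.isPiSystem_Ioi_rat ?_ ?_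
  · intro s hs
    simp only [mem_iUnion, mem_singleton_iff] at hs
    obtain ⟨q, rfl⟩ := hs
    rw [Measure.restrict_apply measurableSet_Ioi, Measure.restrict_apply measurableSet_Ioi,
      Ioi_inter_Ioi]
    have := heq (q ⊔ (1 / (n + 1))) (lt_of_lt_of_le hr le_sup_right)
    rw [Rat.cast_max] at this
    exact this
  · rw [Measure.restrict_apply_univ, Measure.restrict_apply_univ]
    exact heq _ hr

/-- The point measure `∑_i 1_{w_i > 0} δ_{w_i}` of a sequence. -/
def pointSum (w : ℕ → ℝ) : Measure ℝ := Measure.sum fun i => pointMass (w i)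

theorem config_val (x : Omega1) : (config x).1 = pointSum x.1 := rfl

theorem pointSum_Ioi (w : ℕ → ℝ) {t : ℝ} (ht : 0 ≤ t) :
    pointSum w (Ioi t) = ({i | t < w i}.encard : ℝ≥0∞) := by
  rw [pointSum, sum_pointMass_apply _ measurableSet_Ioi, Ioi_inter_Ioi, sup_eq_left.2 ht]
  rfl

theorem pointSum_Iic_zero (w : ℕ → ℝ) : pointSum w (Iic 0) = 0 := by
  rw [pointSum, sum_pointMass_apply _ measurableSet_Iic, Iic_inter_Ioi]
  simp

theorem pointMass_of_nonpos {z : ℝ} (hz : z ≤ 0) : pointMass z = 0 := by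
  ext B hB
  rw [pointMass_apply _ hB, indicator_of_notMem]
  · rfl
  · exact fun h => absurd h.2 (not_lt.2 hz)

instance isFiniteMeasure_pointMass (z : ℝ) : IsFiniteMeasure (pointMass z) := by
  unfold pointMass
  infer_instance

/-- Cancellation is legitimate even where `η₁` is infinite, because the summand removed is finite.
-/
theorem add_pointMass_cancel {η₁ η₂ : Measure ℝ} {z : ℝ}
    (h : η₁ + pointMass z = η₂ + pointMass z) : η₁ = η₂ := by
  ext B hB
  have := congrArg (fun m : Measure ℝ => m B) h
  simp only [Measure.add_apply] at this
  exact (ENNReal.add_left_inj (measure_ne_top _ _)).1 this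

theorem lintegral_pointMass {g : ℝ → ℝ≥0∞} (hg : Measurable g) (z : ℝ) :
    ∫⁻ b, g b ∂pointMass z = if 0 < z then g z else 0 := by
  rw [pointMass, ← lintegral_indicator measurableSet_Ioi,
    lintegral_dirac' _ (hg.indicator measurableSet_Ioi), indicator_apply]
  rfl

theorem lintegral_pointSum {g : ℝ → ℝ≥0∞} (hg : Measurable g) (w : ℕ → ℝ) :
    ∫⁻ b, g b ∂pointSum w = ∑' i, if 0 < w i then g (w i) else 0 := by
  rw [pointSum, lintegral_sum_measure]
  exact tsum_congr fun i => lintegral_pointMass hg _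

/-! ### Ranked sequences and point measures determine each other -/

theorem pointSum_ext_of_encard {w w' : ℕ → ℝ} (hs : Summable w)
    (h : ∀ t, 0 < t → {i | t < w i}.encard = {i | t < w' i}.encard) :
    pointSum w = pointSum w' := by
  refine measure_ext_of_Ioi_rat (pointSum_Iic_zero w) (pointSum_Iic_zero w') (fun q hq => ?_)
    fun q hq => ?_
  · have hq' : (0 : ℝ) < q := by exact_mod_cast hq
    rw [pointSum_Ioi _ hq'.le, (finite_superlevel hs hq').encard_eq_coe_toFinset_card]
    simp
  · have hq' : (0 : ℝ) < q := by exact_mod_cast hq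
    rw [pointSum_Ioi _ hq'.le, pointSum_Ioi _ hq'.le, h _ hq']

/-- The ranked terms depend only on how many terms exceed each level `t ≥ 0`, which is the mass of
`Ioi t`. -/
theorem rankSeq_congr {w w' : ℕ → ℝ} (h : pointSum w = pointSum w') : rankSeq w = rankSeq w' := by
  funext n
  unfold rankSeq
  congr 1
  ext t
  refine and_congr_right fun ht => ?_
  have := congrArg (fun m : Measure ℝ => m (Ioi t)) h
  simp only [pointSum_Ioi _ ht, ENat.toENNReal_inj] at this
  rw [this]

theorem pointSum_rankSeq {w : ℕ → ℝ} (h0 : ∀ i, 0 ≤ w i) (hs : Summable w) :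
    pointSum (rankSeq w) = pointSum w :=
  (pointSum_ext_of_encard hs fun _ ht => (encard_rankSeq h0 hs ht).symm).symm

theorem rankSeq_eq_self {w : ℕ → ℝ} (hw : Antitone w) (h0 : ∀ i, 0 ≤ w i) (hs : Summable w) :
    rankSeq w = w := by
  have key : ∀ n t, 0 ≤ t → (rankSeq w n ≤ t ↔ w n ≤ t) := fun n t ht => by
    rw [rankSeq_le_iff h0 hs n ht]
    constructor
    · intro hle
      by_contra hlt
      have hsub : ((Finset.range (n + 1) : Finset ℕ) : Set ℕ) ⊆ {k | t < w k} := fun k hk => by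
        simp only [Finset.coe_range, mem_Iio] at hk
        exact lt_of_lt_of_le (not_le.1 hlt) (hw (by omega))
      have := (Set.encard_le_encard hsub).trans hle
      rw [Set.encard_coe_eq_coe_finsetCard, Finset.card_range] at this
      norm_cast at this
      omega
    · intro hle
      have hsub : {k | t < w k} ⊆ ((Finset.range n : Finset ℕ) : Set ℕ) := fun k hk => by
        simp only [Finset.coe_range, mem_Iio]
        by_contra hkn
        exact absurd (lt_of_lt_of_le hk ((hw (not_lt.1 hkn)).trans hle)) (lt_irrefl _)
      refine (Set.encard_le_encard hsub).trans ?_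
      rw [Set.encard_coe_eq_coe_finsetCard, Finset.card_range]
  funext n
  exact le_antisymm ((key n _ (h0 n)).2 le_rfl) ((key n _ (rankSeq_nonneg w n)).1 le_rfl)

/-- A ranked sequence is its own rearrangement, hence a function of its point measure. Identities
between states below are checked on point measures, which see neither the order of the terms nor the
zeros. -/
theorem omega_ext {x y : Omega1} (h : pointSum x.1 = pointSum y.1) : x = y := by
  apply Subtype.ext
  rw [← rankSeq_eq_self x.2.1 x.2.2.1 x.2.2.2.summable,
    ← rankSeq_eq_self y.2.1 y.2.2.1 y.2.2.2.summable, rankSeq_congr h]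

theorem config_injective : Function.Injective config := fun _ _ h =>
  omega_ext (congrArg Subtype.val h)

/-- A sequence of nonnegative reals with sum `s`. -/
def IsMass (w : ℕ → ℝ) (s : ℝ) : Prop := (∀ i, 0 ≤ w i) ∧ HasSum w s

theorem Omega1.isMass (x : Omega1) : IsMass x.1 1 := x.2.2

theorem Omega1.nonneg (x : Omega1) (i : ℕ) : 0 ≤ x.1 i := x.2.2.1 i

theorem pointSum_rank {w : ℕ → ℝ} (h : IsMass w 1) : pointSum (rank w).1 = pointSum w := by
  have hr : (rank w).1 = rankSeq w := by
    rw [rank, dif_pos (show (∀ i, 0 ≤ w i) ∧ HasSum w 1 from h)]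
  rw [hr, pointSum_rankSeq h.1 h.2.summable]

theorem IsMass.mul {w : ℕ → ℝ} {s : ℝ} (h : IsMass w s) {c : ℝ} (hc : 0 ≤ c) :
    IsMass (fun k => c * w k) (c * s) :=
  ⟨fun i => mul_nonneg hc (h.1 i), h.2.mul_left c⟩

theorem IsMass.update {w : ℕ → ℝ} {s : ℝ} (h : IsMass w s) (i : ℕ) {a : ℝ} (ha : 0 ≤ a) :
    IsMass (Function.update w i a) (s - w i + a) := by
  refine ⟨fun k => ?_, ?_⟩
  · by_cases hk : k = i
    · subst hk; simpa using ha
    · simpa [Function.update_of_ne hk] using h.1 k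
  · rw [show s - w i + a = a - w i + s by ring]
    exact h.2.update i a

/-- Prepend a term to a sequence. -/
def consSeq (a : ℝ) (w : ℕ → ℝ) : ℕ → ℝ
  | 0 => a
  | k + 1 => w k

theorem IsMass.cons {w : ℕ → ℝ} {s : ℝ} (h : IsMass w s) {a : ℝ} (ha : 0 ≤ a) :
    IsMass (consSeq a w) (a + s) := by
  refine ⟨fun k => ?_, ?_⟩
  · cases k with
    | zero => exact ha
    | succ k => exact h.1 k
  · have : HasSum (fun k => consSeq a w (k + 1)) s := h.2
    rw [hasSum_nat_add_iff (f := consSeq a w) 1] at this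
    simpa [consSeq, add_comm] using this

theorem pointSum_consSeq (a : ℝ) (w : ℕ → ℝ) :
    pointSum (consSeq a w) = pointMass a + pointSum w := by
  ext B hB
  rw [pointSum, pointSum, Measure.add_apply, Measure.sum_apply _ hB, Measure.sum_apply _ hB,
    tsum_eq_zero_add' ENNReal.summable]
  rfl

/-- Zero terms carry no mass, so overwriting a term by `0` removes exactly its atom. -/
theorem pointSum_update_zero (w : ℕ → ℝ) (i : ℕ) :
    pointSum w = pointSum (Function.update w i 0) + pointMass (w i) := by
  ext B hB
  have h2 : ∑' k, pointMass (w k) B =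
      pointMass (w i) B + ∑' k, pointMass (Function.update w i 0 k) B := by
    have h3 := ENNReal.tsum_eq_add_tsum_ite (f := fun k => pointMass (w k) B) i
    rw [h3]
    congr 1
    exact tsum_congr fun k => by
      by_cases hk : k = i
      · simp [hk, pointMass_of_nonpos]
      · simp [hk]
  rw [pointSum, pointSum, Measure.add_apply, Measure.sum_apply _ hB, Measure.sum_apply _ hB, h2,
    add_comm]

/-- Replace by `0` the first term of `w` which is equal to `v`. -/
def del (w : ℕ → ℝ) (v : ℝ) (k : ℕ) : ℝ := if w k = v ∧ ∀ l < k, w l ≠ v then 0 else w k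

theorem del_eq_update {w : ℕ → ℝ} {v : ℝ} (h : ∃ i, w i = v) :
    ∃ i, w i = v ∧ del w v = Function.update w i 0 := by
  classical
  refine ⟨Nat.find h, Nat.find_spec h, ?_⟩
  funext k
  by_cases hk : k = Nat.find h
  · subst hk
    rw [Function.update_self, del, if_pos ⟨Nat.find_spec h, fun l hl => Nat.find_min h hl⟩]
  · rw [Function.update_of_ne hk, del, if_neg]
    rintro ⟨h1, h2⟩
    rcases lt_or_gt_of_ne hk with h3 | h3
    · exact Nat.find_min h h3 h1
    · exact h2 _ h3 (Nat.find_spec h)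

theorem exists_eq_of_pointSum {w : ℕ → ℝ} {v : ℝ} {η : Measure ℝ} (hv : 0 < v)
    (h : pointSum w = η + pointMass v) : ∃ i, w i = v := by
  by_contra! hne
  have h1 : pointSum w {v} = 0 := by
    rw [pointSum, Measure.sum_apply _ (measurableSet_singleton v), ENNReal.tsum_eq_zero]
    intro i
    rw [pointMass_apply _ (measurableSet_singleton v), indicator_of_notMem]
    exact fun hi => hne i hi.1
  rw [h, Measure.add_apply, pointMass_apply _ (measurableSet_singleton v),
    indicator_of_mem (by simpa using hv)] at h1
  simp at h1

/-- Several indices may hold the value `v`; on point measures it does not matter which one is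
erased. -/
theorem pointSum_del {w : ℕ → ℝ} {v : ℝ} {η : Measure ℝ} (hv : 0 < v)
    (h : pointSum w = η + pointMass v) : pointSum (del w v) = η := by
  obtain ⟨i, hi, hd⟩ := del_eq_update (exists_eq_of_pointSum hv h)
  rw [hd]
  rw [pointSum_update_zero w i, hi] at h
  exact add_pointMass_cancel h

theorem IsMass.del {w : ℕ → ℝ} {s v : ℝ} (hw : IsMass w s) {η : Measure ℝ} (hv : 0 < v)
    (h : pointSum w = η + pointMass v) : IsMass (del w v) (s - v) := by
  obtain ⟨i, hi, hd⟩ := del_eq_update (exists_eq_of_pointSum hv h)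
  rw [hd]
  simpa [hi] using hw.update i le_rfl

/-! ### Measurability of prepending and deleting a term -/

theorem measurable_pi_of_apply {α : Type*} [MeasurableSpace α] {f : α → ℕ → ℝ}
    (h : ∀ n, Measurable fun a => f a n) : Measurable f := measurable_pi_iff.2 h

theorem measurable_consSeq {α : Type*} [MeasurableSpace α] {a : α → ℝ} {w : α → ℕ → ℝ}
    (ha : Measurable a) (hw : Measurable w) : Measurable fun z => consSeq (a z) (w z) := by
  refine measurable_pi_of_apply fun n => ?_
  cases n with
  | zero => exact ha
  | succ n => exact (measurable_pi_apply n).comp hw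

theorem measurable_del {α : Type*} [MeasurableSpace α] {v : α → ℝ} {w : α → ℕ → ℝ}
    (hw : Measurable w) (hv : Measurable v) : Measurable fun z => del (w z) (v z) := by
  refine measurable_pi_of_apply fun n => ?_
  have hk : ∀ k, Measurable fun z => w z k := fun k => (measurable_pi_apply k).comp hw
  unfold del
  refine Measurable.ite ?_ measurable_const (hk n)
  have : {z | w z n = v z ∧ ∀ l < n, w z l ≠ v z} =
      {z | w z n = v z} ∩ ⋂ l, ⋂ (_ : l < n), {z | w z l = v z}ᶜ := by
    ext z
    simp
  rw [this]
  exact (measurableSet_eq_fun (hk n) hv).inter (MeasurableSet.iInter fun l =>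
    MeasurableSet.iInter fun _ => (measurableSet_eq_fun (hk l) hv).compl)

/-! ### Merging and splitting in terms of values -/

@[fun_prop]
theorem measurable_coord (i : ℕ) : Measurable fun x : Omega1 => x.1 i :=
  (measurable_pi_apply i).comp measurable_subtype_coe

/-- Merge two blocks of sizes `v.1` and `v.2`. -/
def mergeVal (v : ℝ × ℝ) (x : Omega1) : Omega1 :=
  rank (consSeq (v.1 + v.2) (del (del x.1 v.1) v.2))

/-- Split a block of size `v.1 + v.2` into blocks of sizes `v.1` and `v.2`. -/
def splitVal (v : ℝ × ℝ) (x : Omega1) : Omega1 :=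
  rank (consSeq v.1 (consSeq v.2 (del x.1 (v.1 + v.2))))

theorem measurable_mergeVal : Measurable fun z : (ℝ × ℝ) × Omega1 => mergeVal z.1 z.2 := by
  have hx : Measurable fun z : (ℝ × ℝ) × Omega1 => z.2.1 := by fun_prop
  exact measurable_rank.comp (measurable_consSeq (by fun_prop)
    (measurable_del (measurable_del hx (by fun_prop)) (by fun_prop)))

theorem measurable_splitVal : Measurable fun z : (ℝ × ℝ) × Omega1 => splitVal z.1 z.2 := by
  have hx : Measurable fun z : (ℝ × ℝ) × Omega1 => z.2.1 := by fun_prop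
  exact measurable_rank.comp (measurable_consSeq (by fun_prop) (measurable_consSeq (by fun_prop)
    (measurable_del hx (by fun_prop))))

theorem pointSum_mergeVal {v : ℝ × ℝ} (h1 : 0 < v.1) (h2 : 0 < v.2) {x : Omega1} {η : Measure ℝ}
    (h : pointSum x.1 = η + pointMass v.1 + pointMass v.2) :
    pointSum (mergeVal v x).1 = η + pointMass (v.1 + v.2) := by
  have e1 : pointSum x.1 = (η + pointMass v.2) + pointMass v.1 := by rw [h, add_right_comm]
  have m1 := x.isMass.del h1 e1
  have e2 := pointSum_del h1 e1
  have m2 := m1.del h2 e2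
  have m3 := m2.cons (add_pos h1 h2).le
  rw [show v.1 + v.2 + (1 - v.1 - v.2) = 1 by ring] at m3
  rw [mergeVal, pointSum_rank m3, pointSum_consSeq, pointSum_del h2 e2, add_comm]

theorem pointSum_splitVal {v : ℝ × ℝ} (h1 : 0 < v.1) (h2 : 0 < v.2) {x : Omega1} {η : Measure ℝ}
    (h : pointSum x.1 = η + pointMass (v.1 + v.2)) :
    pointSum (splitVal v x).1 = η + pointMass v.1 + pointMass v.2 := by
  have m3 := ((x.isMass.del (add_pos h1 h2) h).cons h2.le).cons h1.le
  rw [show v.1 + (v.2 + (1 - (v.1 + v.2))) = 1 by ring] at m3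
  rw [splitVal, pointSum_rank m3, pointSum_consSeq, pointSum_consSeq,
    pointSum_del (add_pos h1 h2) h, add_comm, add_comm (pointMass v.2), add_right_comm]

theorem pointSum_update_update (x : ℕ → ℝ) {i j : ℕ} (hij : i ≠ j) :
    pointSum x = pointSum (Function.update (Function.update x i 0) j 0)
      + pointMass (x i) + pointMass (x j) := by
  rw [pointSum_update_zero x i, pointSum_update_zero (Function.update x i 0) j,
    Function.update_of_ne hij.symm, add_right_comm]

/-- Passing from indices to sizes: the target of a jump depends only on the sizes merged, so sums
over pairs of indices become integrals against `config2`. -/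
theorem merge_eq_mergeVal (x : Omega1) {i j : ℕ} (hij : i ≠ j) (hi : 0 < x.1 i) (hj : 0 < x.1 j) :
    merge x i j = mergeVal (x.1 i, x.1 j) x := by
  apply omega_ext
  rw [pointSum_mergeVal (v := (x.1 i, x.1 j)) hi hj (pointSum_update_update x.1 hij)]
  have e : merge x i j = rank (Function.update (Function.update x.1 j 0) i (x.1 i + x.1 j)) := by
    refine congrArg rank (funext fun k => ?_)
    simp only [Function.update_apply]
  have m := (x.isMass.update j (le_refl 0)).update i (add_pos hi hj).le
  rw [Function.update_of_ne hij, show 1 - x.1 j + 0 - x.1 i + (x.1 i + x.1 j) = 1 by ring] at m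
  rw [e, pointSum_rank m, pointSum_update_zero (Function.update _ _ (x.1 i + x.1 j)) i, Function.update_idem,
    Function.update_self, Function.update_comm hij.symm]

/-- Counterpart for splits, allowing sums over indices to become integrals against `config`. The
open interval for `u` makes both fragments positive, so each is an atom. -/
theorem split_eq_splitVal (x : Omega1) {i : ℕ} (hi : 0 < x.1 i) {u : ℝ} (hu : u ∈ Ioo (0 : ℝ) 1) :
    split x i u = splitVal (u * x.1 i, (1 - u) * x.1 i) x := by
  have h1 : 0 < u * x.1 i := mul_pos hu.1 hi
  have h2 : 0 < (1 - u) * x.1 i := mul_pos (sub_pos.2 hu.2) hi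
  apply omega_ext
  rw [pointSum_splitVal (v := (u * x.1 i, (1 - u) * x.1 i)) (η := pointSum (Function.update x.1 i 0)) h1 h2 (by
    rw [pointSum_update_zero x.1 i]; congr 2; ring)]
  have e : (fun k => match k with
      | 0 => (1 - u) * x.1 i
      | k + 1 => if k = i then u * x.1 i else x.1 k) =
      consSeq ((1 - u) * x.1 i) (Function.update x.1 i (u * x.1 i)) := by
    funext k
    cases k <;> simp [consSeq, Function.update_apply]
  have m := (x.isMass.update i h1.le).cons h2.le
  rw [show (1 - u) * x.1 i + (1 - x.1 i + u * x.1 i) = 1 by ring] at m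
  have e2 : split x i u = rank (consSeq ((1 - u) * x.1 i) (Function.update x.1 i (u * x.1 i))) :=
    congrArg rank e
  rw [e2, pointSum_rank m, pointSum_consSeq, pointSum_update_zero (Function.update _ _ _) i,
    Function.update_idem, Function.update_self, add_comm]

theorem measurable_merge (i j : ℕ) : Measurable fun x : Omega1 => merge x i j := by
  refine measurable_rank.comp (measurable_pi_of_apply fun n => ?_)
  have h := measurable_coord
  split_ifs
  · exact (h i).add (h j)
  · exact measurable_const
  · exact h n

theorem measurable_split (i : ℕ) : Measurable fun z : Omega1 × ℝ => split z.1 i z.2 := by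
  refine measurable_rank.comp (measurable_pi_of_apply fun n => ?_)
  have h : ∀ k, Measurable fun z : Omega1 × ℝ => z.1.1 k := fun k =>
    (measurable_coord k).comp measurable_fst
  cases n with
  | zero => exact (measurable_const.sub measurable_snd).mul (h i)
  | succ n =>
    dsimp only
    split_ifs
    · exact measurable_snd.mul (h i)
    · exact h n

theorem lintegral_config2 {g : ℝ × ℝ → ℝ≥0∞} (hg : Measurable g) (x : Omega1) :
    ∫⁻ v, g v ∂config2 x = ∑' p : ℕ × ℕ, if p.1 ≠ p.2 ∧ 0 < x.1 p.1 ∧ 0 < x.1 p.2 then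
      g (x.1 p.1, x.1 p.2) else 0 := by
  rw [config2, lintegral_sum_measure]
  refine tsum_congr fun p => ?_
  have hS : MeasurableSet (Ioi (0 : ℝ) ×ˢ Ioi (0 : ℝ)) := measurableSet_Ioi.prod measurableSet_Ioi
  by_cases hp : p.1 ≠ p.2
  · simp only [if_pos hp]
    rw [← lintegral_indicator hS, lintegral_dirac' _ (hg.indicator hS), indicator_apply]
    simp [hp]
  · simp [hp]

end CoagFrag

end

noncomputable section

namespace CoagFrag

/-! ### The jump kernel of the generator -/

/-- The rates of the coagulation jumps from `x` (each unordered pair is counted twice). -/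
def coagMeas (K : ℝ → ℝ → ℝ) (x : Omega1) : Measure Omega1 :=
  Measure.sum fun p : ℕ × ℕ => (if p.1 ≠ p.2 ∧ 0 < x.1 p.1 ∧ 0 < x.1 p.2 then
    ENNReal.ofReal (K (x.1 p.1) (x.1 p.2)) else 0) • Measure.dirac (merge x p.1 p.2)

/-- The rates of the fragmentation jumps from `x`. -/
def fragMeas (F : ℝ → ℝ → ℝ) (x : Omega1) : Measure Omega1 :=
  Measure.sum fun i => ENNReal.ofReal (x.1 i) •
    (((volume.restrict (Ioo (0 : ℝ) 1)).withDensity fun u =>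
      ENNReal.ofReal (F (u * x.1 i) ((1 - u) * x.1 i))).map fun u => split x i u)

theorem measurable_split_right (x : Omega1) (i : ℕ) : Measurable fun u => split x i u :=
  (measurable_split i).comp (measurable_const.prodMk measurable_id)

theorem measurable_fragRate {F : ℝ → ℝ → ℝ} (hF : Measurable (Function.uncurry F)) (i : ℕ) :
    Measurable fun z : Omega1 × ℝ =>
      ENNReal.ofReal (F (z.2 * z.1.1 i) ((1 - z.2) * z.1.1 i)) := by
  have h : Measurable fun z : Omega1 × ℝ => z.1.1 i := (measurable_coord i).comp measurable_fst
  exact (hF.comp ((measurable_snd.mul h).prodMk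
    ((measurable_const.sub measurable_snd).mul h))).ennreal_ofReal

theorem measurable_fragRate_right {F : ℝ → ℝ → ℝ} (hF : Measurable (Function.uncurry F)) (a : ℝ) :
    Measurable fun u : ℝ => ENNReal.ofReal (F (u * a) ((1 - u) * a)) :=
  (hF.comp (f := fun u : ℝ => (u * a, (1 - u) * a)) (by fun_prop)).ennreal_ofReal

theorem lintegral_coagMeas (K : ℝ → ℝ → ℝ) (x : Omega1) {f : Omega1 → ℝ≥0∞} (hf : Measurable f) :
    ∫⁻ y, f y ∂coagMeas K x = ∑' p : ℕ × ℕ, if p.1 ≠ p.2 ∧ 0 < x.1 p.1 ∧ 0 < x.1 p.2 then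
      ENNReal.ofReal (K (x.1 p.1) (x.1 p.2)) * f (merge x p.1 p.2) else 0 := by
  rw [coagMeas, lintegral_sum_measure]
  refine tsum_congr fun p => ?_
  rw [lintegral_smul_measure, lintegral_dirac' _ hf, smul_eq_mul, ite_mul, zero_mul]

theorem lintegral_fragMeas {F : ℝ → ℝ → ℝ} (hF : Measurable (Function.uncurry F)) (x : Omega1)
    {f : Omega1 → ℝ≥0∞} (hf : Measurable f) :
    ∫⁻ y, f y ∂fragMeas F x = ∑' i, ENNReal.ofReal (x.1 i) * ∫⁻ u in Ioo (0 : ℝ) 1,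
      ENNReal.ofReal (F (u * x.1 i) ((1 - u) * x.1 i)) * f (split x i u) := by
  rw [fragMeas, lintegral_sum_measure]
  refine tsum_congr fun i => ?_
  have h := lintegral_withDensity_eq_lintegral_mul (volume.restrict (Ioo (0 : ℝ) 1))
    (measurable_fragRate_right hF (x.1 i)) (hf.comp (measurable_split_right x i))
  rw [lintegral_smul_measure, smul_eq_mul, lintegral_map hf (measurable_split_right x i)]
  exact congrArg _ h

theorem measurable_coagMeas {K : ℝ → ℝ → ℝ} (hK : Measurable (Function.uncurry K)) :
    Measurable (coagMeas K) := by
  refine Measure.measurable_of_measurable_coe _ fun B hB => ?_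
  simp_rw [← lintegral_indicator_one hB, lintegral_coagMeas K _ (measurable_one.indicator hB)]
  refine Measurable.tsum fun p => Measurable.ite ?_ (Measurable.mul ?_ ?_) measurable_const
  · exact (MeasurableSet.const _).inter ((measurableSet_lt measurable_const (measurable_coord _)).inter
      (measurableSet_lt measurable_const (measurable_coord _)))
  · exact (hK.comp ((measurable_coord p.1).prodMk (measurable_coord p.2))).ennreal_ofReal
  · exact (measurable_one.indicator hB).comp (measurable_merge _ _)

theorem measurable_fragMeas {F : ℝ → ℝ → ℝ} (hF : Measurable (Function.uncurry F)) :
    Measurable (fragMeas F) := by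
  refine Measure.measurable_of_measurable_coe _ fun B hB => ?_
  simp_rw [← lintegral_indicator_one hB, lintegral_fragMeas hF _ (measurable_one.indicator hB)]
  refine Measurable.tsum fun i => (measurable_coord i).ennreal_ofReal.mul ?_
  refine Measurable.lintegral_prod_right' (f := fun z : Omega1 × ℝ =>
    ENNReal.ofReal (F (z.2 * z.1.1 i) ((1 - z.2) * z.1.1 i)) * B.indicator 1 (split z.1 i z.2)) ?_
  exact (measurable_fragRate hF i).mul ((measurable_one.indicator hB).comp (measurable_split i))

/-- The kernel of the jump rates of the process generated by `L₁^♯`. -/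
def jumpKernel {K F : ℝ → ℝ → ℝ} (hK : Measurable (Function.uncurry K))
    (hF : Measurable (Function.uncurry F)) : Kernel Omega1 Omega1 :=
  ⟨fun x => (2⁻¹ : ℝ≥0∞) • (coagMeas K x + fragMeas F x),
    Measure.measurable_of_measurable_coe _ fun B hB => by
      simp only [Measure.smul_apply, Measure.add_apply, smul_eq_mul]
      exact (((Measure.measurable_coe hB).comp (measurable_coagMeas hK)).add
        ((Measure.measurable_coe hB).comp (measurable_fragMeas hF))).const_mul _⟩

theorem jumpKernel_apply {K F : ℝ → ℝ → ℝ} (hK : Measurable (Function.uncurry K))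
    (hF : Measurable (Function.uncurry F)) (x : Omega1) :
    jumpKernel hK hF x = (2⁻¹ : ℝ≥0∞) • (coagMeas K x + fragMeas F x) := rfl

theorem coagMeas_univ (K : ℝ → ℝ → ℝ) (x : Omega1) :
    coagMeas K x univ = ∑' p : ℕ × ℕ, (if p.1 ≠ p.2 ∧ 0 < x.1 p.1 ∧ 0 < x.1 p.2 then
      ENNReal.ofReal (K (x.1 p.1) (x.1 p.2)) else 0) := by
  rw [← lintegral_one, lintegral_coagMeas _ _ measurable_const]
  simp

theorem fragMeas_univ {F : ℝ → ℝ → ℝ} (hF : Measurable (Function.uncurry F)) (x : Omega1) :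
    fragMeas F x univ = ∑' i, ENNReal.ofReal (x.1 i) * ∫⁻ u in Ioo (0 : ℝ) 1,
      ENNReal.ofReal (F (u * x.1 i) ((1 - u) * x.1 i)) := by
  rw [← lintegral_one, lintegral_fragMeas hF _ measurable_const]
  simp

theorem exists_jumpKernel_le {K F : ℝ → ℝ → ℝ} (hK : Measurable (Function.uncurry K))
    (hF : Measurable (Function.uncurry F)) (bK : BoundedCoagRate K) (bF : BoundedFragRate F) :
    ∃ C : ℝ≥0, 0 < C ∧ ∀ x, jumpKernel hK hF x univ ≤ C := by
  obtain ⟨C₁, h1⟩ := bK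
  obtain ⟨C₂, h2⟩ := bF
  -- The extra `1` makes the bound positive, so that one can later divide by it.
  refine ⟨C₁ + C₂ + 1, by positivity, fun x => ?_⟩
  rw [jumpKernel_apply, Measure.smul_apply, Measure.add_apply, coagMeas_univ, fragMeas_univ hF,
    smul_eq_mul]
  calc _ ≤ 1 * ((C₁ : ℝ≥0∞) + C₂) := by
        gcongr
        · exact ENNReal.inv_le_one.2 (by norm_num)
        · exact h1 x
        · exact h2 x
    _ ≤ _ := by
        rw [one_mul]
        push_cast
        exact le_self_add

theorem integrable_of_bdd {ν : Measure Omega1} [IsFiniteMeasure ν] {Φ : Omega1 → ℝ}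
    (h : IsBddMeas Φ) : Integrable Φ ν := by
  obtain ⟨hm, C, hC⟩ := h
  exact Integrable.of_bound hm.aestronglyMeasurable C (ae_of_all _ fun x => hC x)

theorem add_le_one (x : Omega1) {i j : ℕ} (hij : i ≠ j) : x.1 i + x.1 j ≤ 1 := by
  have := x.2.2.2.summable.sum_le_tsum {i, j} fun k _ => x.nonneg k
  rwa [Finset.sum_pair hij, x.2.2.2.tsum_eq] at this

theorem le_one (x : Omega1) (i : ℕ) : x.1 i ≤ 1 := le_hasSum x.2.2.2 i fun j _ => x.nonneg j

theorem integral_coagMeas {K : ℝ → ℝ → ℝ} (hK : IsRate K) (x : Omega1)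
    [IsFiniteMeasure (coagMeas K x)] {g : Omega1 → ℝ} (hg : IsBddMeas g) :
    ∫ y, g y ∂coagMeas K x = ∑' p : ℕ × ℕ, (if p.1 ≠ p.2 ∧ 0 < x.1 p.1 ∧ 0 < x.1 p.2 then
      K (x.1 p.1) (x.1 p.2) * g (merge x p.1 p.2) else 0) := by
  have h := hasSum_integral_measure (integrable_of_bdd (ν := coagMeas K x) hg)
  refine Eq.trans h.tsum_eq.symm (tsum_congr fun p => ?_)
  rw [integral_smul_measure, integral_dirac' _ _ hg.1.stronglyMeasurable]
  split_ifs with hp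
  · rw [ENNReal.toReal_ofReal (hK.nonneg _ _ hp.2.1 hp.2.2 (add_le_one x hp.1)), smul_eq_mul]
  · simp

theorem integral_fragMeas {F : ℝ → ℝ → ℝ} (hF : IsRate F) (x : Omega1)
    [IsFiniteMeasure (fragMeas F x)] {g : Omega1 → ℝ} (hg : IsBddMeas g) :
    ∫ y, g y ∂fragMeas F x = ∑' i, x.1 i * ∫ u in (0 : ℝ)..1,
      F (u * x.1 i) ((1 - u) * x.1 i) * g (split x i u) := by
  have h := hasSum_integral_measure (integrable_of_bdd (ν := fragMeas F x) hg)
  refine Eq.trans h.tsum_eq.symm (tsum_congr fun i => ?_)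
  have hi := x.nonneg i
  rw [integral_smul_measure, integral_map (measurable_split_right x i).aemeasurable
    hg.1.aestronglyMeasurable, ENNReal.toReal_ofReal hi, smul_eq_mul]
  rcases hi.eq_or_lt with h0 | h0
  · rw [← h0]; simp
  congr 1
  rw [integral_withDensity_eq_integral_toReal_smul (measurable_fragRate_right hF.measurable _)
    (ae_of_all _ fun _ => ENNReal.ofReal_lt_top), intervalIntegral.integral_of_le zero_le_one,
    integral_Ioc_eq_integral_Ioo]
  refine setIntegral_congr_fun measurableSet_Ioo fun u hu => ?_
  have h1 := mul_pos hu.1 h0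
  have h2 := mul_pos (sub_pos.2 hu.2) h0
  have h3 : u * x.1 i + (1 - u) * x.1 i ≤ 1 := by
    have := le_one x i
    linarith
  simp only [ENNReal.toReal_ofReal (hF.nonneg _ _ h1 h2 h3), smul_eq_mul]

theorem IsBddMeas.sub_const {Φ : Omega1 → ℝ} (h : IsBddMeas Φ) (c : ℝ) :
    IsBddMeas fun y => Φ y - c := by
  obtain ⟨hm, C, hC⟩ := h
  exact ⟨hm.sub_const c, C + |c|, fun x => (abs_sub _ _).trans (by gcongr; exact hC x)⟩

/-- Boundedness of the total rates makes both jump measures finite, hence the integrands integrable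
and the series in the generator equal to integrals. -/
theorem opSharp_eq_integral {K F : ℝ → ℝ → ℝ} (hK : IsRate K) (hF : IsRate F)
    (bK : BoundedCoagRate K) (bF : BoundedFragRate F) {Φ : Omega1 → ℝ} (hΦ : IsBddMeas Φ)
    (x : Omega1) :
    opSharp K F Φ x = ∫ y, (Φ y - Φ x) ∂jumpKernel hK.measurable hF.measurable x := by
  obtain ⟨C₁, h1⟩ := bK
  obtain ⟨C₂, h2⟩ := bF
  have f1 : IsFiniteMeasure (coagMeas K x) :=
    ⟨by rw [coagMeas_univ]; exact (h1 x).trans_lt ENNReal.coe_lt_top⟩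
  have f2 : IsFiniteMeasure (fragMeas F x) :=
    ⟨by rw [fragMeas_univ hF.measurable]; exact (h2 x).trans_lt ENNReal.coe_lt_top⟩
  have hg := hΦ.sub_const (Φ x)
  rw [jumpKernel_apply, integral_smul_measure, integral_add_measure (integrable_of_bdd hg)
    (integrable_of_bdd hg), integral_coagMeas hK x hg, integral_fragMeas hF x hg, opSharp]
  simp only [ENNReal.toReal_inv, ENNReal.toReal_ofNat, smul_eq_mul]
  ring

/-- Coagulation and fragmentation jumps balance under `μ`. -/
def DetailedBalance (K F : ℝ → ℝ → ℝ) (μ : Measure Omega1) : Prop :=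
  ∀ f : Omega1 × Omega1 → ℝ≥0∞, Measurable f →
    ∫⁻ x, ∫⁻ y, f (x, y) ∂coagMeas K x ∂μ = ∫⁻ x, ∫⁻ y, f (y, x) ∂fragMeas F x ∂μ

/-- On a rectangle, detailed balance says that the coagulation flux from `A` to `B` is the
fragmentation flux from `B` to `A`. Using this for `(A, B)` and `(B, A)` exchanges the two summands
of the kernel. -/
theorem DetailedBalance.isReversible {K F : ℝ → ℝ → ℝ} {μ : Measure Omega1}
    (h : DetailedBalance K F μ) (hK : Measurable (Function.uncurry K))
    (hF : Measurable (Function.uncurry F)) : (jumpKernel hK hF).IsReversible μ := by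
  have key : ∀ A B, MeasurableSet A → MeasurableSet B →
      ∫⁻ x in A, coagMeas K x B ∂μ = ∫⁻ x in B, fragMeas F x A ∂μ := fun A B hA hB => by
    have := h ((A ×ˢ B).indicator 1) (measurable_one.indicator (hA.prod hB))
    convert this using 1
    · rw [← lintegral_indicator hA]
      refine lintegral_congr fun x => ?_
      by_cases hx : x ∈ A
      · rw [indicator_of_mem hx, ← lintegral_indicator_one hB]
        refine lintegral_congr fun y => ?_
        by_cases hy : y ∈ B <;> simp [hx, hy]
      · simp [hx]
    · rw [← lintegral_indicator hB]
      refine lintegral_congr fun x => ?_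
      by_cases hx : x ∈ B
      · rw [indicator_of_mem hx, ← lintegral_indicator_one hA]
        refine lintegral_congr fun y => ?_
        by_cases hy : y ∈ A <;> simp [hx, hy]
      · simp [hx]
  intro A B hA hB
  have e : ∀ A B, MeasurableSet A → MeasurableSet B → ∫⁻ x in A, jumpKernel hK hF x B ∂μ =
      2⁻¹ * (∫⁻ x in A, coagMeas K x B ∂μ + ∫⁻ x in A, fragMeas F x B ∂μ) := fun A B _ hB => by
    have m1 : Measurable fun x => coagMeas K x B :=
      (Measure.measurable_coe hB).comp (measurable_coagMeas hK)
    have m2 : Measurable fun x => fragMeas F x B :=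
      (Measure.measurable_coe hB).comp (measurable_fragMeas hF)
    rw [← lintegral_add_left m1]
    exact lintegral_const_mul _ (m1.add m2)
  rw [e A B hA hB, e B A hB hA, key A B hA hB, key B A hB hA, add_comm]

end CoagFrag

end

noncomputable section

namespace CoagFrag

/-! ### Reversible kernels -/

section Kernels

variable {α : Type*} [MeasurableSpace α]

/-- Under a reversible law a kernel moves a density by acting on it as a function. Read as an
equality of measures, reversibility says that `π` with density `κ · B` is the image under `κ` of `π`
restricted to `B`; integrate `f` against both. -/
theorem isReversible_bind_withDensity {κ : Kernel α α} {π : Measure α} (h : κ.IsReversible π)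
    {f : α → ℝ≥0∞} (hf : Measurable f) :
    (π.withDensity f).bind κ = π.withDensity fun y => ∫⁻ z, f z ∂κ y := by
  have key : ∀ B, MeasurableSet B → π.withDensity (fun x => κ x B) = (π.restrict B).bind κ := by
    intro B hB
    ext A hA
    rw [withDensity_apply _ hA, Measure.bind_apply hA κ.aemeasurable]
    exact h hA hB
  ext B hB
  have hm : Measurable fun x => κ x B := κ.measurable_coe hB
  rw [Measure.bind_apply hB κ.aemeasurable, withDensity_apply _ hB,
    lintegral_withDensity_eq_lintegral_mul _ hf hm, ← Measure.lintegral_bind κ.aemeasurable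
      hf.aemeasurable, ← key B hB, lintegral_withDensity_eq_lintegral_mul _ hm hf]
  simp only [Pi.mul_apply, mul_comm]

/-- Self-adjointness of `κ` for the pairing `∫ f g dπ`, the form in which reversibility is used from
here on. -/
theorem isReversible_lintegral_mul {κ : Kernel α α} {π : Measure α} (h : κ.IsReversible π)
    {f g : α → ℝ≥0∞} (hf : Measurable f) (hg : Measurable g) :
    ∫⁻ x, f x * ∫⁻ y, g y ∂κ x ∂π = ∫⁻ x, (∫⁻ y, f y ∂κ x) * g x ∂π := by
  have h1 := congrArg (fun m : Measure α => ∫⁻ y, g y ∂m) (isReversible_bind_withDensity h hf)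
  rw [Measure.lintegral_bind κ.aemeasurable hg.aemeasurable,
    lintegral_withDensity_eq_lintegral_mul _ hf hg.lintegral_kernel,
    lintegral_withDensity_eq_lintegral_mul _ hf.lintegral_kernel hg] at h1
  exact h1

/-- Iterates of a kernel. -/
def kernelPow (κ : Kernel α α) : ℕ → Kernel α α
  | 0 => Kernel.id
  | n + 1 => κ ∘ₖ kernelPow κ n

theorem kernelPow_succ' (κ : Kernel α α) (n : ℕ) : kernelPow κ (n + 1) = kernelPow κ n ∘ₖ κ := by
  induction n with
  | zero => simp [kernelPow]
  | succ n ih => rw [kernelPow, ih, ← Kernel.comp_assoc, ← kernelPow, ih]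

instance isMarkovKernel_kernelPow (κ : Kernel α α) [IsMarkovKernel κ] (n : ℕ) :
    IsMarkovKernel (kernelPow κ n) := by
  induction n with
  | zero => unfold kernelPow; infer_instance
  | succ n ih => unfold kernelPow; infer_instance

theorem isReversible_kernelPow {κ : Kernel α α} {π : Measure α} (h : κ.IsReversible π) (n : ℕ) :
    (kernelPow κ n).IsReversible π := by
  classical
  induction n with
  | zero =>
    intro A B hA hB
    simp only [kernelPow, Kernel.id_apply, Measure.dirac_apply' _ hA, Measure.dirac_apply' _ hB]
    rw [lintegral_indicator_one hB, lintegral_indicator_one hA, Measure.restrict_apply hB,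
      Measure.restrict_apply hA, inter_comm]
  | succ n ih =>
    intro A B hA hB
    -- Peel the extra factor off on one side here and on the other side in `e'`, which is possible
    -- since `κ` commutes with its powers; the two expressions are exchanged by swapping `A` and
    -- `B`.
    have e : ∀ A B, MeasurableSet A → MeasurableSet B → ∫⁻ x in A, kernelPow κ (n + 1) x B ∂π =
        ∫⁻ y, kernelPow κ n y A * κ y B ∂π := fun A B hA hB => by
      have hm : Measurable fun x => κ x B := κ.measurable_coe hB
      have h1 := isReversible_lintegral_mul ih (f := A.indicator 1) (measurable_one.indicator hA) hm
      simp only [lintegral_indicator_one hA] at h1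
      rw [← h1, ← lintegral_indicator hA]
      refine lintegral_congr fun x => ?_
      rw [kernelPow, indicator_apply, Kernel.comp_apply' _ _ _ hB]
      by_cases hx : x ∈ A <;> simp [hx]
    have e' : ∫⁻ x in A, kernelPow κ (n + 1) x B ∂π = ∫⁻ y, κ y A * kernelPow κ n y B ∂π := by
      have hm : Measurable fun x => kernelPow κ n x B := (kernelPow κ n).measurable_coe hB
      have h1 := isReversible_lintegral_mul h (f := A.indicator 1) (measurable_one.indicator hA) hm
      simp only [lintegral_indicator_one hA] at h1
      rw [← h1, ← lintegral_indicator hA]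
      refine lintegral_congr fun x => ?_
      rw [kernelPow_succ', indicator_apply, Kernel.comp_apply' _ _ _ hB]
      by_cases hx : x ∈ A <;> simp [hx]
    rw [e', e B A hB hA]
    simp only [mul_comm]

/-- The Markov kernel `J / C + (1 - J(·, α) / C) id`. -/
def uniformized (J : Kernel α α) (C : ℝ≥0) : Kernel α α :=
  ⟨fun x => (C : ℝ≥0∞)⁻¹ • J x + (1 - (C : ℝ≥0∞)⁻¹ * J x univ) • Measure.dirac x,
    Measure.measurable_of_measurable_coe _ fun B hB => by
      simp only [Measure.add_apply, Measure.smul_apply, smul_eq_mul, Measure.dirac_apply' _ hB]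
      exact ((J.measurable_coe hB).const_mul _).add
        ((measurable_const.sub ((J.measurable_coe .univ).const_mul _)).mul
          (measurable_one.indicator hB))⟩

theorem uniformized_apply (J : Kernel α α) (C : ℝ≥0) (x : α) : uniformized J C x =
    (C : ℝ≥0∞)⁻¹ • J x + (1 - (C : ℝ≥0∞)⁻¹ * J x univ) • Measure.dirac x := rfl

theorem isMarkovKernel_uniformized {J : Kernel α α} {C : ℝ≥0} (hC : 0 < C)
    (h : ∀ x, J x univ ≤ C) : IsMarkovKernel (uniformized J C) := by
  refine ⟨fun x => ⟨?_⟩⟩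
  rw [uniformized_apply, Measure.add_apply, Measure.smul_apply, Measure.smul_apply,
    measure_univ (μ := Measure.dirac x), smul_eq_mul, smul_eq_mul, mul_one]
  refine add_tsub_cancel_of_le ?_
  calc (C : ℝ≥0∞)⁻¹ * J x univ ≤ (C : ℝ≥0∞)⁻¹ * C := by gcongr; exact h x
    _ = 1 := ENNReal.inv_mul_cancel (by simpa using hC.ne') ENNReal.coe_ne_top

/-- The holding part contributes an integral over `A ∩ B`, which is symmetric in `A` and `B`. -/
theorem isReversible_uniformized {J : Kernel α α} {π : Measure α} (h : J.IsReversible π)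
    (C : ℝ≥0) : (uniformized J C).IsReversible π := by
  classical
  have e : ∀ A B, MeasurableSet A → MeasurableSet B → ∫⁻ x in A, uniformized J C x B ∂π =
      (C : ℝ≥0∞)⁻¹ * ∫⁻ x in A, J x B ∂π
        + ∫⁻ x in A ∩ B, (1 - (C : ℝ≥0∞)⁻¹ * J x univ) ∂π := fun A B hA hB => by
    have hm : Measurable fun x => J x B := J.measurable_coe hB
    rw [← lintegral_const_mul _ hm, inter_comm, ← Measure.restrict_restrict hB,
      ← lintegral_indicator hB, ← lintegral_add_left (hm.const_mul _)]
    refine lintegral_congr fun x => ?_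
    rw [uniformized_apply, Measure.add_apply, Measure.smul_apply, Measure.smul_apply,
      Measure.dirac_apply' _ hB, smul_eq_mul, smul_eq_mul, indicator_apply, indicator_apply]
    split_ifs <;> simp
  intro A B hA hB
  rw [e A B hA hB, e B A hB hA, h hA hB, inter_comm]

/-- The weights of the Poisson distribution. -/
def poissonWeight (r : ℝ) (n : ℕ) : ℝ := Real.exp (-r) * (r ^ n / n.factorial)

theorem poissonWeight_nonneg {r : ℝ} (hr : 0 ≤ r) (n : ℕ) : 0 ≤ poissonWeight r n := by
  unfold poissonWeight
  positivity

theorem hasSum_poissonWeight (r : ℝ) : HasSum (poissonWeight r) 1 := by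
  have := (NormedSpace.expSeries_div_hasSum_exp (𝔸 := ℝ) r).mul_left (Real.exp (-r))
  rw [← Real.exp_eq_exp_ℝ, ← Real.exp_add, neg_add_cancel, Real.exp_zero] at this
  exact this

/-- The Poissonized kernel `∑ₙ e^{-r} rⁿ / n! κⁿ`. -/
def poissonized (κ : Kernel α α) (r : ℝ) : Kernel α α :=
  ⟨fun x => Measure.sum fun n => ENNReal.ofReal (poissonWeight r n) • kernelPow κ n x,
    Measure.measurable_of_measurable_coe _ fun B hB => by
      simp only [Measure.sum_apply _ hB, Measure.smul_apply, smul_eq_mul]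
      exact Measurable.tsum fun n => ((kernelPow κ n).measurable_coe hB).const_mul _⟩

theorem poissonized_apply (κ : Kernel α α) (r : ℝ) (x : α) : poissonized κ r x =
    Measure.sum fun n => ENNReal.ofReal (poissonWeight r n) • kernelPow κ n x := rfl

theorem isMarkovKernel_poissonized (κ : Kernel α α) [IsMarkovKernel κ] {r : ℝ} (hr : 0 ≤ r) :
    IsMarkovKernel (poissonized κ r) := by
  refine ⟨fun x => ⟨?_⟩⟩
  rw [poissonized_apply, Measure.sum_apply _ .univ]
  simp only [Measure.smul_apply, measure_univ, smul_eq_mul, mul_one]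
  rw [← ENNReal.ofReal_tsum_of_nonneg (poissonWeight_nonneg hr) (hasSum_poissonWeight r).summable,
    (hasSum_poissonWeight r).tsum_eq, ENNReal.ofReal_one]

theorem isReversible_poissonized {κ : Kernel α α} {π : Measure α} (h : κ.IsReversible π) (r : ℝ) :
    (poissonized κ r).IsReversible π := by
  have e : ∀ A B, MeasurableSet A → MeasurableSet B → ∫⁻ x in A, poissonized κ r x B ∂π =
      ∑' n, ENNReal.ofReal (poissonWeight r n) * ∫⁻ x in A, kernelPow κ n x B ∂π :=
    fun A B hA hB => by
      have hm : ∀ n, Measurable fun x => kernelPow κ n x B := fun n =>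
        (kernelPow κ n).measurable_coe hB
      simp_rw [← fun n => lintegral_const_mul (μ := π.restrict A)
        (ENNReal.ofReal (poissonWeight r n)) (hm n)]
      rw [← lintegral_tsum fun n => ((hm n).const_mul _).aemeasurable]
      refine lintegral_congr fun x => ?_
      rw [poissonized_apply, Measure.sum_apply _ hB]
      rfl
  intro A B hA hB
  rw [e A B hA hB, e B A hB hA]
  exact tsum_congr fun n => by rw [isReversible_kernelPow h n hA hB]

end Kernels

/-! ### The transition function -/

theorem IsBddMeas.integral_kernel {Φ : Omega1 → ℝ} (h : IsBddMeas Φ)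
    (κ : Kernel Omega1 Omega1) [IsMarkovKernel κ] : IsBddMeas fun x => ∫ y, Φ y ∂κ x := by
  obtain ⟨hm, C, hC⟩ := h
  refine ⟨hm.stronglyMeasurable.integral_kernel.measurable, C, fun x => ?_⟩
  have := norm_integral_le_of_norm_le_const (μ := κ x) (f := Φ) (ae_of_all _ fun y => hC y)
  simpa using this

theorem integral_kernelPow_succ {Φ : Omega1 → ℝ} (h : IsBddMeas Φ)
    (κ : Kernel Omega1 Omega1) [IsMarkovKernel κ] (n : ℕ) (x : Omega1) :
    ∫ y, Φ y ∂kernelPow κ (n + 1) x = ∫ y, (∫ z, Φ z ∂κ y) ∂kernelPow κ n x := by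
  rw [kernelPow]
  exact Kernel.integral_comp (integrable_of_bdd h)

/-- The purpose of uniformization: the generator becomes `C (κ - 1)` with `κ` Markov. Jumps from `x`
to itself cancel on both sides, so the holding probability is invisible. -/
theorem uniformized_generator {J : Kernel Omega1 Omega1} {C : ℝ≥0} (hC : 0 < C)
    (h : ∀ x, J x univ ≤ C) {Φ : Omega1 → ℝ} (hΦ : IsBddMeas Φ) (x : Omega1) :
    ∫ y, (Φ y - Φ x) ∂J x = C * (∫ y, Φ y ∂uniformized J C x - Φ x) := by
  have f1 : IsFiniteMeasure (J x) := ⟨(h x).trans_lt ENNReal.coe_lt_top⟩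
  have hle : (C : ℝ≥0∞)⁻¹ * J x univ ≤ 1 := by
    calc (C : ℝ≥0∞)⁻¹ * J x univ ≤ (C : ℝ≥0∞)⁻¹ * C := by gcongr; exact h x
      _ = 1 := ENNReal.inv_mul_cancel (by simpa using hC.ne') ENNReal.coe_ne_top
  have hC' : (C : ℝ) ≠ 0 := by exact_mod_cast hC.ne'
  have i1 := integrable_of_bdd (ν := J x) hΦ
  have i2 := integrable_of_bdd (ν := Measure.dirac x) hΦ
  rw [uniformized_apply, integral_add_measure (i1.smul_measure (by simpa using hC.ne'))
    (i2.smul_measure (ne_top_of_le_ne_top ENNReal.one_ne_top tsub_le_self)),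
    integral_smul_measure, integral_smul_measure, integral_dirac' _ _ hΦ.1.stronglyMeasurable,
    integral_sub i1 (integrable_const _), integral_const, ENNReal.toReal_sub_of_le hle (by simp),
    ENNReal.toReal_mul, ENNReal.toReal_inv]
  simp only [ENNReal.coe_toReal, smul_eq_mul, ENNReal.toReal_one, Measure.real]
  field_simp
  ring

/-- Binomial expansion of `(C (κ - 1))^n`. The form of `L` is known only on bounded measurable
functions, so the induction runs over all of them and `L Φ` has to be shown to be one. -/
theorem iterate_generator {κ : Kernel Omega1 Omega1} [IsMarkovKernel κ] {C : ℝ}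
    {L : (Omega1 → ℝ) → Omega1 → ℝ}
    (hL : ∀ Φ, IsBddMeas Φ → ∀ x, L Φ x = C * (∫ y, Φ y ∂κ x - Φ x)) (n : ℕ) :
    ∀ Φ, IsBddMeas Φ → ∀ x, L^[n] Φ x = C ^ n * ∑ ij ∈ Finset.HasAntidiagonal.antidiagonal n,
      (n.choose ij.1 : ℝ) * ((-1) ^ ij.2 * ∫ y, Φ y ∂kernelPow κ ij.1 x) := by
  induction n with
  | zero =>
    intro Φ hΦ x
    simp [kernelPow, Kernel.id_apply, integral_dirac' _ _ hΦ.1.stronglyMeasurable]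
  | succ n ih =>
    intro Φ hΦ x
    have hb : IsBddMeas (L Φ) := by
      have e : L Φ = fun x => C * (∫ y, Φ y ∂κ x - Φ x) := funext (hL Φ hΦ)
      obtain ⟨hm, D, hD⟩ := hΦ.integral_kernel κ
      obtain ⟨hm', D', hD'⟩ := hΦ
      rw [e]
      refine ⟨(hm.sub hm').const_mul C, |C| * (D + D'), fun x => ?_⟩
      rw [abs_mul]
      gcongr
      exact (abs_sub _ _).trans (add_le_add (hD x) (hD' x))
    have hU : ∀ k, ∫ y, L Φ y ∂kernelPow κ k x =
        C * (∫ y, Φ y ∂kernelPow κ (k + 1) x - ∫ y, Φ y ∂kernelPow κ k x) := fun k => by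
      rw [integral_kernelPow_succ hΦ, ← integral_sub (integrable_of_bdd (hΦ.integral_kernel κ))
        (integrable_of_bdd hΦ), ← integral_const_mul]
      exact integral_congr_ae (ae_of_all _ (hL Φ hΦ))
    rw [Function.iterate_succ_apply, ih _ hb,
      Finset.sum_antidiagonal_choose_succ_mul
        (fun i j => (-1 : ℝ) ^ j * ∫ y, Φ y ∂kernelPow κ i x), pow_succ, mul_assoc,
      ← Finset.sum_add_distrib, Finset.mul_sum, Finset.mul_sum, Finset.mul_sum]
    refine Finset.sum_congr rfl fun ij hij => ?_
    -- Pascal's rule leaves one of the two sums with `ij.2` as the lower index.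
    have hs : (n.choose ij.2 : ℝ) = n.choose ij.1 := by
      rw [Nat.choose_symm_of_eq_add (Finset.HasAntidiagonal.mem_antidiagonal.1 hij).symm]
    rw [hU, hs]
    ring

/-- This is `e^{tC(κ - 1)} = e^{-tC} e^{tCκ}`: the Cauchy product of the two exponential series
regroups, by the binomial expansion, into the series of `e^{tL}`. -/
theorem integral_poissonized {κ : Kernel Omega1 Omega1} [IsMarkovKernel κ] {C : ℝ≥0}
    {L : (Omega1 → ℝ) → Omega1 → ℝ}
    (hL : ∀ Φ, IsBddMeas Φ → ∀ x, L Φ x = C * (∫ y, Φ y ∂κ x - Φ x)) (t : ℝ≥0)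
    {Φ : Omega1 → ℝ} (hΦ : IsBddMeas Φ) (x : Omega1) :
    ∫ y, Φ y ∂poissonized κ (t * C) x = expSemigroup L t Φ x := by
  have hr : (0 : ℝ) ≤ t * C := by positivity
  have hM := isMarkovKernel_poissonized κ hr
  have h1 := hasSum_integral_measure (integrable_of_bdd (ν := poissonized κ (t * C) x) hΦ)
  have h2 : ∫ y, Φ y ∂poissonized κ (t * C) x = ∑' n, poissonWeight (t * C) n *
      ∫ y, Φ y ∂kernelPow κ n x := by
    refine Eq.trans h1.tsum_eq.symm (tsum_congr fun n => ?_)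
    rw [integral_smul_measure, ENNReal.toReal_ofReal (poissonWeight_nonneg hr n), smul_eq_mul]
  obtain ⟨D, hD⟩ := hΦ.2
  have hexp : ∀ r : ℝ, HasSum (fun n : ℕ => r ^ n / n.factorial) (Real.exp r) := fun r => by
    rw [Real.exp_eq_exp_ℝ]
    exact NormedSpace.expSeries_div_hasSum_exp (𝔸 := ℝ) r
  have s1 : Summable fun n : ℕ =>
      ‖(t * C : ℝ) ^ n / n.factorial * ∫ y, Φ y ∂kernelPow κ n x‖ := by
    refine Summable.of_nonneg_of_le (fun _ => norm_nonneg _) (fun n => ?_)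
      ((hexp (t * C)).summable.mul_right D)
    rw [norm_mul, Real.norm_of_nonneg (by positivity : (0 : ℝ) ≤ (t * C : ℝ) ^ n / n.factorial)]
    gcongr
    have := norm_integral_le_of_norm_le_const (μ := kernelPow κ n x) (f := Φ)
      (ae_of_all _ fun y => hD y)
    simpa using this
  have s2 : Summable fun n : ℕ => ‖(-(t * C) : ℝ) ^ n / n.factorial‖ := by
    refine (hexp (t * C)).summable.congr fun n => ?_
    rw [norm_div, norm_pow, norm_neg, Real.norm_of_nonneg hr]
    simp
  have h3 := tsum_mul_tsum_eq_tsum_sum_antidiagonal_of_summable_norm s1 s2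
  rw [(hexp _).tsum_eq] at h3
  rw [h2, expSemigroup]
  simp only [poissonWeight, mul_assoc]
  rw [tsum_mul_left, mul_comm, h3]
  refine tsum_congr fun n => ?_
  rw [iterate_generator hL n Φ hΦ x, Finset.mul_sum, Finset.mul_sum]
  refine Finset.sum_congr rfl fun ij hij => ?_
  have hn := Finset.HasAntidiagonal.mem_antidiagonal.1 hij
  have hc : ((n.choose ij.1 : ℕ) : ℝ) = n.factorial / (ij.1.factorial * ij.2.factorial) := by
    rw [← hn, Nat.cast_add_choose]
  have hf : (n.factorial : ℝ) ≠ 0 := by positivity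
  have e : ∀ a : ℝ, a ^ n = a ^ ij.1 * a ^ ij.2 := fun a => by rw [← hn, pow_add]
  rw [hc, neg_pow, e t, e C, mul_pow, mul_pow]
  field_simp

end CoagFrag

end

noncomputable section

namespace CoagFrag

/-! ### Finite-dimensional distributions of reversible Markov processes -/

section Paths

variable {α : Type*} [MeasurableSpace α]

/-- The density, with respect to a reversible initial law, of the position at the `n`-th time on the
event that the `i`-th position lies in `A i` for all `i ≤ n`. -/
def pathDensity (κ : ℕ → Kernel α α) (A : ℕ → Set α) : ℕ → α → ℝ≥0∞
  | 0 => (A 0).indicator 1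
  | n + 1 => fun x => (A (n + 1)).indicator 1 x * ∫⁻ y, pathDensity κ A n y ∂κ n x

theorem measurable_pathDensity (κ : ℕ → Kernel α α) {A : ℕ → Set α}
    (hA : ∀ n, MeasurableSet (A n)) (n : ℕ) : Measurable (pathDensity κ A n) := by
  induction n with
  | zero => exact measurable_one.indicator (hA 0)
  | succ n ih => exact (measurable_one.indicator (hA _)).mul ih.lintegral_kernel

/-- The probability of a path of sets can be computed from either end, because each kernel in the
chain can be moved to the other factor by self-adjointness. -/
theorem lintegral_pathDensity_reverse {κ κ' : ℕ → Kernel α α} {A A' : ℕ → Set α} {π : Measure α}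
    (hκ : ∀ n, (κ n).IsReversible π) (hA : ∀ n, MeasurableSet (A n))
    (hA' : ∀ n, MeasurableSet (A' n)) {N : ℕ} (hκ' : ∀ i j, i + j + 1 = N → κ' i = κ j)
    (hAA' : ∀ i j, i + j = N → A' i = A j) :
    ∫⁻ x, pathDensity κ A N x ∂π = ∫⁻ x, pathDensity κ' A' N x ∂π := by
  -- The path is cut between times `k` and `k + 1`: the factors are the forward density of `A 0, …,
  -- A k` and the backward density of `A N, …, A (k + 1)`. The cut moves from the end of the path to
  -- its beginning.
  have step : ∀ m k, k + m + 1 = N → ∫⁻ x, pathDensity κ A N x ∂π =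
      ∫⁻ x, pathDensity κ A k x * ∫⁻ y, pathDensity κ' A' m y ∂κ k x ∂π := by
    intro m
    induction m with
    | zero =>
      intro k hk
      rw [isReversible_lintegral_mul (hκ k) (measurable_pathDensity κ hA k)
        (measurable_pathDensity κ' hA' 0)]
      obtain rfl : N = k + 1 := by omega
      simp only [pathDensity, hAA' 0 (k + 1) (by omega), mul_comm]
    | succ m ih =>
      intro k hk
      rw [ih (k + 1) (by omega), isReversible_lintegral_mul (hκ k) (measurable_pathDensity κ hA k)
        (measurable_pathDensity κ' hA' (m + 1))]
      refine lintegral_congr fun x => ?_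
      simp only [pathDensity, hAA' (m + 1) (k + 1) (by omega), hκ' m (k + 1) (by omega)]
      ring
  cases N with
  | zero => simp only [pathDensity, hAA' 0 0 rfl]
  | succ n =>
    rw [step n 0 (by omega)]
    simp only [pathDensity, hAA' (n + 1) 0 (by omega), hκ' n 0 (by omega)]

end Paths

section Transition

/-- The σ-algebra of the past up to time `s`. -/
abbrev past {S : Type u} (X : ℝ≥0 → S → Omega1) (s : ℝ≥0) : MeasurableSpace S :=
  ⨆ r : {r : ℝ≥0 // r ≤ s}, MeasurableSpace.comap (X r) inferInstance

theorem measurableSet_past {S : Type u} {X : ℝ≥0 → S → Omega1} {r s : ℝ≥0} (h : r ≤ s) {B : Set Omega1} (hB : MeasurableSet B) :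
    MeasurableSet[past X s] (X r ⁻¹' B) :=
  (le_iSup (fun r : {r : ℝ≥0 // r ≤ s} => MeasurableSpace.comap (X r) inferInstance) ⟨r, h⟩)
    _ ⟨B, hB, rfl⟩

theorem measurableSet_path {S : Type u} {X : ℝ≥0 → S → Omega1} {N : ℕ} {s : ℕ → ℝ≥0} (hs : Monotone s) {A : ℕ → Set Omega1}
    (hA : ∀ n, MeasurableSet (A n)) :
    MeasurableSet[past X (s N)] {ω | ∀ i ≤ N, X (s i) ω ∈ A i} := by
  have : {ω | ∀ i ≤ N, X (s i) ω ∈ A i} = ⋂ i, ⋂ (_ : i ≤ N), X (s i) ⁻¹' A i := by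
    ext ω
    simp
  rw [this]
  exact MeasurableSet.iInter fun i => MeasurableSet.iInter fun hi =>
    measurableSet_past (hs hi) (hA i)

theorem isBddMeas_indicator {B : Set Omega1} (hB : MeasurableSet B) :
    IsBddMeas (B.indicator 1) := by
  classical
  refine ⟨measurable_one.indicator hB, 1, fun x => ?_⟩
  rw [indicator_apply]
  split_ifs <;> simp

variable {S : Type u} [MeasurableSpace S] {L : (Omega1 → ℝ) → Omega1 → ℝ} {P : Measure S}
  {X : ℝ≥0 → S → Omega1} {p : ℝ≥0 → Kernel Omega1 Omega1}

/-- The Markov property for the indicator of `B`, integrated over an event of the past; finiteness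
of all quantities allows the passage from real integrals to `ℝ≥0∞`. -/
theorem measure_past_inter [IsProbabilityMeasure P] (hX : IsGeneratedBy L P X)
    (hp : IsTransitionFunction L p) (s t : ℝ≥0) {E : Set S} (hE : MeasurableSet[past X s] E)
    {B : Set Omega1} (hB : MeasurableSet B) :
    P (E ∩ X (s + t) ⁻¹' B) = ∫⁻ ω in E, p t (X s ω) B ∂P := by
  have hM := (hp t).1
  have hle : past X s ≤ ‹MeasurableSpace S› := iSup_le fun r => (hX.measurable r).comap_le
  have hΦ := isBddMeas_indicator hB
  have hXB : MeasurableSet (X (s + t) ⁻¹' B) := hX.measurable _ hB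
  have e0 : (fun ω => B.indicator (1 : Omega1 → ℝ) (X (s + t) ω)) =
      (X (s + t) ⁻¹' B).indicator 1 := rfl
  have h1 : ∫ ω in E, (P[fun ω => B.indicator (1 : Omega1 → ℝ) (X (s + t) ω) | past X s]) ω ∂P =
      ∫ ω in E, B.indicator (1 : Omega1 → ℝ) (X (s + t) ω) ∂P :=
    setIntegral_condExp hle (by
      rw [e0]
      exact (integrable_const (1 : ℝ)).indicator hXB) hE
  rw [setIntegral_congr_ae (g := fun ω => (p t (X s ω)).real B) (hle _ hE)
    ((hX.markov s t _ hΦ).mono fun ω hω _ => hω.trans ?_)] at h1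
  · rw [e0, integral_indicator_one hXB, measureReal_restrict_apply hXB,
      integral_eq_lintegral_of_nonneg_ae (ae_of_all _ fun _ => measureReal_nonneg)
        ((((p t).measurable_coe hB).comp (hX.measurable s)).ennreal_toReal.aestronglyMeasurable)]
      at h1
    simp only [Measure.real, ENNReal.ofReal_toReal (measure_ne_top _ _)] at h1
    rw [inter_comm]
    refine ((ENNReal.toReal_eq_toReal_iff' ?_ (measure_ne_top _ _)).1 h1).symm
    refine ne_top_of_le_ne_top (measure_ne_top P E) ?_
    calc ∫⁻ ω in E, p t (X s ω) B ∂P ≤ ∫⁻ _ in E, 1 ∂P := lintegral_mono fun _ => prob_le_one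
      _ = P E := by simp
  · exact ((hp t).2 _ hΦ (X s ω)).symm.trans (integral_indicator_one hB)

theorem map_eq_of_isReversible [IsProbabilityMeasure P] {μ : Measure Omega1}
    (hX : IsGeneratedBy L P X) (hp : IsTransitionFunction L p) (hr : ∀ t, (p t).IsReversible μ)
    (h0 : P.map (X 0) = μ) (s : ℝ≥0) : P.map (X s) = μ := by
  ext B hB
  have hM := (hp s).1
  have h := measure_past_inter hX hp 0 s (MeasurableSet.univ) hB
  rw [zero_add, univ_inter, Measure.restrict_univ] at h
  rw [Measure.map_apply (hX.measurable s) hB, h,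
    ← lintegral_map (f := fun x => p s x B) ((p s).measurable_coe hB) (hX.measurable 0), h0]
  have := hr s MeasurableSet.univ hB
  simpa using this

/-- The Markov property appends one kernel to the law at the last time, and reversibility turns its
action on that law into an action on the density with respect to `μ`. -/
theorem map_restrict_path [IsProbabilityMeasure P] {μ : Measure Omega1}
    (hX : IsGeneratedBy L P X) (hp : IsTransitionFunction L p) (hr : ∀ t, (p t).IsReversible μ)
    (h0 : P.map (X 0) = μ) {s : ℕ → ℝ≥0} (hs : Monotone s) {A : ℕ → Set Omega1}
    (hA : ∀ n, MeasurableSet (A n)) (n : ℕ) :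
    (P.restrict {ω | ∀ i ≤ n, X (s i) ω ∈ A i}).map (X (s n)) =
      μ.withDensity (pathDensity (fun n => p (s (n + 1) - s n)) A n) := by
  induction n with
  | zero =>
    ext B hB
    have e : {ω | ∀ i ≤ 0, X (s i) ω ∈ A i} = X (s 0) ⁻¹' A 0 := by
      ext ω
      simp
    rw [Measure.map_apply (hX.measurable _) hB, Measure.restrict_apply (hX.measurable _ hB), e,
      ← preimage_inter, ← Measure.map_apply (hX.measurable _) (hB.inter (hA 0)),
      map_eq_of_isReversible hX hp hr h0, pathDensity, withDensity_indicator_one (hA 0),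
      Measure.restrict_apply hB]
  | succ n ih =>
    ext B hB
    have hm := measurable_pathDensity (fun n => p (s (n + 1) - s n)) hA n
    have e : X (s (n + 1)) ⁻¹' B ∩ {ω | ∀ i ≤ n + 1, X (s i) ω ∈ A i} =
        {ω | ∀ i ≤ n, X (s i) ω ∈ A i} ∩ X (s n + (s (n + 1) - s n)) ⁻¹' (A (n + 1) ∩ B) := by
      rw [add_tsub_cancel_of_le (hs n.le_succ)]
      ext ω
      simp only [mem_inter_iff, mem_preimage, mem_ofPred_eq]
      constructor
      · rintro ⟨h1, h2⟩
        exact ⟨fun i hi => h2 i (by omega), h2 _ le_rfl, h1⟩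
      · rintro ⟨h1, h2, h3⟩
        refine ⟨h3, fun i hi => ?_⟩
        rcases Nat.le_succ_iff.1 hi with h | rfl
        · exact h1 i h
        · exact h2
    rw [Measure.map_apply (hX.measurable _) hB, Measure.restrict_apply (hX.measurable _ hB), e,
      measure_past_inter hX hp _ _ (measurableSet_path hs hA) ((hA _).inter hB),
      ← lintegral_map (f := fun x => p (s (n + 1) - s n) x (A (n + 1) ∩ B))
        ((p _).measurable_coe ((hA _).inter hB)) (hX.measurable _), ih,
      ← Measure.bind_apply ((hA _).inter hB) (p _).aemeasurable,
      isReversible_bind_withDensity (hr _) hm, withDensity_apply _ ((hA _).inter hB),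
      withDensity_apply _ hB, ← lintegral_indicator ((hA _).inter hB), ← lintegral_indicator hB]
    refine lintegral_congr fun x => ?_
    by_cases h1 : x ∈ A (n + 1) <;> by_cases h2 : x ∈ B <;> simp [pathDensity, h1, h2]

theorem measure_path [IsProbabilityMeasure P] {μ : Measure Omega1}
    (hX : IsGeneratedBy L P X) (hp : IsTransitionFunction L p) (hr : ∀ t, (p t).IsReversible μ)
    (h0 : P.map (X 0) = μ) {s : ℕ → ℝ≥0} (hs : Monotone s) {A : ℕ → Set Omega1}
    (hA : ∀ n, MeasurableSet (A n)) (n : ℕ) :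
    P {ω | ∀ i ≤ n, X (s i) ω ∈ A i} =
      ∫⁻ x, pathDensity (fun n => p (s (n + 1) - s n)) A n x ∂μ := by
  have h := congrArg (fun m : Measure Omega1 => m univ) (map_restrict_path hX hp hr h0 hs hA n)
  simpa [Measure.map_apply (hX.measurable _)] using h

theorem isReversibleProcess_of_isReversible [IsProbabilityMeasure P] {μ : Measure Omega1}
    (hX : IsGeneratedBy L P X) (hp : IsTransitionFunction L p) (hr : ∀ t, (p t).IsReversible μ)
    (h0 : P.map (X 0) = μ) : IsReversibleProcess P X := by
  intro T n t ht
  have m1 : Measurable fun ω i => X (t i) ω := measurable_pi_iff.2 fun i => hX.measurable _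
  have m2 : Measurable fun ω i => X (T - t i) ω := measurable_pi_iff.2 fun i => hX.measurable _
  have p1 : IsProbabilityMeasure (P.map fun ω i => X (t i) ω) :=
    Measure.isProbabilityMeasure_map m1.aemeasurable
  have p2 : IsProbabilityMeasure (P.map fun ω i => X (T - t i) ω) :=
    Measure.isProbabilityMeasure_map m2.aemeasurable
  refine ext_of_generate_finite _ generateFrom_pi.symm isPiSystem_pi ?_ (by simp)
  rintro _ ⟨B, hB, rfl⟩
  have hB' : ∀ i, MeasurableSet (B i) := fun i => hB i (mem_univ i)
  have hBm : MeasurableSet (univ.pi B) := MeasurableSet.univ_pi hB'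
  rw [Measure.map_apply m1 hBm, Measure.map_apply m2 hBm]
  cases n with
  | zero =>
    congr 2
    exact funext fun ω => Subsingleton.elim _ _
  | succ N =>
    let σ : Equiv.Perm (Fin (N + 1)) := Tuple.sort t
    have hσ : Monotone (t ∘ σ) := Tuple.monotone_sort t
    -- Clamping at `N` extends the sorted times to a monotone sequence on `ℕ`, as the path formula
    -- requires.
    let c : ℕ → Fin (N + 1) := fun i => ⟨min i N, by omega⟩
    have hc : ∀ i : Fin (N + 1), c i = i := fun i => Fin.ext (by simp only [c]; omega)
    have hc2 : Monotone c := fun i j hij => by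
      simp only [c, Fin.mk_le_mk]
      omega
    have hc3 : Antitone fun i => c (N - i) := fun i j hij => hc2 (by omega)
    have hs : Monotone fun i => t (σ (c i)) := hσ.comp hc2
    -- The reversed times `T - t` increase when the sorted times are read backwards.
    have hs' : Monotone fun i => T - t (σ (c (N - i))) := fun i j hij =>
      tsub_le_tsub_left (hσ (hc3 hij)) T
    have e1 : (fun ω i => X (t i) ω) ⁻¹' univ.pi B =
        {ω | ∀ i ≤ N, X (t (σ (c i))) ω ∈ B (σ (c i))} := by
      ext ω
      simp only [mem_preimage, Set.mem_pi, mem_univ, true_imp_iff, mem_ofPred_eq]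
      refine ⟨fun h i _ => h _, fun h i => ?_⟩
      have := h (σ.symm i) (by omega)
      rwa [hc, Equiv.apply_symm_apply] at this
    have e2 : (fun ω i => X (T - t i) ω) ⁻¹' univ.pi B =
        {ω | ∀ i ≤ N, X (T - t (σ (c (N - i)))) ω ∈ B (σ (c (N - i)))} := by
      ext ω
      simp only [mem_preimage, Set.mem_pi, mem_univ, true_imp_iff, mem_ofPred_eq]
      refine ⟨fun h i _ => h _, fun h i => ?_⟩
      have := h (N - σ.symm i) (by omega)
      rwa [show N - (N - (σ.symm i : ℕ)) = σ.symm i by omega, hc, Equiv.apply_symm_apply] at this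
    rw [e1, e2, measure_path hX hp hr h0 hs (A := fun i => B (σ (c i))) (fun _ => hB' _),
      measure_path hX hp hr h0 hs' (A := fun i => B (σ (c (N - i)))) (fun _ => hB' _)]
    refine lintegral_pathDensity_reverse (fun _ => hr _) (fun _ => hB' _) (fun _ => hB' _) ?_ ?_
    · intro i j hij
      congr 1
      rw [show N - (i + 1) = j by omega, show N - i = j + 1 by omega]
      -- Reversal preserves the gaps between successive times; subtraction in `ℝ≥0` is truncated, so
      -- `t ≤ T` is needed.
      exact tsub_tsub_tsub_cancel_left (ht _)
    · intro i j hij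
      simp only [show N - i = j by omega]

end Transition

theorem reversibleWrt_of_jumpKernel {L : (Omega1 → ℝ) → Omega1 → ℝ} {J : Kernel Omega1 Omega1}
    {μ : Measure Omega1} {C : ℝ≥0} (hC : 0 < C) (hJ : ∀ x, J x univ ≤ C)
    (hL : ∀ Φ, IsBddMeas Φ → ∀ x, L Φ x = ∫ y, (Φ y - Φ x) ∂J x) (hr : J.IsReversible μ) :
    ReversibleWrt.{u} L μ := by
  have hM := isMarkovKernel_uniformized hC hJ
  have hp : IsTransitionFunction L fun t : ℝ≥0 => poissonized (uniformized J C) (t * C) :=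
    fun t => ⟨isMarkovKernel_poissonized _ (by positivity), fun Φ hΦ x =>
      integral_poissonized (fun Φ hΦ x => by
        rw [hL Φ hΦ x, uniformized_generator hC hJ hΦ]) t hΦ x⟩
  have hpr : ∀ t : ℝ≥0, (poissonized (uniformized J C) (t * C)).IsReversible μ := fun t =>
    isReversible_poissonized (isReversible_uniformized hr C) _
  exact ⟨⟨_, hp, hpr⟩, fun S _ P _ X hX h0 => isReversibleProcess_of_isReversible hX hp hpr h0⟩

theorem DetailedBalance.reversibleWrt {K F : ℝ → ℝ → ℝ} {μ : Measure Omega1}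
    (h : DetailedBalance K F μ) (hK : IsRate K) (hF : IsRate F) (bK : BoundedCoagRate K)
    (bF : BoundedFragRate F) : ReversibleWrt.{u} (opSharp K F) μ := by
  obtain ⟨C, hC, hJ⟩ := exists_jumpKernel_le hK.measurable hF.measurable bK bF
  exact reversibleWrt_of_jumpKernel hC hJ (fun _ hΦ x => opSharp_eq_integral hK hF bK bF hΦ x)
    (h.isReversible _ _)

end CoagFrag

end

noncomputable section

namespace CoagFrag

/-! ### Recovering the state from its point configuration -/

/-- The numbers of points above the positive rational levels. -/
def tailCount (ζ : PointConfig) (q : ℚ) : ℝ≥0∞ := if 0 < q then ζ.1 (Ioi (q : ℝ)) else 0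

theorem measurable_tailCount : Measurable tailCount := by
  refine measurable_pi_iff.2 fun q => ?_
  unfold tailCount
  split_ifs
  · exact (Measure.measurable_coe measurableSet_Ioi).comp measurable_subtype_coe
  · exact measurable_const

/-- Only the finiteness of the counts of `config x` is needed, so `ζ` may be any configuration;
hence the range of `config` can be recognized from tail counts. -/
theorem eq_config_of_tailCount {ζ : PointConfig} {x : Omega1}
    (h : tailCount (config x) = tailCount ζ) : config x = ζ := by
  refine Subtype.ext (measure_ext_of_Ioi_rat (config x).2.1 ζ.2.1 (fun q hq => ?_) fun q hq => ?_)
  · have hq' : (0 : ℝ) < q := by exact_mod_cast hq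
    rw [config_val, pointSum_Ioi _ hq'.le,
      (finite_superlevel x.2.2.2.summable hq').encard_eq_coe_toFinset_card]
    simp
  · have := congrFun h q
    simpa only [tailCount, if_pos hq] using this

/-! ### Measurable recovery of a state on a standard Borel space -/

instance standardBorelSpace_Omega1 : StandardBorelSpace Omega1 := by
  have h : {x : ℕ → ℝ | Antitone x ∧ (∀ i, 0 ≤ x i) ∧ HasSum x 1} =
      (⋂ i, {x : ℕ → ℝ | x (i + 1) ≤ x i}) ∩ {w : ℕ → ℝ | (∀ i, 0 ≤ w i) ∧ HasSum w 1} := by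
    ext x
    simp only [mem_ofPred_eq, mem_inter_iff, mem_iInter]
    exact and_congr_left fun _ => ⟨fun h i => h i.le_succ, antitone_nat_of_succ_le⟩
  refine MeasurableSet.standardBorel (s := {x | Antitone x ∧ (∀ i, 0 ≤ x i) ∧ HasSum x 1}) ?_
  rw [h]
  have hm : ∀ i, MeasurableSet {x : ℕ → ℝ | x (i + 1) ≤ x i} := fun i =>
    measurableSet_le (measurable_pi_apply _) (measurable_pi_apply _)
  exact (MeasurableSet.iInter hm).inter measurableSet_prob

/-- Lusin–Souslin: an injective measurable map from a standard Borel space into the countable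
product `ℚ → ℝ≥0∞` is an embedding. It provides a measurable inverse of `config` and the
measurability of its range. -/
theorem measurableEmbedding_tailCount_config : MeasurableEmbedding (tailCount ∘ config) :=
  (measurable_tailCount.comp measurable_config).measurableEmbedding fun _ _ h =>
    config_injective (eq_config_of_tailCount h)

theorem exists_measurable_leftInverse_config :
    ∃ T : PointConfig → Omega1, Measurable T ∧ ∀ x, T (config x) = x := by
  obtain ⟨g, hg, h⟩ := measurableEmbedding_tailCount_config.exists_measurable_extend
    (g := id) measurable_id fun _ => ⟨oneBlock⟩
  exact ⟨g ∘ tailCount, hg.comp measurable_tailCount, fun x => congrFun h x⟩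

theorem measurableSet_range_config : MeasurableSet (range config) := by
  have h : range config = tailCount ⁻¹' range (tailCount ∘ config) := by
    ext ζ
    constructor
    · rintro ⟨x, rfl⟩
      exact ⟨x, rfl⟩
    · rintro ⟨x, hx⟩
      exact ⟨x, eq_config_of_tailCount hx⟩
  rw [h]
  exact measurable_tailCount measurableEmbedding_tailCount_config.measurableSet_range

theorem measurable_addPoint {α : Type*} [MeasurableSpace α] {η : α → PointConfig} {z : α → ℝ}
    (hη : Measurable η) (hz : Measurable z) : Measurable fun a => addPoint (η a) (z a) := by
  refine Measurable.subtype_mk (Measure.measurable_of_measurable_coe _ fun B hB => ?_)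
  simp only [Measure.add_apply]
  exact ((Measure.measurable_coe hB).comp (measurable_subtype_coe.comp hη)).add
    ((Measure.measurable_coe hB).comp (measurable_pointMass.comp hz))

theorem config_mergeVal {v : ℝ × ℝ} (h1 : 0 < v.1) (h2 : 0 < v.2) {x : Omega1} {η : PointConfig}
    (h : config x = addPoint (addPoint η v.1) v.2) :
    config (mergeVal v x) = addPoint η (v.1 + v.2) :=
  Subtype.ext (pointSum_mergeVal h1 h2 (congrArg Subtype.val h))

theorem config_splitVal {v : ℝ × ℝ} (h1 : 0 < v.1) (h2 : 0 < v.2) {x : Omega1} {η : PointConfig}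
    (h : config x = addPoint η (v.1 + v.2)) :
    config (splitVal v x) = addPoint (addPoint η v.1) v.2 :=
  Subtype.ext (pointSum_splitVal h1 h2 (congrArg Subtype.val h))

/-! ### A change of variables -/

theorem lintegral_Ioo_mul {g : ℝ → ℝ≥0∞} (hg : Measurable g) {z : ℝ} (hz : 0 < z) :
    ENNReal.ofReal z * ∫⁻ u in Ioo (0 : ℝ) 1, g (u * z) = ∫⁻ a in Ioo 0 z, g a := by
  have h1 : ∫⁻ a in Ioo 0 z, g a = ENNReal.ofReal z * ∫⁻ u, (Ioo 0 z).indicator g (u * z) := by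
    rw [← lintegral_map (hg.indicator measurableSet_Ioo) (measurable_mul_const z), ← smul_eq_mul,
      ← lintegral_smul_measure]
    have e := Real.smul_map_volume_mul_right hz.ne'
    rw [abs_of_pos hz] at e
    rw [e, lintegral_indicator measurableSet_Ioo]
  rw [h1, ← lintegral_indicator measurableSet_Ioo]
  congr 1
  refine lintegral_congr fun u => ?_
  have : u ∈ Ioo (0 : ℝ) 1 ↔ u * z ∈ Ioo 0 z := by
    simp only [mem_Ioo]
    rw [mul_pos_iff_of_pos_right hz, mul_lt_iff_lt_one_left hz]
  by_cases h : u ∈ Ioo (0 : ℝ) 1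
  · rw [indicator_of_mem h, indicator_of_mem (this.1 h)]
  · rw [indicator_of_notMem h, indicator_of_notMem (fun h' => h (this.2 h'))]

/-- The map `(z, u) ↦ (u z, (1 - u) z)` has Jacobian `z`, which accounts for the factor `x_i` in the
fragmentation rate. After the scaling `a = u z`, what is left is the shear `z = a + b`, handled by
translation invariance. -/
theorem lintegral_quadrant {H : ℝ × ℝ → ℝ≥0∞} (hH : Measurable H) :
    ∫⁻ z in Ioi (0 : ℝ), ENNReal.ofReal z * ∫⁻ u in Ioo (0 : ℝ) 1, H (u * z, (1 - u) * z) =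
      ∫⁻ v in Ioi (0 : ℝ) ×ˢ Ioi (0 : ℝ), H v := by
  have hQ : MeasurableSet (Ioi (0 : ℝ) ×ˢ Ioi (0 : ℝ)) := measurableSet_Ioi.prod measurableSet_Ioi
  set H' := (Ioi (0 : ℝ) ×ˢ Ioi (0 : ℝ)).indicator H with hH'
  have mH' : Measurable H' := hH.indicator hQ
  have h1 : ∀ z : ℝ, (Ioi (0 : ℝ)).indicator
      (fun z => ENNReal.ofReal z * ∫⁻ u in Ioo (0 : ℝ) 1, H (u * z, (1 - u) * z)) z =
      ∫⁻ a, H' (a, z - a) := fun z => by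
    by_cases hz : 0 < z
    · have m : Measurable fun a => H (a, z - a) := hH.comp (by fun_prop)
      have e := lintegral_Ioo_mul m hz
      rw [indicator_of_mem (mem_Ioi.2 hz)]
      simp only [sub_mul, one_mul]
      rw [e, ← lintegral_indicator measurableSet_Ioo]
      refine lintegral_congr fun a => ?_
      have : a ∈ Ioo 0 z ↔ (a, z - a) ∈ Ioi (0 : ℝ) ×ˢ Ioi (0 : ℝ) := by simp
      by_cases h : a ∈ Ioo 0 z
      · rw [indicator_of_mem h, hH', indicator_of_mem (this.1 h)]
      · rw [indicator_of_notMem h, hH', indicator_of_notMem (fun h' => h (this.2 h'))]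
    · rw [indicator_of_notMem (by simpa using hz), eq_comm]
      refine (lintegral_congr fun a => ?_).trans lintegral_zero
      rw [hH', indicator_of_notMem]
      rintro ⟨h1, h2⟩
      simp only [mem_Ioi] at h1 h2
      linarith
  have mS : Measurable (Function.uncurry fun z a : ℝ => H' (a, z - a)) :=
    mH'.comp (f := fun p : ℝ × ℝ => (p.2, p.1 - p.2)) (by fun_prop)
  rw [← lintegral_indicator measurableSet_Ioi, lintegral_congr h1,
    lintegral_lintegral_swap mS.aemeasurable,
    ← lintegral_indicator hQ, Measure.volume_eq_prod, lintegral_prod _ mH'.aemeasurable]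
  exact lintegral_congr fun a => lintegral_sub_right_eq_self (fun b => H' (a, b)) a

/-- The rates are extended from `v.1 + v.2 ≤ 1`, but the Palm identity is assumed only for `v.1 +
v.2 < 1`; the difference is null. -/
theorem volume_line : volume {v : ℝ × ℝ | v.1 + v.2 = 1} = 0 := by
  have hm : MeasurableSet {v : ℝ × ℝ | v.1 + v.2 = 1} :=
    measurableSet_eq_fun (by fun_prop) measurable_const
  rw [Measure.volume_eq_prod, Measure.measure_prod_null hm]
  refine ae_of_all _ fun a => ?_
  have : Prod.mk a ⁻¹' {v : ℝ × ℝ | v.1 + v.2 = 1} = {1 - a} := by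
    ext b
    simp only [mem_preimage, mem_ofPred_eq, mem_singleton_iff]
    constructor <;> intro h <;> linarith
  simp [this]

/-! ### Detailed balance in terms of values -/

/-- The set of pairs of sizes between which coagulation and fragmentation take place. -/
def rateDomain : Set (ℝ × ℝ) := {v | 0 < v.1 ∧ 0 < v.2 ∧ v.1 + v.2 ≤ 1}

theorem measurableSet_rateDomain : MeasurableSet rateDomain :=
  (measurableSet_lt measurable_const measurable_fst).inter
    ((measurableSet_lt measurable_const measurable_snd).inter
      (measurableSet_le (measurable_fst.add measurable_snd) measurable_const))

/-- The extension by `0` of a rate to `ℝ²`. -/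
def rateExt (H : ℝ → ℝ → ℝ) : ℝ × ℝ → ℝ≥0∞ :=
  rateDomain.indicator fun v => ENNReal.ofReal (H v.1 v.2)

theorem measurable_rateExt {H : ℝ → ℝ → ℝ} (hH : Measurable (Function.uncurry H)) :
    Measurable (rateExt H) := hH.ennreal_ofReal.indicator measurableSet_rateDomain

theorem lintegral_coagMeas_eq {K : ℝ → ℝ → ℝ} (hK : Measurable (Function.uncurry K))
    {f : Omega1 × Omega1 → ℝ≥0∞} (hf : Measurable f) (x : Omega1) :
    ∫⁻ y, f (x, y) ∂coagMeas K x = ∫⁻ v, rateExt K v * f (x, mergeVal v x) ∂config2 x := by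
  have m1 : Measurable fun y => f (x, y) := hf.comp (by fun_prop)
  have m2 : Measurable fun v => rateExt K v * f (x, mergeVal v x) :=
    (measurable_rateExt hK).mul (hf.comp (measurable_const.prodMk
      (measurable_mergeVal.comp (measurable_id.prodMk measurable_const))))
  rw [lintegral_coagMeas _ _ m1, lintegral_config2 m2]
  refine tsum_congr fun p => ?_
  split_ifs with h
  · rw [merge_eq_mergeVal x h.1 h.2.1 h.2.2, rateExt,
      indicator_of_mem (show (x.1 p.1, x.1 p.2) ∈ rateDomain from
        ⟨h.2.1, h.2.2, add_le_one x h.1⟩)]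
  · rfl

theorem measurable_splitIntegral {F : ℝ → ℝ → ℝ} (hF : Measurable (Function.uncurry F))
    {f : Omega1 × Omega1 → ℝ≥0∞} (hf : Measurable f) :
    Measurable fun a : ℝ × Omega1 => ∫⁻ u in Ioo (0 : ℝ) 1,
      rateExt F (u * a.1, (1 - u) * a.1) * f (splitVal (u * a.1, (1 - u) * a.1) a.2, a.2) := by
  refine Measurable.lintegral_prod_right'
    (f := fun b : (ℝ × Omega1) × ℝ => rateExt F (b.2 * b.1.1, (1 - b.2) * b.1.1) *
      f (splitVal (b.2 * b.1.1, (1 - b.2) * b.1.1) b.1.2, b.1.2)) ?_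
  have m : Measurable fun b : (ℝ × Omega1) × ℝ => (b.2 * b.1.1, (1 - b.2) * b.1.1) := by fun_prop
  have m' : Measurable fun b : (ℝ × Omega1) × ℝ => b.1.2 := by fun_prop
  exact ((measurable_rateExt hF).comp m).mul
    (hf.comp ((measurable_splitVal.comp (m.prodMk m')).prodMk m'))

theorem lintegral_fragMeas_eq {F : ℝ → ℝ → ℝ} (hF : Measurable (Function.uncurry F))
    {f : Omega1 × Omega1 → ℝ≥0∞} (hf : Measurable f) (x : Omega1) :
    ∫⁻ y, f (y, x) ∂fragMeas F x = ∫⁻ z, (ENNReal.ofReal z * ∫⁻ u in Ioo (0 : ℝ) 1,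
      rateExt F (u * z, (1 - u) * z) * f (splitVal (u * z, (1 - u) * z) x, x)) ∂(config x).1 := by
  have m1 : Measurable fun y => f (y, x) := hf.comp (by fun_prop)
  have m2 : Measurable fun z : ℝ => ENNReal.ofReal z * ∫⁻ u in Ioo (0 : ℝ) 1,
      rateExt F (u * z, (1 - u) * z) * f (splitVal (u * z, (1 - u) * z) x, x) :=
    ENNReal.measurable_ofReal.mul
      ((measurable_splitIntegral hF hf).comp (f := fun z : ℝ => (z, x)) (by fun_prop))
  rw [lintegral_fragMeas hF _ m1, config_val, lintegral_pointSum m2]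
  refine tsum_congr fun i => ?_
  rcases (x.nonneg i).eq_or_lt with h | h
  · simp [← h]
  rw [if_pos h]
  congr 1
  refine setLIntegral_congr_fun measurableSet_Ioo fun u hu => ?_
  have h1 := mul_pos hu.1 h
  have h2 := mul_pos (sub_pos.2 hu.2) h
  have h3 : u * x.1 i + (1 - u) * x.1 i ≤ 1 := by
    have := le_one x i
    linarith
  simp only [split_eq_splitVal x h hu, rateExt,
    indicator_of_mem (show (u * x.1 i, (1 - u) * x.1 i) ∈ rateDomain from ⟨h1, h2, h3⟩)]

/-! ### Detailed balance from the Palm distributions -/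

/-- Both fluxes are disintegrated over the sizes `v` involved and the configuration `η` of the other
blocks. The integrand `g (v, η)` is the same for both, so the assumed equality of weighted Palm
measures can be integrated against it. -/
theorem detailedBalance_of_palm {K F : ℝ → ℝ → ℝ} (hK : Measurable (Function.uncurry K))
    (hF : Measurable (Function.uncurry F)) {μ : Measure Omega1} {q₁ : ℝ → ℝ≥0∞}
    {q₂ : ℝ × ℝ → ℝ≥0∞} (hq₁ : IsCorrFun1 μ q₁) (hq₂ : IsCorrFun2 μ q₂)
    {P₁ : Kernel ℝ PointConfig} [IsMarkovKernel P₁] {P₂ : Kernel (ℝ × ℝ) PointConfig}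
    [IsMarkovKernel P₂] (hP₁ : IsPalm1 μ P₁) (hP₂ : IsPalm2 μ P₂)
    (h : ∀ᵐ x : ℝ × ℝ, 0 < x.1 → 0 < x.2 → x.1 + x.2 < 1 →
      (ENNReal.ofReal (K x.1 x.2) * q₂ x) • P₂ x =
        (ENNReal.ofReal (F x.1 x.2) * q₁ (x.1 + x.2)) • P₁ (x.1 + x.2)) :
    DetailedBalance K F μ := by
  intro f hf
  obtain ⟨T, hT, hTc⟩ := exists_measurable_leftInverse_config
  have hR : Measurable ((range config).indicator (1 : PointConfig → ℝ≥0∞)) :=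
    measurable_one.indicator measurableSet_range_config
  -- Value of `f` on the state with blocks `v.1, v.2` and the state with block `v.1 + v.2`, both
  -- over `η`. The indicator discards those `η` for which these configurations do not come from
  -- states, where `T` is arbitrary.
  let g : (ℝ × ℝ) × PointConfig → ℝ≥0∞ := fun a =>
    (range config).indicator 1 (addPoint a.2 (a.1.1 + a.1.2)) *
      f (T (addPoint (addPoint a.2 a.1.1) a.1.2), T (addPoint a.2 (a.1.1 + a.1.2)))
  have mg : Measurable g := by
    have a1 : Measurable fun a : (ℝ × ℝ) × PointConfig => addPoint a.2 (a.1.1 + a.1.2) :=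
      measurable_addPoint measurable_snd (by fun_prop)
    have a2 : Measurable fun a : (ℝ × ℝ) × PointConfig =>
        addPoint (addPoint a.2 a.1.1) a.1.2 :=
      measurable_addPoint (measurable_addPoint measurable_snd (by fun_prop)) (by fun_prop)
    exact (hR.comp a1).mul (hf.comp ((hT.comp a2).prodMk (hT.comp a1)))
  -- Merging and splitting turn states into states, so one of the two configurations comes from a
  -- state iff the other does; the indicator may be tested on either.
  have hmerge : ∀ (v : ℝ × ℝ) (η : PointConfig), 0 < v.1 → 0 < v.2 →
      (range config).indicator (1 : PointConfig → ℝ≥0∞) (addPoint (addPoint η v.1) v.2) *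
        f (T (addPoint (addPoint η v.1) v.2),
          mergeVal v (T (addPoint (addPoint η v.1) v.2))) = g (v, η) := by
    intro v η h1 h2
    simp only [g]
    by_cases hx : addPoint (addPoint η v.1) v.2 ∈ range config
    · obtain ⟨x, hx⟩ := hx
      have hm := config_mergeVal h1 h2 hx
      rw [← hx, ← hm, hTc, hTc, indicator_of_mem (mem_range_self _),
        indicator_of_mem (mem_range_self _)]
      rfl
    · have hx' : addPoint η (v.1 + v.2) ∉ range config := by
        rintro ⟨x, hx'⟩
        exact hx ⟨_, config_splitVal h1 h2 hx'⟩
      rw [indicator_of_notMem hx, indicator_of_notMem hx', zero_mul, zero_mul]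
  have hsplit : ∀ (v : ℝ × ℝ) (η : PointConfig), 0 < v.1 → 0 < v.2 →
      (range config).indicator (1 : PointConfig → ℝ≥0∞) (addPoint η (v.1 + v.2)) *
        f (splitVal v (T (addPoint η (v.1 + v.2))), T (addPoint η (v.1 + v.2))) = g (v, η) := by
    intro v η h1 h2
    simp only [g]
    by_cases hx : addPoint η (v.1 + v.2) ∈ range config
    · obtain ⟨x, hx⟩ := hx
      have hm := config_splitVal h1 h2 hx
      rw [← hx, ← hm, hTc, hTc]
    · rw [indicator_of_notMem hx, zero_mul, zero_mul]
  have hQ : MeasurableSet (Ioi (0 : ℝ) ×ˢ Ioi (0 : ℝ)) := measurableSet_Ioi.prod measurableSet_Ioi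
  have mK := measurable_rateExt hK
  have mF := measurable_rateExt hF
  have mI₂ : Measurable fun v => ∫⁻ η, g (v, η) ∂P₂ v := mg.lintegral_kernel_prod_right'
  have mI₁ : Measurable fun v : ℝ × ℝ => ∫⁻ η, g (v, η) ∂P₁ (v.1 + v.2) :=
    mg.lintegral_kernel_prod_right' (κ := P₁.comap (fun v : ℝ × ℝ => v.1 + v.2) (by fun_prop))
  have mgv : ∀ v, Measurable fun η => g (v, η) := fun v => mg.comp (by fun_prop)
  have lhs : ∫⁻ x, ∫⁻ y, f (x, y) ∂coagMeas K x ∂μ =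
      ∫⁻ v in Ioi (0 : ℝ) ×ˢ Ioi (0 : ℝ), q₂ v * (rateExt K v * ∫⁻ η, g (v, η) ∂P₂ v) := by
    have mG : Measurable fun a : (ℝ × ℝ) × PointConfig => rateExt K a.1 *
        ((range config).indicator 1 a.2 * f (T a.2, mergeVal a.1 (T a.2))) := by
      have hT2 : Measurable fun a : (ℝ × ℝ) × PointConfig => T a.2 := hT.comp measurable_snd
      exact (mK.comp measurable_fst).mul ((hR.comp measurable_snd).mul
        (hf.comp (hT2.prodMk (measurable_mergeVal.comp (measurable_fst.prodMk hT2)))))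
    have e := hP₂ _ mG
    simp only [indicator_of_mem (mem_range_self _), hTc, Pi.one_apply, one_mul] at e
    simp only [lintegral_coagMeas_eq hK hf]
    rw [e, hq₂.2, lintegral_withDensity_eq_lintegral_mul _ hq₂.1]
    · refine setLIntegral_congr_fun hQ fun v hv => ?_
      simp only [Pi.mul_apply]
      congr 1
      rw [← lintegral_const_mul _ (mgv v)]
      refine lintegral_congr fun η => ?_
      rw [hmerge v η hv.1 hv.2]
    · refine Measurable.lintegral_kernel_prod_right' (f := fun a : (ℝ × ℝ) × PointConfig =>
        rateExt K a.1 * ((range config).indicator 1 (addPoint (addPoint a.2 a.1.1) a.1.2) *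
          f (T (addPoint (addPoint a.2 a.1.1) a.1.2),
            mergeVal a.1 (T (addPoint (addPoint a.2 a.1.1) a.1.2))))) ?_
      exact mG.comp (measurable_fst.prodMk (measurable_addPoint (measurable_addPoint
        measurable_snd (by fun_prop)) (by fun_prop)))
  have rhs : ∫⁻ x, ∫⁻ y, f (y, x) ∂fragMeas F x ∂μ =
      ∫⁻ v in Ioi (0 : ℝ) ×ˢ Ioi (0 : ℝ),
        q₁ (v.1 + v.2) * (rateExt F v * ∫⁻ η, g (v, η) ∂P₁ (v.1 + v.2)) := by
    have mG : Measurable fun a : ℝ × PointConfig => (range config).indicator 1 a.2 *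
        (ENNReal.ofReal a.1 * ∫⁻ u in Ioo (0 : ℝ) 1, rateExt F (u * a.1, (1 - u) * a.1) *
          f (splitVal (u * a.1, (1 - u) * a.1) (T a.2), T a.2)) :=
      (hR.comp measurable_snd).mul (measurable_fst.ennreal_ofReal.mul
        ((measurable_splitIntegral hF hf).comp
          (measurable_fst.prodMk (hT.comp measurable_snd))))
    have e := hP₁ _ mG
    simp only [indicator_of_mem (mem_range_self _), hTc, Pi.one_apply, one_mul] at e
    simp only [lintegral_fragMeas_eq hF hf]
    rw [e, hq₁.2, lintegral_withDensity_eq_lintegral_mul _ hq₁.1]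
    -- The right side is pulled back to `(z, u)`; then the integrals over `η` and `u` are
    -- interchanged.
    · rw [← lintegral_quadrant]
      · refine setLIntegral_congr_fun measurableSet_Ioi fun z hz => ?_
        simp only [Pi.mul_apply]
        have hz' : 0 < z := hz
        have mJ : Measurable fun a : PointConfig × ℝ =>
            rateExt F (a.2 * z, (1 - a.2) * z) * g ((a.2 * z, (1 - a.2) * z), a.1) :=
          (mF.comp (by fun_prop)).mul (mg.comp (by fun_prop))
        have mJ' : Measurable fun u : ℝ =>
            rateExt F (u * z, (1 - u) * z) *
              ∫⁻ η, g ((u * z, (1 - u) * z), η) ∂P₁ (u * z + (1 - u) * z) :=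
          (mF.mul mI₁).comp (f := fun u : ℝ => (u * z, (1 - u) * z)) (by fun_prop)
        have hadd : ∀ u : ℝ, u * z + (1 - u) * z = z := fun u => by ring
        have hJ : ∀ η : PointConfig, (range config).indicator 1 (addPoint η z) *
            (ENNReal.ofReal z * ∫⁻ u in Ioo (0 : ℝ) 1, rateExt F (u * z, (1 - u) * z) *
              f (splitVal (u * z, (1 - u) * z) (T (addPoint η z)), T (addPoint η z))) =
            ENNReal.ofReal z * ∫⁻ u in Ioo (0 : ℝ) 1,
              rateExt F (u * z, (1 - u) * z) * g ((u * z, (1 - u) * z), η) := fun η => by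
          have m : Measurable fun u : ℝ => rateExt F (u * z, (1 - u) * z) *
              f (splitVal (u * z, (1 - u) * z) (T (addPoint η z)), T (addPoint η z)) :=
            (mF.mul (hf.comp ((measurable_splitVal.comp (measurable_id.prodMk
              measurable_const)).prodMk measurable_const))).comp
                (f := fun u : ℝ => (u * z, (1 - u) * z)) (by fun_prop)
          rw [mul_left_comm, ← lintegral_const_mul _ m]
          congr 1
          refine setLIntegral_congr_fun measurableSet_Ioo fun u hu => ?_
          rw [← hsplit (u * z, (1 - u) * z) η (mul_pos hu.1 hz')
            (mul_pos (sub_pos.2 hu.2) hz'), mul_left_comm]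
          simp only [hadd]
        simp only [hJ, hadd] at mJ' ⊢
        rw [lintegral_const_mul _ mJ.lintegral_prod_right', lintegral_lintegral_swap mJ.aemeasurable,
          mul_left_comm]
        congr 1
        refine Eq.trans ?_ (lintegral_const_mul _ mJ').symm
        congr 1
        exact lintegral_congr fun u => lintegral_const_mul (rateExt F (u * z, (1 - u) * z))
          (mgv (u * z, (1 - u) * z))
      · exact (hq₁.1.comp (by fun_prop)).mul (mF.mul mI₁)
    · exact Measurable.lintegral_kernel_prod_right' (mG.comp (measurable_fst.prodMk
        (measurable_addPoint measurable_snd measurable_fst)))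
  rw [lhs, rhs]
  have hline : ∀ᵐ v : ℝ × ℝ, v.1 + v.2 ≠ 1 := by
    rw [ae_iff]
    simpa using volume_line
  refine setLIntegral_congr_fun_ae hQ ?_
  filter_upwards [h, hline] with v hv hv1 hvQ
  by_cases hle : v ∈ rateDomain
  · have e := congrArg (fun m : Measure PointConfig => ∫⁻ η, g (v, η) ∂m)
      (hv hle.1 hle.2.1 (lt_of_le_of_ne hle.2.2 hv1))
    simp only [lintegral_smul_measure, smul_eq_mul] at e
    rw [rateExt, rateExt, indicator_of_mem hle, indicator_of_mem hle, ← mul_assoc, ← mul_assoc,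
      mul_comm (q₂ v), e, mul_comm (q₁ _)]
  · rw [rateExt, rateExt, indicator_of_notMem hle, indicator_of_notMem hle]
    simp

end CoagFrag

end

noncomputable section

namespace CoagFrag

/-! ### The density of two stick-breaking steps -/

theorem isProbabilityMeasure_beta {θ : ℝ} (hθ : 0 < θ) :
    IsProbabilityMeasure (betaMeasure 1 θ) := isProbabilityMeasureBeta one_pos hθ

theorem beta_one {θ : ℝ} (hθ : 0 < θ) : 1 / beta 1 θ = θ := by
  rw [beta, Real.Gamma_one, one_mul, add_comm, Real.Gamma_add_one hθ.ne']
  have := (Real.Gamma_pos_of_pos hθ).ne'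
  field_simp

theorem lintegral_beta {θ : ℝ} (hθ : 0 < θ) {g : ℝ → ℝ≥0∞} (hg : Measurable g) :
    ∫⁻ v, g v ∂betaMeasure 1 θ =
      ∫⁻ v in Ioo (0 : ℝ) 1, ENNReal.ofReal (θ * (1 - v) ^ (θ - 1)) * g v := by
  have hm : Measurable (betaPDF 1 θ) := (measurable_betaPDFReal 1 θ).ennreal_ofReal
  rw [betaMeasure, lintegral_withDensity_eq_lintegral_mul _ hm hg,
    ← lintegral_indicator measurableSet_Ioo]
  refine lintegral_congr fun v => ?_
  by_cases hv : v ∈ Ioo (0 : ℝ) 1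
  · rw [indicator_of_mem hv, Pi.mul_apply, betaPDF_of_pos_lt_one hv.1 hv.2, beta_one hθ, sub_self,
      Real.rpow_zero, mul_one]
  · rw [indicator_of_notMem hv, Pi.mul_apply, betaPDF_eq, if_neg (show ¬(0 < v ∧ v < 1) from hv),
      ENNReal.ofReal_zero, zero_mul]

theorem ae_beta_mem_Ioo (θ : ℝ) : ∀ᵐ v ∂betaMeasure 1 θ, v ∈ Ioo (0 : ℝ) 1 := by
  have hm : Measurable (betaPDF 1 θ) := (measurable_betaPDFReal 1 θ).ennreal_ofReal
  rw [betaMeasure, ae_withDensity_iff hm]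
  refine ae_of_all _ fun v hv => ?_
  by_contra h
  exact hv (by rw [betaPDF_eq, if_neg (show ¬(0 < v ∧ v < 1) from h), ENNReal.ofReal_zero])

/-- The contraction constant `E(1 - V)`: it makes the sticks exhaust the unit mass and gives
uniqueness in the size-biasing recursion. -/
theorem lintegral_one_sub_beta_lt_one {θ : ℝ} (hθ : 0 < θ) :
    ∫⁻ v, ENNReal.ofReal (1 - v) ∂betaMeasure 1 θ < 1 := by
  have hP := isProbabilityMeasure_beta hθ
  have h : ∀ᵐ v ∂betaMeasure 1 θ, ENNReal.ofReal (1 - v) < 1 := by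
    filter_upwards [ae_beta_mem_Ioo θ] with v hv
    rw [ENNReal.ofReal_lt_one]
    linarith [hv.1]
  have hle : ∫⁻ v, ENNReal.ofReal (1 - v) ∂betaMeasure 1 θ ≤ 1 := by
    calc _ ≤ ∫⁻ _, 1 ∂betaMeasure 1 θ := lintegral_mono_ae (h.mono fun v hv => hv.le)
      _ = 1 := by simp
  have := lintegral_strict_mono (μ := betaMeasure 1 θ) (IsProbabilityMeasure.ne_zero _)
    aemeasurable_const (ne_top_of_le_ne_top ENNReal.one_ne_top hle) h
  simpa using this

/-- The open triangle `{(a, b) : a, b > 0, a + b < 1}`. -/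
def triangle : Set (ℝ × ℝ) := {p | 0 < p.1 ∧ 0 < p.2 ∧ p.1 + p.2 < 1}

theorem measurableSet_triangle : MeasurableSet triangle :=
  (measurableSet_lt measurable_const measurable_fst).inter
    ((measurableSet_lt measurable_const measurable_snd).inter
      (measurableSet_lt (measurable_fst.add measurable_snd) measurable_const))

/-- The function `θ² (1 - a - b)^{θ - 1}` on the triangle, extended by `0`. -/
def twoStickDensity (θ : ℝ) : ℝ × ℝ → ℝ≥0∞ :=
  triangle.indicator fun p => ENNReal.ofReal (θ ^ 2 * (1 - (p.1 + p.2)) ^ (θ - 1))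

theorem measurable_twoStickDensity (θ : ℝ) : Measurable (twoStickDensity θ) := by
  refine Measurable.indicator ?_ measurableSet_triangle
  fun_prop

theorem twoStickDensity_swap (θ : ℝ) (p : ℝ × ℝ) :
    twoStickDensity θ p.swap = twoStickDensity θ p := by
  have h : p.swap ∈ triangle ↔ p ∈ triangle := by
    simp only [triangle, mem_ofPred_eq, Prod.fst_swap, Prod.snd_swap]
    rw [add_comm]
    tauto
  unfold twoStickDensity
  by_cases hp : p ∈ triangle
  · rw [indicator_of_mem hp, indicator_of_mem (h.2 hp), Prod.fst_swap, Prod.snd_swap, add_comm]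
  · rw [indicator_of_notMem hp, indicator_of_notMem (fun h' => hp (h.1 h'))]

/-- With `a = v` and `b = (1 - v) w` the weight `1 - v` is absorbed by `db = (1 - v) dw`, and `(1 -
v)(1 - w) = 1 - a - b`. The resulting density is symmetric in `a` and `b`, which is why the weight
is put in. -/
theorem lintegral_beta_beta {θ : ℝ} (hθ : 0 < θ) {g : ℝ × ℝ → ℝ≥0∞} (hg : Measurable g) :
    ∫⁻ v, ENNReal.ofReal (1 - v) * ∫⁻ w, g (v, (1 - v) * w) ∂betaMeasure 1 θ ∂betaMeasure 1 θ =
      ∫⁻ p, twoStickDensity θ p * g p := by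
  have hP := isProbabilityMeasure_beta hθ
  have m1 : Measurable fun v : ℝ => ENNReal.ofReal (1 - v) *
      ∫⁻ w, g (v, (1 - v) * w) ∂betaMeasure 1 θ := by
    refine Measurable.mul (by fun_prop) (Measurable.lintegral_prod_right'
      (f := fun a : ℝ × ℝ => g (a.1, (1 - a.1) * a.2)) (hg.comp (by fun_prop)))
  have m2 : Measurable fun p => twoStickDensity θ p * g p :=
    (measurable_twoStickDensity θ).mul hg
  rw [lintegral_beta hθ m1, Measure.volume_eq_prod, lintegral_prod _ m2.aemeasurable,
    ← lintegral_indicator measurableSet_Ioo]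
  refine lintegral_congr fun v => ?_
  by_cases hv : v ∈ Ioo (0 : ℝ) 1
  swap
  · rw [indicator_of_notMem hv, eq_comm]
    refine (lintegral_congr fun b => ?_).trans lintegral_zero
    rw [twoStickDensity, indicator_of_notMem, zero_mul]
    rintro ⟨h1, h2, h3⟩
    exact hv ⟨h1, by linarith⟩
  have hz : 0 < 1 - v := sub_pos.2 hv.2
  have m3 : Measurable fun w => g (v, (1 - v) * w) := hg.comp (by fun_prop)
  have m4 : Measurable fun b => ENNReal.ofReal (θ * (1 - b / (1 - v)) ^ (θ - 1)) * g (v, b) :=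
    Measurable.mul (by fun_prop) (hg.comp (by fun_prop))
  have e1 : ENNReal.ofReal (1 - v) * ∫⁻ w, g (v, (1 - v) * w) ∂betaMeasure 1 θ =
      ∫⁻ b in Ioo 0 (1 - v), ENNReal.ofReal (θ * (1 - b / (1 - v)) ^ (θ - 1)) * g (v, b) := by
    rw [lintegral_beta hθ m3, ← lintegral_Ioo_mul m4 hz]
    congr 1
    refine lintegral_congr fun u => ?_
    rw [mul_div_cancel_right₀ _ hz.ne', mul_comm u]
  rw [indicator_of_mem hv, e1, ← lintegral_const_mul _ m4, ← lintegral_indicator measurableSet_Ioo]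
  refine lintegral_congr fun b => ?_
  have hb : b ∈ Ioo 0 (1 - v) ↔ (v, b) ∈ triangle := by
    simp only [triangle, mem_ofPred_eq, mem_Ioo, hv.1, true_and]
    exact and_congr_right fun _ => by constructor <;> intro h <;> linarith
  by_cases h : b ∈ Ioo 0 (1 - v)
  · rw [indicator_of_mem h, twoStickDensity, indicator_of_mem (hb.1 h), ← mul_assoc,
      ← ENNReal.ofReal_mul (by positivity)]
    congr 2
    have h1 : 0 ≤ 1 - b / (1 - v) := by
      rw [sub_nonneg, div_le_one hz]
      exact h.2.le
    have h2 : 1 - (v + b) = (1 - v) * (1 - b / (1 - v)) := by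
      field_simp
      ring
    rw [h2, Real.mul_rpow hz.le h1]
    ring
  · rw [indicator_of_notMem h, twoStickDensity, indicator_of_notMem (fun h' => h (hb.2 h')),
      zero_mul]

end CoagFrag

end

noncomputable section

namespace CoagFrag

/-! ### Inserting blocks -/

theorem pointSum_scale {c : ℝ} (hc : 0 < c) (w : ℕ → ℝ) :
    pointSum (fun k => c * w k) = (pointSum w).map (c * ·) := by
  ext B hB
  have hm : Measurable fun b : ℝ => c * b := measurable_const_mul c
  rw [Measure.map_apply hm hB, pointSum, pointSum, Measure.sum_apply _ hB,
    Measure.sum_apply _ (hm hB)]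
  refine tsum_congr fun i => ?_
  rw [pointMass_apply _ hB, pointMass_apply _ (hm hB)]
  refine indicator_eq_indicator ?_ rfl
  simp only [mem_inter_iff, mem_preimage, mem_Ioi, mul_pos_iff_of_pos_left hc]

/-- The state consisting of a block of size `v` and the blocks of `x` scaled by `1 - v`. -/
def ins (v : ℝ) (x : Omega1) : Omega1 := rank (consSeq v fun k => (1 - v) * x.1 k)

/-- The state consisting of two blocks of sizes `p.1` and `p.2` and the blocks of `x`, scaled to
total size `1 - (p.1 + p.2)`. -/
def ins2 (p : ℝ × ℝ) (x : Omega1) : Omega1 :=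
  rank (consSeq p.1 (consSeq p.2 fun k => (1 - (p.1 + p.2)) * x.1 k))

theorem measurable_ins : Measurable fun a : ℝ × Omega1 => ins a.1 a.2 := by
  have h : ∀ k, Measurable fun a : ℝ × Omega1 => a.2.1 k := fun k =>
    (measurable_coord k).comp measurable_snd
  exact measurable_rank.comp (measurable_consSeq measurable_fst (measurable_pi_of_apply fun k =>
    (measurable_const.sub measurable_fst).mul (h k)))

theorem measurable_ins2 : Measurable fun a : (ℝ × ℝ) × Omega1 => ins2 a.1 a.2 := by
  have h : ∀ k, Measurable fun a : (ℝ × ℝ) × Omega1 => a.2.1 k := fun k =>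
    (measurable_coord k).comp measurable_snd
  have h1 : Measurable fun a : (ℝ × ℝ) × Omega1 => 1 - (a.1.1 + a.1.2) := by fun_prop
  exact measurable_rank.comp (measurable_consSeq (by fun_prop) (measurable_consSeq (by fun_prop)
    (measurable_pi_of_apply fun k => h1.mul (h k))))

theorem isMass_ins {v : ℝ} (hv : v ∈ Ioo (0 : ℝ) 1) {w : ℕ → ℝ} (hw : IsMass w 1) :
    IsMass (consSeq v fun k => (1 - v) * w k) 1 := by
  have := (hw.mul (sub_nonneg.2 hv.2.le)).cons hv.1.le
  rwa [show v + (1 - v) * 1 = 1 by ring] at this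

theorem pointSum_ins {v : ℝ} (hv : v ∈ Ioo (0 : ℝ) 1) (x : Omega1) :
    pointSum (ins v x).1 = pointSum (fun k => (1 - v) * x.1 k) + pointMass v := by
  rw [ins, pointSum_rank (isMass_ins hv x.isMass), pointSum_consSeq, add_comm]

theorem pointSum_ins2 {p : ℝ × ℝ} (hp : p ∈ triangle) (x : Omega1) :
    pointSum (ins2 p x).1 =
      pointSum (fun k => (1 - (p.1 + p.2)) * x.1 k) + pointMass p.1 + pointMass p.2 := by
  have h := ((x.isMass.mul (sub_nonneg.2 hp.2.2.le)).cons hp.2.1.le).cons hp.1.le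
  rw [show p.1 + (p.2 + (1 - (p.1 + p.2)) * 1) = 1 by ring] at h
  rw [ins2, pointSum_rank h, pointSum_consSeq, pointSum_consSeq, add_comm (pointMass p.2), add_comm,
    add_right_comm]

theorem mem_triangle_of_mem_Ioo {v w : ℝ} (hv : v ∈ Ioo (0 : ℝ) 1) (hw : w ∈ Ioo (0 : ℝ) 1) :
    (v, (1 - v) * w) ∈ triangle := by
  have h1 : 0 < 1 - v := sub_pos.2 hv.2
  refine ⟨hv.1, mul_pos h1 hw.1, ?_⟩
  have : 0 < (1 - v) * (1 - w) := mul_pos h1 (sub_pos.2 hw.2)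
  simp only
  linarith

/-- Both sides have blocks `v`, `(1 - v) w` and the blocks of `x` scaled by `(1 - v)(1 - w)`. -/
theorem ins_ins {v w : ℝ} (hv : v ∈ Ioo (0 : ℝ) 1) (hw : w ∈ Ioo (0 : ℝ) 1) (x : Omega1) :
    ins v (ins w x) = ins2 (v, (1 - v) * w) x := by
  have hz : 0 < 1 - v := sub_pos.2 hv.2
  apply omega_ext
  rw [pointSum_ins hv, pointSum_ins2 (mem_triangle_of_mem_Ioo hv hw), pointSum_scale hz, ins,
    pointSum_rank (isMass_ins hw x.isMass), ← pointSum_scale hz]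
  have e : (fun k => (1 - v) * consSeq w (fun k => (1 - w) * x.1 k) k) =
      consSeq ((1 - v) * w) fun k => (1 - (v + (1 - v) * w)) * x.1 k := by
    funext k
    cases k with
    | zero => rfl
    | succ k =>
      simp only [consSeq]
      ring
  rw [e, pointSum_consSeq, add_comm (pointMass _), add_right_comm]

theorem ins2_swap {p : ℝ × ℝ} (hp : p ∈ triangle) (x : Omega1) : ins2 p.swap x = ins2 p x := by
  have hp' : p.swap ∈ triangle := ⟨hp.2.1, hp.1, by
    rw [Prod.fst_swap, Prod.snd_swap, add_comm]; exact hp.2.2⟩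
  apply omega_ext
  rw [pointSum_ins2 hp, pointSum_ins2 hp', Prod.fst_swap, Prod.snd_swap, add_comm p.2,
    add_right_comm]

theorem mergeVal_ins2 {p : ℝ × ℝ} (hp : p ∈ triangle) (x : Omega1) :
    mergeVal p (ins2 p x) = ins (p.1 + p.2) x := by
  apply omega_ext
  rw [pointSum_mergeVal hp.1 hp.2.1 (pointSum_ins2 hp x),
    pointSum_ins ⟨add_pos hp.1 hp.2.1, hp.2.2⟩]

theorem splitVal_ins {p : ℝ × ℝ} (hp : p ∈ triangle) (x : Omega1) :
    splitVal p (ins (p.1 + p.2) x) = ins2 p x := by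
  apply omega_ext
  rw [pointSum_splitVal hp.1 hp.2.1 (pointSum_ins ⟨add_pos hp.1 hp.2.1, hp.2.2⟩ x),
    pointSum_ins2 hp]

theorem lintegral_scale {c : ℝ} (hc : 0 < c) {g : ℝ → ℝ≥0∞} (hg : Measurable g) (w : ℕ → ℝ) :
    ∫⁻ b, g b ∂pointSum (fun k => c * w k) = ∫⁻ b, g (c * b) ∂pointSum w := by
  rw [pointSum_scale hc, lintegral_map hg (measurable_const_mul c)]

theorem lintegral_pointSum_ins {v : ℝ} (hv : v ∈ Ioo (0 : ℝ) 1) {g : ℝ → ℝ≥0∞} (hg : Measurable g)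
    (x : Omega1) : ∫⁻ b, g b ∂pointSum (ins v x).1 =
      g v + ∫⁻ b, g ((1 - v) * b) ∂pointSum x.1 := by
  rw [pointSum_ins hv, lintegral_add_measure, lintegral_scale (sub_pos.2 hv.2) hg,
    lintegral_pointMass hg, if_pos hv.1, add_comm]

/-! ### The stick-breaking recursion of the Poisson–Dirichlet distribution -/

/-- The law of the i.i.d. stick-breaking proportions. -/
def stickLaw (θ : ℝ) : Measure (ℕ → ℝ) := Measure.infinitePi fun _ : ℕ => betaMeasure 1 θ

theorem isProbabilityMeasure_stickLaw {θ : ℝ} (hθ : 0 < θ) :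
    IsProbabilityMeasure (stickLaw θ) := by
  have := isProbabilityMeasure_beta hθ
  unfold stickLaw
  infer_instance

theorem stickLaw_eq_map {θ : ℝ} (hθ : 0 < θ) :
    ((betaMeasure 1 θ).prod (stickLaw θ)).map (fun a => consSeq a.1 a.2) = stickLaw θ := by
  have := isProbabilityMeasure_beta hθ
  have := isProbabilityMeasure_stickLaw hθ
  have hm : Measurable fun a : ℝ × (ℕ → ℝ) => consSeq a.1 a.2 :=
    measurable_consSeq measurable_fst measurable_snd
  refine Measure.eq_infinitePi _ fun s t ht => ?_
  obtain ⟨N, hN⟩ := s.exists_nat_subset_range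
  -- Padding with `univ`, which has mass one, turns a box over `s` into one over an initial segment,
  -- from which coordinate `0` splits off.
  let t' : ℕ → Set ℝ := fun i => if i ∈ s then t i else univ
  have ht' : ∀ i, MeasurableSet (t' i) := fun i => by
    simp only [t']
    split_ifs
    exacts [ht i, .univ]
  have e1 : (fun a : ℝ × (ℕ → ℝ) => consSeq a.1 a.2) ⁻¹' (s : Set ℕ).pi t =
      t' 0 ×ˢ (Finset.range N : Set ℕ).pi fun i => t' (i + 1) := by
    ext ⟨v, w⟩
    simp only [mem_preimage, Set.mem_pi, Finset.mem_coe, mem_prod, Finset.mem_range]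
    constructor
    · intro h
      refine ⟨?_, fun i _ => ?_⟩
      · simp only [t']
        split_ifs with h0
        exacts [h 0 h0, mem_univ _]
      · simp only [t']
        split_ifs with h0
        exacts [h _ h0, mem_univ _]
    · rintro ⟨h1, h2⟩ i hi
      cases i with
      | zero =>
        simp only [t', if_pos hi] at h1
        exact h1
      | succ i =>
        have := h2 i (by have := Finset.mem_range.1 (hN hi); omega)
        simp only [t', if_pos hi] at this
        exact this
  have e2 : ∏ i ∈ s, betaMeasure 1 θ (t i) =
      ∏ i ∈ Finset.range (N + 1), betaMeasure 1 θ (t' i) := by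
    have hs : s ⊆ Finset.range (N + 1) := hN.trans (Finset.range_mono N.le_succ)
    rw [← Finset.prod_subset hs fun i _ hi => by simp [t', hi]]
    exact Finset.prod_congr rfl fun i hi => by simp [t', hi]
  rw [Measure.map_apply hm (MeasurableSet.pi s.countable_toSet fun i _ => ht i), e1,
    Measure.prod_prod, stickLaw, Measure.infinitePi_pi _ (fun i _ => ht' _), e2,
    Finset.prod_range_succ', mul_comm]

theorem lintegral_stickLaw {θ : ℝ} (hθ : 0 < θ) {f : (ℕ → ℝ) → ℝ≥0∞} (hf : Measurable f) :
    ∫⁻ s, f s ∂stickLaw θ = ∫⁻ v, ∫⁻ s, f (consSeq v s) ∂stickLaw θ ∂betaMeasure 1 θ := by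
  have := isProbabilityMeasure_stickLaw hθ
  have hm : Measurable fun a : ℝ × (ℕ → ℝ) => consSeq a.1 a.2 :=
    measurable_consSeq measurable_fst measurable_snd
  conv_lhs => rw [← stickLaw_eq_map hθ]
  rw [lintegral_map hf hm]
  exact lintegral_prod _ (hf.comp hm).aemeasurable

theorem ae_stickLaw_mem_Ioo {θ : ℝ} (hθ : 0 < θ) :
    ∀ᵐ s ∂stickLaw θ, ∀ i, s i ∈ Ioo (0 : ℝ) 1 := by
  have := isProbabilityMeasure_beta hθ
  rw [ae_all_iff]
  intro i
  have h := measurePreserving_eval_infinitePi (fun _ : ℕ => betaMeasure 1 θ) i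
  exact h.quasiMeasurePreserving.ae (ae_beta_mem_Ioo θ)

/-- The part of the stick which is left after `n` breaks. -/
def restStick (s : ℕ → ℝ) (n : ℕ) : ℝ≥0∞ := ∏ j ∈ Finset.range n, ENNReal.ofReal (1 - s j)

theorem measurable_restStick (n : ℕ) : Measurable fun s => restStick s n := by
  unfold restStick
  fun_prop

theorem lintegral_restStick {θ : ℝ} (hθ : 0 < θ) (n : ℕ) :
    ∫⁻ s, restStick s n ∂stickLaw θ = (∫⁻ v, ENNReal.ofReal (1 - v) ∂betaMeasure 1 θ) ^ n := by
  have := isProbabilityMeasure_stickLaw hθ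
  induction n with
  | zero => simp [restStick]
  | succ n ih =>
    have e : ∀ v s, restStick (consSeq v s) (n + 1) = ENNReal.ofReal (1 - v) * restStick s n := by
      intro v s
      rw [restStick, Finset.prod_range_succ', mul_comm]
      rfl
    rw [lintegral_stickLaw hθ (measurable_restStick _)]
    simp only [e, lintegral_const_mul _ (measurable_restStick n), ih]
    rw [lintegral_mul_const _ (by fun_prop), pow_succ, mul_comm]

/-- By independence the mean remainder after `n` breaks is `(E(1 - V))^n`, so the infimum has mean
zero. -/
theorem ae_iInf_restStick {θ : ℝ} (hθ : 0 < θ) : ∀ᵐ s ∂stickLaw θ, ⨅ n, restStick s n = 0 := by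
  have hm : Measurable fun s => ⨅ n, restStick s n := Measurable.iInf measurable_restStick
  refine (lintegral_eq_zero_iff hm).1 (le_antisymm ?_ zero_le)
  refine ge_of_tendsto' (ENNReal.tendsto_pow_atTop_nhds_zero_of_lt_one
    (lintegral_one_sub_beta_lt_one hθ)) fun n => ?_
  rw [← lintegral_restStick hθ n]
  exact lintegral_mono fun s => iInf_le _ n

theorem sum_stickBreaking (s : ℕ → ℝ) (n : ℕ) :
    ∑ k ∈ Finset.range n, stickBreaking s k = 1 - ∏ j ∈ Finset.range n, (1 - s j) := by
  induction n with
  | zero => simp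
  | succ n ih =>
    rw [Finset.sum_range_succ, ih, Finset.prod_range_succ, stickBreaking]
    ring

theorem ae_isMass_stickBreaking {θ : ℝ} (hθ : 0 < θ) :
    ∀ᵐ s ∂stickLaw θ, IsMass (stickBreaking s) 1 := by
  filter_upwards [ae_stickLaw_mem_Ioo hθ, ae_iInf_restStick hθ] with s h1 h2
  have hnn : ∀ n, 0 ≤ ∏ j ∈ Finset.range n, (1 - s j) := fun n =>
    Finset.prod_nonneg fun j _ => sub_nonneg.2 (h1 j).2.le
  have h0 : ∀ n, 0 ≤ stickBreaking s n := fun n => mul_nonneg (h1 n).1.le (hnn n)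
  refine ⟨h0, ?_⟩
  have hanti : Antitone (restStick s) := by
    refine antitone_nat_of_succ_le fun n => ?_
    rw [restStick, Finset.prod_range_succ]
    exact mul_le_of_le_one_right' (ENNReal.ofReal_le_one.2 (by linarith [(h1 n).1]))
  have ht := tendsto_atTop_iInf hanti
  rw [h2] at ht
  have ht' := (ENNReal.tendsto_toReal ENNReal.zero_ne_top).comp ht
  have e : (ENNReal.toReal ∘ restStick s) = fun n => ∏ j ∈ Finset.range n, (1 - s j) := by
    funext n
    rw [Function.comp_apply, restStick, ENNReal.toReal_prod]
    exact Finset.prod_congr rfl fun j _ => ENNReal.toReal_ofReal (sub_nonneg.2 (h1 j).2.le)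
  rw [e, ENNReal.toReal_zero] at ht'
  rw [hasSum_iff_tendsto_nat_of_nonneg h0]
  simp only [sum_stickBreaking]
  simpa using ht'.const_sub 1

theorem stickBreaking_consSeq (v : ℝ) (s : ℕ → ℝ) :
    stickBreaking (consSeq v s) = consSeq v fun k => (1 - v) * stickBreaking s k := by
  funext k
  cases k with
  | zero => simp [stickBreaking, consSeq]
  | succ k =>
    simp only [stickBreaking, consSeq, Finset.prod_range_succ']
    ring

theorem rank_stickBreaking_consSeq {v : ℝ} (hv : v ∈ Ioo (0 : ℝ) 1) {s : ℕ → ℝ}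
    (hs : IsMass (stickBreaking s) 1) :
    rank (stickBreaking (consSeq v s)) = ins v (rank (stickBreaking s)) := by
  have hz : 0 < 1 - v := sub_pos.2 hv.2
  apply omega_ext
  rw [pointSum_ins hv, stickBreaking_consSeq, pointSum_rank (isMass_ins hv hs), pointSum_consSeq,
    pointSum_scale hz, pointSum_scale hz, pointSum_rank hs, add_comm]

theorem PD_eq_map (θ : ℝ) : PD θ = (stickLaw θ).map fun s => rank (stickBreaking s) := rfl

theorem isProbabilityMeasure_PD {θ : ℝ} (hθ : 0 < θ) : IsProbabilityMeasure (PD θ) := by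
  have := isProbabilityMeasure_stickLaw hθ
  rw [PD_eq_map]
  exact Measure.isProbabilityMeasure_map
    (measurable_rank.comp measurable_stickBreaking).aemeasurable

/-- Self-similarity: after the first break, the other sticks are a fresh stick-breaking sequence
scaled by `1 - v`. -/
theorem lintegral_PD {θ : ℝ} (hθ : 0 < θ) {f : Omega1 → ℝ≥0∞} (hf : Measurable f) :
    ∫⁻ x, f x ∂PD θ = ∫⁻ v, ∫⁻ x, f (ins v x) ∂PD θ ∂betaMeasure 1 θ := by
  have hm : Measurable fun s => rank (stickBreaking s) :=
    measurable_rank.comp measurable_stickBreaking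
  rw [PD_eq_map, lintegral_map hf hm,
    lintegral_stickLaw hθ (f := fun s => f (rank (stickBreaking s))) (hf.comp hm)]
  refine lintegral_congr_ae ?_
  filter_upwards [ae_beta_mem_Ioo θ] with v hv
  have hi : Measurable fun x => f (ins v x) :=
    hf.comp (measurable_ins.comp (measurable_const.prodMk measurable_id))
  rw [lintegral_map hi hm]
  refine lintegral_congr_ae ?_
  filter_upwards [ae_isMass_stickBreaking hθ] with s hs
  rw [rank_stickBreaking_consSeq hv hs]

end CoagFrag

end

noncomputable section

namespace CoagFrag

/-! ### Size-biased picks from the Poisson–Dirichlet distribution -/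

/-- The joint law of a size-biased pick from `X` and of `X`, where `X` has law `μ`. -/
def pickMeasure (μ : Measure Omega1) : Measure (ℝ × Omega1) :=
  Measure.sum fun i => (μ.withDensity fun x => ENNReal.ofReal (x.1 i)).map fun x => (x.1 i, x)

theorem lintegral_pointSum_ofReal_mul {g : ℝ → ℝ≥0∞} (hg : Measurable g) (x : Omega1) :
    ∫⁻ b, ENNReal.ofReal b * g b ∂pointSum x.1 = ∑' i, ENNReal.ofReal (x.1 i) * g (x.1 i) := by
  have m : Measurable fun b => ENNReal.ofReal b * g b := ENNReal.measurable_ofReal.mul hg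
  rw [lintegral_pointSum m]
  refine tsum_congr fun i => ?_
  rcases (x.nonneg i).eq_or_lt with h | h
  · simp [← h]
  · rw [if_pos h]

theorem measurable_coord_pair (i : ℕ) : Measurable fun x : Omega1 => (x.1 i, x) :=
  (measurable_coord i).prodMk measurable_id

theorem lintegral_pickMeasure (μ : Measure Omega1) {G : ℝ × Omega1 → ℝ≥0∞} (hG : Measurable G) :
    ∫⁻ a, G a ∂pickMeasure μ =
      ∫⁻ x, ∫⁻ b, ENNReal.ofReal b * G (b, x) ∂pointSum x.1 ∂μ := by
  have m1 : ∀ x : Omega1, Measurable fun b => G (b, x) := fun x => hG.comp (by fun_prop)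
  have m2 : ∀ i, Measurable fun x : Omega1 => G (x.1 i, x) := fun i =>
    hG.comp (measurable_coord_pair i)
  have m3 : ∀ i, Measurable fun x : Omega1 => ENNReal.ofReal (x.1 i) := fun i =>
    (measurable_coord i).ennreal_ofReal
  simp only [lintegral_pointSum_ofReal_mul (m1 _)]
  have m4 : ∀ i, Measurable fun x : Omega1 => ENNReal.ofReal (x.1 i) * G (x.1 i, x) := fun i =>
    (m3 i).mul (m2 i)
  rw [pickMeasure, lintegral_sum_measure, lintegral_tsum fun i => (m4 i).aemeasurable]
  refine tsum_congr fun i => ?_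
  rw [lintegral_map hG (measurable_coord_pair i)]
  exact lintegral_withDensity_eq_lintegral_mul _ (m3 i) (m2 i)

theorem tsum_ofReal (x : Omega1) : ∑' i, ENNReal.ofReal (x.1 i) = 1 := by
  rw [← ENNReal.ofReal_tsum_of_nonneg x.nonneg x.2.2.2.summable, x.2.2.2.tsum_eq,
    ENNReal.ofReal_one]

theorem lintegral_ofReal_pointSum (x : Omega1) :
    ∫⁻ b, ENNReal.ofReal b ∂pointSum x.1 = 1 := by
  have h := lintegral_pointSum_ofReal_mul (g := 1) measurable_one x
  simp only [Pi.one_apply, mul_one] at h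
  rw [h, tsum_ofReal]

theorem isProbabilityMeasure_pickMeasure (μ : Measure Omega1) [IsProbabilityMeasure μ] :
    IsProbabilityMeasure (pickMeasure μ) := by
  refine ⟨?_⟩
  rw [← lintegral_one, lintegral_pickMeasure μ measurable_const]
  simp [lintegral_ofReal_pointSum]

/-- The law of `(V, Y)`, where `Y` consists of a block of size `V` with law `Beta(1, θ)` and of an
independent sample of `PD(θ)` scaled by `1 - V`. -/
def insMeasure (θ : ℝ) : Measure (ℝ × Omega1) :=
  ((betaMeasure 1 θ).prod (PD θ)).map fun a => (a.1, ins a.1 a.2)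

theorem measurable_insPair : Measurable fun a : ℝ × Omega1 => (a.1, ins a.1 a.2) :=
  measurable_fst.prodMk measurable_ins

theorem lintegral_insMeasure {θ : ℝ} (hθ : 0 < θ) {G : ℝ × Omega1 → ℝ≥0∞} (hG : Measurable G) :
    ∫⁻ a, G a ∂insMeasure θ = ∫⁻ v, ∫⁻ x, G (v, ins v x) ∂PD θ ∂betaMeasure 1 θ := by
  have := isProbabilityMeasure_PD hθ
  rw [insMeasure, lintegral_map hG measurable_insPair]
  exact lintegral_prod _ (hG.comp measurable_insPair).aemeasurable

theorem isProbabilityMeasure_insMeasure {θ : ℝ} (hθ : 0 < θ) :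
    IsProbabilityMeasure (insMeasure θ) := by
  have := isProbabilityMeasure_PD hθ
  have := isProbabilityMeasure_beta hθ
  exact Measure.isProbabilityMeasure_map measurable_insPair.aemeasurable

theorem lintegral_ins_ins {θ : ℝ} (hθ : 0 < θ) {g : (ℝ × ℝ) × Omega1 → ℝ≥0∞}
    (hg : Measurable g) :
    ∫⁻ v, ENNReal.ofReal (1 - v) * ∫⁻ w, ∫⁻ x, g ((v, (1 - v) * w), ins v (ins w x)) ∂PD θ
      ∂betaMeasure 1 θ ∂betaMeasure 1 θ =
    ∫⁻ p, twoStickDensity θ p * ∫⁻ x, g (p, ins2 p x) ∂PD θ := by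
  have := isProbabilityMeasure_PD hθ
  have m : Measurable fun p => ∫⁻ x, g (p, ins2 p x) ∂PD θ :=
    Measurable.lintegral_prod_right' (f := fun a : (ℝ × ℝ) × Omega1 => g (a.1, ins2 a.1 a.2))
      (hg.comp (measurable_fst.prodMk measurable_ins2))
  rw [← lintegral_beta_beta hθ m]
  refine lintegral_congr_ae ?_
  filter_upwards [ae_beta_mem_Ioo θ] with v hv
  congr 1
  refine lintegral_congr_ae ?_
  filter_upwards [ae_beta_mem_Ioo θ] with w hw
  simp only [ins_ins hv hw]

theorem measurable_lintegral_ins {θ : ℝ} (hθ : 0 < θ) {G : ℝ × Omega1 → ℝ≥0∞}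
    (hG : Measurable G) : Measurable fun v => ∫⁻ x, G (v, ins v x) ∂PD θ := by
  have := isProbabilityMeasure_PD hθ
  exact Measurable.lintegral_prod_right' (f := fun a : ℝ × Omega1 => G (a.1, ins a.1 a.2))
    (hG.comp measurable_insPair)

/-- Expanding the inner sample once more by self-similarity writes any weighted one-block insertion
over the two-stick density; the division by `1 - p.1` compensates the weight built into that
density. -/
theorem lintegral_mul_ins {θ : ℝ} (hθ : 0 < θ) {G : ℝ × Omega1 → ℝ≥0∞} (hG : Measurable G)
    {h : ℝ → ℝ} (hh : Measurable h) :
    ∫⁻ v, ENNReal.ofReal (h v) * ∫⁻ x, G (v, ins v x) ∂PD θ ∂betaMeasure 1 θ =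
      ∫⁻ p, twoStickDensity θ p *
        (ENNReal.ofReal (h p.1 / (1 - p.1)) * ∫⁻ x, G (p.1, ins2 p x) ∂PD θ) := by
  have := isProbabilityMeasure_PD hθ
  have mg : Measurable fun a : (ℝ × ℝ) × Omega1 =>
      ENNReal.ofReal (h a.1.1 / (1 - a.1.1)) * G (a.1.1, a.2) :=
    ((hh.comp (by fun_prop)).div (by fun_prop)).ennreal_ofReal.mul (hG.comp (by fun_prop))
  have e := lintegral_ins_ins hθ mg
  have m1 : ∀ p : ℝ × ℝ, Measurable fun x => G (p.1, ins2 p x) := fun p =>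
    hG.comp (measurable_const.prodMk (measurable_ins2.comp (measurable_const.prodMk measurable_id)))
  have m2 : ∀ v, Measurable fun x => G (v, ins v x) := fun v =>
    hG.comp (measurable_insPair.comp (measurable_const.prodMk measurable_id))
  have m3 : ∀ v w, Measurable fun x => G (v, ins v (ins w x)) := fun v w =>
    (m2 v).comp (measurable_ins.comp (measurable_const.prodMk measurable_id))
  simp only [lintegral_const_mul _ (m1 _), lintegral_const_mul _ (m3 _ _)] at e
  rw [← e]
  refine lintegral_congr_ae ?_
  filter_upwards [ae_beta_mem_Ioo θ] with v hv
  have hz : 0 < 1 - v := sub_pos.2 hv.2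
  have m4 : Measurable fun w => ∫⁻ x, G (v, ins v (ins w x)) ∂PD θ :=
    Measurable.lintegral_prod_right' (f := fun a : ℝ × Omega1 => G (v, ins v (ins a.1 a.2)))
      ((hG.comp (measurable_insPair.comp (measurable_const.prodMk measurable_id))).comp
        measurable_ins)
  rw [lintegral_const_mul _ m4, ← mul_assoc, ← ENNReal.ofReal_mul hz.le,
    mul_div_cancel₀ _ hz.ne', lintegral_PD hθ (m2 v)]

/-- The insertion law satisfies the equation of a size-biased pick: from a state with new block `v`,
pick `v` with probability `v`, otherwise pick from the rest. All terms are compared over the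
two-stick density. -/
theorem insMeasure_recursion {θ : ℝ} (hθ : 0 < θ) {G : ℝ × Omega1 → ℝ≥0∞} (hG : Measurable G) :
    ∫⁻ v, (ENNReal.ofReal v * ∫⁻ x, G (v, ins v x) ∂PD θ + ENNReal.ofReal (1 - v) *
      ∫⁻ a, G ((1 - v) * a.1, ins v a.2) ∂insMeasure θ) ∂betaMeasure 1 θ =
    ∫⁻ a, G a ∂insMeasure θ := by
  have := isProbabilityMeasure_PD hθ
  set H : ℝ × ℝ → ℝ≥0∞ := fun p => ∫⁻ x, G (p.1, ins2 p x) ∂PD θ with hH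
  have mH : Measurable H :=
    Measurable.lintegral_prod_right' (f := fun a : (ℝ × ℝ) × Omega1 => G (a.1.1, ins2 a.1 a.2))
      (hG.comp (measurable_fst.fst.prodMk measurable_ins2))
  have mσ := measurable_twoStickDensity θ
  have hA := lintegral_mul_ins hθ hG measurable_id
  have hR := lintegral_mul_ins hθ hG (h := fun _ => 1) measurable_const
  have mB : Measurable fun a : (ℝ × ℝ) × Omega1 => G (a.1.2, a.2) := hG.comp (by fun_prop)
  have hB := lintegral_ins_ins hθ mB
  -- In the second term the picked block is the second stick; the symmetry of the density and of
  -- `ins2` makes it the first.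
  have hB2 : ∫⁻ p, twoStickDensity θ p * ∫⁻ x, G (p.2, ins2 p x) ∂PD θ =
      ∫⁻ p, twoStickDensity θ p * H p := by
    have e := (Measure.measurePreserving_swap (μ := (volume : Measure ℝ))
      (ν := (volume : Measure ℝ))).lintegral_comp (mσ.mul mH)
    rw [← Measure.volume_eq_prod] at e
    refine Eq.trans (lintegral_congr fun p => ?_) e
    rw [Pi.mul_apply, twoStickDensity_swap]
    by_cases hp : p ∈ triangle
    · simp only [hH, ins2_swap hp, Prod.fst_swap]
    · rw [twoStickDensity, indicator_of_notMem hp, zero_mul, zero_mul]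
  have hv : ∀ v, ∫⁻ a, G ((1 - v) * a.1, ins v a.2) ∂insMeasure θ =
      ∫⁻ w, ∫⁻ x, G ((1 - v) * w, ins v (ins w x)) ∂PD θ ∂betaMeasure 1 θ := fun v =>
    lintegral_insMeasure hθ (G := fun a : ℝ × Omega1 => G ((1 - v) * a.1, ins v a.2))
      (hG.comp ((measurable_const.mul measurable_fst).prodMk
        (measurable_ins.comp (measurable_const.prodMk measurable_snd))))
  simp only [ENNReal.ofReal_one, one_mul] at hR
  simp only [hv]
  simp only [id] at hA hB
  have mA : Measurable fun v => ENNReal.ofReal v * ∫⁻ x, G (v, ins v x) ∂PD θ :=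
    ENNReal.measurable_ofReal.mul (measurable_lintegral_ins hθ hG)
  have mA' : Measurable fun p : ℝ × ℝ =>
      twoStickDensity θ p * (ENNReal.ofReal (p.1 / (1 - p.1)) * H p) :=
    mσ.mul (Measurable.mul (by fun_prop) mH)
  rw [lintegral_insMeasure hθ hG, lintegral_add_left mA, hB, hB2, hR, hA,
    ← lintegral_add_left mA']
  refine lintegral_congr fun p => ?_
  by_cases hp : p ∈ triangle
  · have hz : 0 < 1 - p.1 := by linarith [hp.2.1, hp.2.2]
    rw [← mul_add]
    congr 1
    -- The weights of the two cases, `a / (1 - a)` and `1`, add up to `1 / (1 - a)`, the weight of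
    -- the insertion law itself.
    have e : ENNReal.ofReal (1 / (1 - p.1)) = ENNReal.ofReal (p.1 / (1 - p.1)) + 1 := by
      rw [← ENNReal.ofReal_one, ← ENNReal.ofReal_add (div_nonneg hp.1.le hz.le) zero_le_one]
      congr 1
      field_simp
      ring
    rw [e, add_mul, one_mul]
  · rw [twoStickDensity, indicator_of_notMem hp]
    simp

/-- A pick from `ins v x` is either the block `v` or a pick from `x` scaled by `1 - v`, whose size
bias gains the factor `1 - v`. -/
theorem pickMeasure_recursion {θ : ℝ} (hθ : 0 < θ) {G : ℝ × Omega1 → ℝ≥0∞} (hG : Measurable G) :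
    ∫⁻ a, G a ∂pickMeasure (PD θ) =
      ∫⁻ v, (ENNReal.ofReal v * ∫⁻ x, G (v, ins v x) ∂PD θ + ENNReal.ofReal (1 - v) *
        ∫⁻ a, G ((1 - v) * a.1, ins v a.2) ∂pickMeasure (PD θ)) ∂betaMeasure 1 θ := by
  have m1 : ∀ v, Measurable fun a : ℝ × Omega1 => G ((1 - v) * a.1, ins v a.2) := fun v =>
    hG.comp ((measurable_const.mul measurable_fst).prodMk
      (measurable_ins.comp (measurable_const.prodMk measurable_snd)))
  have m2 : ∀ x : Omega1, Measurable fun b => ENNReal.ofReal b * G (b, x) := fun x =>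
    ENNReal.measurable_ofReal.mul (hG.comp (by fun_prop))
  have m3 : Measurable fun x : Omega1 => ∫⁻ b, ENNReal.ofReal b * G (b, x) ∂pointSum x.1 := by
    have : ∀ x : Omega1, ∫⁻ b, ENNReal.ofReal b * G (b, x) ∂pointSum x.1 =
        ∑' i, ENNReal.ofReal (x.1 i) * G (x.1 i, x) := fun x =>
      lintegral_pointSum_ofReal_mul (g := fun b => G (b, x)) (hG.comp (by fun_prop)) x
    simp only [this]
    exact Measurable.tsum fun i => (measurable_coord i).ennreal_ofReal.mul
      (hG.comp (measurable_coord_pair i))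
  rw [lintegral_pickMeasure _ hG, lintegral_PD hθ m3]
  refine lintegral_congr_ae ?_
  filter_upwards [ae_beta_mem_Ioo θ] with v hv
  have m4 : Measurable fun x => G (v, ins v x) :=
    hG.comp (measurable_insPair.comp (measurable_const.prodMk measurable_id))
  simp only [lintegral_pointSum_ins hv (m2 _)]
  rw [lintegral_add_left (m4.const_mul _), lintegral_const_mul _ m4,
    lintegral_pickMeasure _ (m1 v)]
  congr 1
  have m5 : Measurable fun x : Omega1 =>
      ∫⁻ b, ENNReal.ofReal b * G ((1 - v) * b, ins v x) ∂pointSum x.1 := by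
    have : ∀ x : Omega1, ∫⁻ b, ENNReal.ofReal b * G ((1 - v) * b, ins v x) ∂pointSum x.1 =
        ∑' i, ENNReal.ofReal (x.1 i) * G ((1 - v) * x.1 i, ins v x) := fun x =>
      lintegral_pointSum_ofReal_mul (g := fun b => G ((1 - v) * b, ins v x))
        (hG.comp (by fun_prop)) x
    simp only [this]
    exact Measurable.tsum fun i => (measurable_coord i).ennreal_ofReal.mul
      ((m1 v).comp (measurable_coord_pair i))
  rw [← lintegral_const_mul _ m5]
  refine lintegral_congr fun x => ?_
  have m6 : Measurable fun b => ENNReal.ofReal b * G ((1 - v) * b, ins v x) :=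
    ENNReal.measurable_ofReal.mul (hG.comp (by fun_prop))
  rw [← lintegral_const_mul _ m6]
  refine lintegral_congr fun b => ?_
  rw [ENNReal.ofReal_mul (sub_nonneg.2 hv.2.le), mul_assoc]

/-- Both laws solve the same recursion, and each use of it multiplies the error by `E(1 - V)`.
Quantifying over all `G ≤ 1` lets the induction hypothesis apply to the transformed test function.
-/
theorem lintegral_pickMeasure_le {θ : ℝ} (hθ : 0 < θ) (n : ℕ) : ∀ G : ℝ × Omega1 → ℝ≥0∞,
    Measurable G → (∀ a, G a ≤ 1) → ∫⁻ a, G a ∂pickMeasure (PD θ) ≤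
      ∫⁻ a, G a ∂insMeasure θ + (∫⁻ v, ENNReal.ofReal (1 - v) ∂betaMeasure 1 θ) ^ n := by
  have := isProbabilityMeasure_PD hθ
  have := isProbabilityMeasure_pickMeasure (PD θ)
  induction n with
  | zero =>
    intro G _ hG1
    calc _ ≤ ∫⁻ _, 1 ∂pickMeasure (PD θ) := lintegral_mono hG1
      _ = 1 := by simp
      _ ≤ _ := by rw [pow_zero]; exact le_add_self
  | succ n ih =>
    intro G hG hG1
    have m1 : ∀ v, Measurable fun a : ℝ × Omega1 => G ((1 - v) * a.1, ins v a.2) := fun v =>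
      hG.comp ((measurable_const.mul measurable_fst).prodMk
        (measurable_ins.comp (measurable_const.prodMk measurable_snd)))
    rw [pickMeasure_recursion hθ hG, ← insMeasure_recursion hθ hG, pow_succ,
      ← lintegral_const_mul _ (by fun_prop), ← lintegral_add_right _ (by fun_prop)]
    refine lintegral_mono fun v => ?_
    calc _ ≤ ENNReal.ofReal v * ∫⁻ x, G (v, ins v x) ∂PD θ + ENNReal.ofReal (1 - v) *
          (∫⁻ a, G ((1 - v) * a.1, ins v a.2) ∂insMeasure θ +
            (∫⁻ v, ENNReal.ofReal (1 - v) ∂betaMeasure 1 θ) ^ n) := by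
          gcongr
          exact ih _ (m1 v) fun _ => hG1 _
      _ = _ := by
          rw [mul_add, add_assoc]
          congr 2
          exact mul_comm _ _

/-- Letting `n` tend to infinity gives one inequality between the laws, which suffices since both
have total mass one. -/
theorem pickMeasure_PD {θ : ℝ} (hθ : 0 < θ) : pickMeasure (PD θ) = insMeasure θ := by
  have := isProbabilityMeasure_PD hθ
  have := isProbabilityMeasure_pickMeasure (PD θ)
  have := isProbabilityMeasure_insMeasure hθ
  refine Measure.eq_of_le_of_isProbabilityMeasure (Measure.le_iff.2 fun s hs => ?_)
  have ht := (tendsto_const_nhds (x := insMeasure θ s)).add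
    (ENNReal.tendsto_pow_atTop_nhds_zero_of_lt_one (lintegral_one_sub_beta_lt_one hθ))
  rw [add_zero] at ht
  refine ge_of_tendsto' ht fun n => ?_
  have h := lintegral_pickMeasure_le hθ n (s.indicator 1) (measurable_one.indicator hs)
    fun a => indicator_le_self' (fun _ _ => zero_le) a
  rwa [lintegral_indicator_one hs, lintegral_indicator_one hs] at h

/-- Size-biased picking from the Poisson–Dirichlet distribution. -/
theorem lintegral_pick_PD {θ : ℝ} (hθ : 0 < θ) {G : ℝ × Omega1 → ℝ≥0∞} (hG : Measurable G) :
    ∫⁻ x, ∫⁻ b, ENNReal.ofReal b * G (b, x) ∂pointSum x.1 ∂PD θ =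
      ∫⁻ v, ∫⁻ x, G (v, ins v x) ∂PD θ ∂betaMeasure 1 θ := by
  rw [← lintegral_pickMeasure _ hG, pickMeasure_PD hθ, lintegral_insMeasure hθ hG]

end CoagFrag

end

noncomputable section

namespace CoagFrag

/-! ### The two-point correlation formula for the Poisson–Dirichlet distribution -/

theorem measurable_lintegral_pointSum {α : Type*} [MeasurableSpace α] {w : α → ℕ → ℝ}
    (hw : Measurable w) {G : α × ℝ → ℝ≥0∞} (hG : Measurable G) :
    Measurable fun z => ∫⁻ b, G (z, b) ∂pointSum (w z) := by
  have h : ∀ z, ∫⁻ b, G (z, b) ∂pointSum (w z) =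
      ∑' i, if 0 < w z i then G (z, w z i) else 0 := fun z =>
    lintegral_pointSum (g := fun b => G (z, b)) (hG.comp (by fun_prop)) (w z)
  have hk : ∀ k, Measurable fun z => w z k := fun k => (measurable_pi_apply k).comp hw
  simp only [h]
  exact Measurable.tsum fun i => Measurable.ite (measurableSet_lt measurable_const (hk i))
    (hG.comp (measurable_id.prodMk (hk i))) measurable_const

/-- Ordered pairs of distinct blocks are successive picks without replacement; deleting by value
instead of by index leaves the same point measure. -/
theorem lintegral_config2_eq_pointSum_del {k : ℝ × ℝ → ℝ≥0∞} (hk : Measurable k) (x : Omega1) :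
    ∫⁻ v, k v ∂config2 x = ∫⁻ a, ∫⁻ b, k (a, b) ∂pointSum (del x.1 a) ∂pointSum x.1 := by
  classical
  have m : Measurable fun a => ∫⁻ b, k (a, b) ∂pointSum (del x.1 a) :=
    measurable_lintegral_pointSum (measurable_del measurable_const measurable_id) hk
  rw [lintegral_config2 hk, lintegral_pointSum m, ENNReal.tsum_prod (f := fun i j => if i ≠ j ∧ 0 < x.1 i ∧ 0 < x.1 j then
      k (x.1 i, x.1 j) else 0)]
  refine tsum_congr fun i => ?_
  split_ifs with hi
  · rw [pointSum_del hi (pointSum_update_zero x.1 i),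
      lintegral_pointSum (g := fun b => k (x.1 i, b)) (hk.comp (by fun_prop))]
    refine tsum_congr fun j => ?_
    rcases eq_or_ne j i with rfl | hj
    · simp
    · simp [hj, hj.symm, hi]
  · simp [hi]

/-- Two size-biased picks without replacement. After the first, the state is `ins v x` and deleting
`v` leaves the blocks of `x` scaled by `1 - v`; the second is a pick from `x`. The scaling supplies
the factor `1 - v` in the two-stick density. -/
theorem lintegral_config2_PD {θ : ℝ} (hθ : 0 < θ) {g : (ℝ × ℝ) × Omega1 → ℝ≥0∞}
    (hg : Measurable g) :
    ∫⁻ x, ∫⁻ v, ENNReal.ofReal v.1 * ENNReal.ofReal v.2 * g (v, x) ∂config2 x ∂PD θ =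
      ∫⁻ p, twoStickDensity θ p * ∫⁻ x, g (p, ins2 p x) ∂PD θ := by
  have := isProbabilityMeasure_PD hθ
  set G : ℝ × Omega1 → ℝ≥0∞ := fun z =>
    ∫⁻ b, ENNReal.ofReal b * g ((z.1, b), z.2) ∂pointSum (del z.2.1 z.1) with hGdef
  have mG : Measurable G := by
    refine measurable_lintegral_pointSum
      (G := fun c : (ℝ × Omega1) × ℝ => ENNReal.ofReal c.2 * g ((c.1.1, c.2), c.1.2))
      (measurable_del (measurable_subtype_coe.comp measurable_snd) measurable_fst) ?_
    exact measurable_snd.ennreal_ofReal.mul (hg.comp (by fun_prop))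
  have e1 : ∀ x : Omega1, ∫⁻ v, ENNReal.ofReal v.1 * ENNReal.ofReal v.2 * g (v, x) ∂config2 x =
      ∫⁻ a, ENNReal.ofReal a * G (a, x) ∂pointSum x.1 := by
    intro x
    rw [lintegral_config2_eq_pointSum_del
      (k := fun v => ENNReal.ofReal v.1 * ENNReal.ofReal v.2 * g (v, x))
      ((Measurable.mul (by fun_prop) (by fun_prop)).mul (hg.comp (by fun_prop)))]
    refine lintegral_congr fun a => ?_
    have m : Measurable fun b => ENNReal.ofReal b * g ((a, b), x) :=
      ENNReal.measurable_ofReal.mul (hg.comp (by fun_prop))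
    simp only [hGdef, mul_assoc]
    exact lintegral_const_mul _ m
  simp only [e1]
  rw [lintegral_pick_PD hθ mG, ← lintegral_ins_ins hθ hg]
  refine lintegral_congr_ae ?_
  filter_upwards [ae_beta_mem_Ioo θ] with v hv
  have hz : 0 < 1 - v := sub_pos.2 hv.2
  have mg : Measurable fun a : ℝ × Omega1 => g ((v, (1 - v) * a.1), ins v a.2) :=
    hg.comp (Measurable.prodMk (by fun_prop)
      (measurable_ins.comp (measurable_const.prodMk measurable_snd)))
  have m1 : Measurable fun x : Omega1 =>
      ∫⁻ b, ENNReal.ofReal b * g ((v, (1 - v) * b), ins v x) ∂pointSum x.1 := by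
    refine measurable_lintegral_pointSum
      (G := fun c : Omega1 × ℝ => ENNReal.ofReal c.2 * g ((v, (1 - v) * c.2), ins v c.1))
      measurable_subtype_coe ?_
    exact measurable_snd.ennreal_ofReal.mul (mg.comp measurable_swap)
  have e2 : ∀ x : Omega1, G (v, ins v x) =
      ENNReal.ofReal (1 - v) *
        ∫⁻ b, ENNReal.ofReal b * g ((v, (1 - v) * b), ins v x) ∂pointSum x.1 := by
    intro x
    have m2 : Measurable fun b => ENNReal.ofReal b * g ((v, b), ins v x) :=
      ENNReal.measurable_ofReal.mul (hg.comp (by fun_prop))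
    have m3 : Measurable fun b => ENNReal.ofReal b * g ((v, (1 - v) * b), ins v x) :=
      ENNReal.measurable_ofReal.mul
        (mg.comp (g := fun a : ℝ × Omega1 => g ((v, (1 - v) * a.1), ins v a.2))
          (f := fun b => (b, x)) (by fun_prop))
    simp only [hGdef]
    rw [pointSum_del hv.1 (pointSum_ins hv x), lintegral_scale hz m2, ← lintegral_const_mul _ m3]
    refine lintegral_congr fun b => ?_
    rw [ENNReal.ofReal_mul hz.le, mul_assoc]
  simp only [e2]
  rw [lintegral_const_mul _ m1, lintegral_pick_PD hθ mg]

end CoagFrag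

end

noncomputable section

namespace CoagFrag

/-! ### Detailed balance for the Poisson–Dirichlet distribution -/

theorem mul_mem_triangle {u v : ℝ} (hu : u ∈ Ioo (0 : ℝ) 1) (hv : v ∈ Ioo (0 : ℝ) 1) :
    (u * v, (1 - u) * v) ∈ triangle := by
  refine ⟨mul_pos hu.1 hv.1, mul_pos (sub_pos.2 hu.2) hv.1, ?_⟩
  simp only
  linarith [hv.2]

theorem lintegral_triangle {H : ℝ × ℝ → ℝ≥0∞} (hH : Measurable H) (h0 : ∀ p ∉ triangle, H p = 0) :
    ∫⁻ p, H p = ∫⁻ v in Ioo (0 : ℝ) 1, ENNReal.ofReal v *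
      ∫⁻ u in Ioo (0 : ℝ) 1, H (u * v, (1 - u) * v) := by
  have hQ : MeasurableSet (Ioi (0 : ℝ) ×ˢ Ioi (0 : ℝ)) := measurableSet_Ioi.prod measurableSet_Ioi
  have e : ∫⁻ v in Ioi (0 : ℝ) ×ˢ Ioi (0 : ℝ), H v = ∫⁻ p, H p := by
    rw [← lintegral_indicator hQ]
    refine lintegral_congr fun p => ?_
    by_cases hp : p ∈ Ioi (0 : ℝ) ×ˢ Ioi (0 : ℝ)
    · rw [indicator_of_mem hp]
    · rw [indicator_of_notMem hp, h0 p fun h => hp ⟨h.1, h.2.1⟩]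
  rw [← e, ← lintegral_quadrant hH, ← lintegral_indicator measurableSet_Ioi,
    ← lintegral_indicator measurableSet_Ioo]
  refine lintegral_congr fun z => ?_
  by_cases hz : z ∈ Ioo (0 : ℝ) 1
  · rw [indicator_of_mem hz, indicator_of_mem (mem_Ioi.2 hz.1)]
  · rw [indicator_of_notMem hz]
    by_cases hz0 : z ∈ Ioi (0 : ℝ)
    · have hz1 : 1 ≤ z := not_lt.1 fun h => hz ⟨hz0, h⟩
      have : ∀ u : ℝ, H (u * z, (1 - u) * z) = 0 := fun u => h0 _ fun h => by
        have := h.2.2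
        simp only at this
        linarith
      simp only [indicator_of_mem hz0, this, lintegral_zero, mul_zero]
    · rw [indicator_of_notMem hz0]

/-- Both fluxes equal the integral of `twoStickDensity θ`, the rate `Q` and the mean `Γ` of `f`. In
the coagulation flux the factor `x y` is the size bias of two picks. In the fragmentation flux one
pick of size `v` uses the weight `z` of the jump measure, and the remaining factor `θ v` supplies
the Jacobian `v` and the second `θ` of the density. -/
theorem detailedBalance_PD {θ : ℝ} (hθ : 0 < θ) {Q : ℝ → ℝ → ℝ}
    (hQ : Measurable (Function.uncurry Q)) :
    DetailedBalance (fun x y => x * y * Q x y) (fun x y => θ * (x + y) * Q x y) (PD θ) := by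
  intro f hf
  have := isProbabilityMeasure_PD hθ
  have hQ' : Measurable fun p : ℝ × ℝ => Q p.1 p.2 := hQ
  have hK : Measurable (Function.uncurry fun x y => x * y * Q x y) :=
    (measurable_fst.mul measurable_snd).mul hQ'
  have hF : Measurable (Function.uncurry fun x y => θ * (x + y) * Q x y) :=
    (measurable_const.mul (measurable_fst.add measurable_snd)).mul hQ'
  have mQ := measurable_rateExt hQ
  have mσ := measurable_twoStickDensity θ
  have rK : ∀ p : ℝ × ℝ, rateExt (fun x y => x * y * Q x y) p =
      ENNReal.ofReal p.1 * ENNReal.ofReal p.2 * rateExt Q p := fun p => by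
    by_cases hp : p ∈ rateDomain
    · simp only [rateExt, indicator_of_mem hp]
      rw [ENNReal.ofReal_mul (mul_nonneg hp.1.le hp.2.1.le), ENNReal.ofReal_mul hp.1.le]
    · simp only [rateExt, indicator_of_notMem hp, mul_zero]
  have rF : ∀ p : ℝ × ℝ, rateExt (fun x y => θ * (x + y) * Q x y) p =
      ENNReal.ofReal (θ * (p.1 + p.2)) * rateExt Q p := fun p => by
    by_cases hp : p ∈ rateDomain
    · simp only [rateExt, indicator_of_mem hp]
      rw [ENNReal.ofReal_mul (mul_nonneg hθ.le (add_nonneg hp.1.le hp.2.1.le))]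
    · simp only [rateExt, indicator_of_notMem hp, mul_zero]
  have mi : Measurable fun a : (ℝ × ℝ) × Omega1 => ins (a.1.1 + a.1.2) a.2 :=
    measurable_ins.comp (Measurable.prodMk (by fun_prop) measurable_snd)
  have mΓf : Measurable fun a : (ℝ × ℝ) × Omega1 => f (ins2 a.1 a.2, ins (a.1.1 + a.1.2) a.2) :=
    hf.comp (measurable_ins2.prodMk mi)
  have mΓp : ∀ p : ℝ × ℝ, Measurable fun x => f (ins2 p x, ins (p.1 + p.2) x) := fun p =>
    mΓf.comp (measurable_const.prodMk measurable_id)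
  set Γ : ℝ × ℝ → ℝ≥0∞ := fun p => ∫⁻ x, f (ins2 p x, ins (p.1 + p.2) x) ∂PD θ with hΓ
  have mΓ : Measurable Γ := Measurable.lintegral_prod_right' mΓf
  have lhs : ∫⁻ x, ∫⁻ y, f (x, y) ∂coagMeas (fun x y => x * y * Q x y) x ∂PD θ =
      ∫⁻ p, twoStickDensity θ p * (rateExt Q p * Γ p) := by
    have mg : Measurable fun a : (ℝ × ℝ) × Omega1 =>
        rateExt Q a.1 * f (a.2, mergeVal a.1 a.2) :=
      (mQ.comp measurable_fst).mul (hf.comp (measurable_snd.prodMk measurable_mergeVal))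
    simp only [lintegral_coagMeas_eq hK hf, rK, mul_assoc _ (rateExt Q _)]
    rw [lintegral_config2_PD hθ mg]
    refine lintegral_congr fun p => ?_
    by_cases hp : p ∈ triangle
    · simp only [mergeVal_ins2 hp]
      rw [lintegral_const_mul _ (mΓp p)]
    · simp only [twoStickDensity, indicator_of_notMem hp, zero_mul]
  have rhs : ∫⁻ x, ∫⁻ y, f (y, x) ∂fragMeas (fun x y => θ * (x + y) * Q x y) x ∂PD θ =
      ∫⁻ p, twoStickDensity θ p * (rateExt Q p * Γ p) := by
    have mS := measurable_splitIntegral hF hf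
    simp only [lintegral_fragMeas_eq hF hf, config_val]
    rw [lintegral_pick_PD hθ mS, lintegral_beta hθ (measurable_lintegral_ins hθ mS),
      lintegral_triangle (H := fun p => twoStickDensity θ p * (rateExt Q p * Γ p))
        (mσ.mul (mQ.mul mΓ)) fun p hp => by
          simp only [twoStickDensity, indicator_of_notMem hp, zero_mul]]
    refine setLIntegral_congr_fun measurableSet_Ioo fun v hv => ?_
    have mp : Measurable fun a : Omega1 × ℝ => (a.2 * v, (1 - a.2) * v) := by fun_prop
    have mi' : Measurable fun a : Omega1 × ℝ => ins v a.1 :=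
      measurable_ins.comp (measurable_const.prodMk measurable_fst)
    have mI : Measurable (Function.uncurry fun (x : Omega1) (u : ℝ) =>
        rateExt (fun x y => θ * (x + y) * Q x y) (u * v, (1 - u) * v) *
          f (splitVal (u * v, (1 - u) * v) (ins v x), ins v x)) :=
      ((measurable_rateExt hF).comp mp).mul
        (hf.comp ((measurable_splitVal.comp (mp.prodMk mi')).prodMk mi'))
    have mJ : Measurable fun u : ℝ => rateExt Q (u * v, (1 - u) * v) * Γ (u * v, (1 - u) * v) :=
      (mQ.mul mΓ).comp (f := fun u : ℝ => (u * v, (1 - u) * v)) (by fun_prop)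
    have e1 : ∫⁻ x, (∫⁻ u in Ioo (0 : ℝ) 1,
        rateExt (fun x y => θ * (x + y) * Q x y) (u * v, (1 - u) * v) *
          f (splitVal (u * v, (1 - u) * v) (ins v x), ins v x)) ∂PD θ =
        ENNReal.ofReal (θ * v) * ∫⁻ u in Ioo (0 : ℝ) 1,
          rateExt Q (u * v, (1 - u) * v) * Γ (u * v, (1 - u) * v) := by
      rw [lintegral_lintegral_swap mI.aemeasurable, ← lintegral_const_mul _ mJ]
      refine setLIntegral_congr_fun measurableSet_Ioo fun u hu => ?_
      have hp := mul_mem_triangle hu hv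
      have hs : u * v + (1 - u) * v = v := by ring
      have hi := splitVal_ins hp
      simp only [hs] at hi
      simp only [hi, rF, hs, hΓ]
      have m := mΓp (u * v, (1 - u) * v)
      simp only [hs] at m
      rw [lintegral_const_mul _ m, mul_assoc]
    have e2 : ∫⁻ u in Ioo (0 : ℝ) 1, twoStickDensity θ (u * v, (1 - u) * v) *
        (rateExt Q (u * v, (1 - u) * v) * Γ (u * v, (1 - u) * v)) =
        ENNReal.ofReal (θ ^ 2 * (1 - v) ^ (θ - 1)) * ∫⁻ u in Ioo (0 : ℝ) 1,
          rateExt Q (u * v, (1 - u) * v) * Γ (u * v, (1 - u) * v) := by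
      rw [← lintegral_const_mul _ mJ]
      refine setLIntegral_congr_fun measurableSet_Ioo fun u hu => ?_
      have hs : u * v + (1 - u) * v = v := by ring
      simp only [twoStickDensity, indicator_of_mem (mul_mem_triangle hu hv), hs]
    have hz : 0 ≤ (1 - v) ^ (θ - 1) := Real.rpow_nonneg (sub_nonneg.2 hv.2.le) _
    rw [e1, e2, ← mul_assoc, ← mul_assoc, ← ENNReal.ofReal_mul (mul_nonneg hθ.le hz),
      ← ENNReal.ofReal_mul hv.1.le]
    congr 2
    -- The identity of constants is `θ (1 - v)^(θ - 1) · θ v = v · θ² (1 - v)^(θ - 1)`.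
    ring
  rw [lhs, rhs]

end CoagFrag

end

noncomputable section

namespace CoagFrag

/-! ### The Poisson–Dirichlet distribution as a reversible distribution -/

/-- The two fragments of a block add up to it, so the factor `θ (x + y)` in the rate equals `θ x_i`;
with the weight `x_i` this gives `θ x_i²`. -/
theorem opQ_eq_opSharp (Q : ℝ → ℝ → ℝ) (θ : ℝ) :
    opQ Q θ = opSharp (fun x y => x * y * Q x y) fun x y => θ * (x + y) * Q x y := by
  funext Φ x
  have h : ∀ i, x.1 i * ∫ u in (0 : ℝ)..1, θ * (u * x.1 i + (1 - u) * x.1 i) *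
      Q (u * x.1 i) ((1 - u) * x.1 i) * (Φ (split x i u) - Φ x) =
      θ * (x.1 i ^ 2 * ∫ u in (0 : ℝ)..1,
        Q (u * x.1 i) ((1 - u) * x.1 i) * (Φ (split x i u) - Φ x)) := fun i => by
    have : ∀ u : ℝ, θ * (u * x.1 i + (1 - u) * x.1 i) * Q (u * x.1 i) ((1 - u) * x.1 i) *
        (Φ (split x i u) - Φ x) = θ * x.1 i *
        (Q (u * x.1 i) ((1 - u) * x.1 i) * (Φ (split x i u) - Φ x)) := fun u => by ring
    simp only [this, intervalIntegral.integral_const_mul]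
    ring
  simp only [opQ, opSharp, h, tsum_mul_left]
  ring

theorem IsRate.mul_mul {Q : ℝ → ℝ → ℝ} (hQ : IsRate Q) : IsRate fun x y => x * y * Q x y where
  measurable := (measurable_fst.mul measurable_snd).mul
    (show Measurable fun p : ℝ × ℝ => Q p.1 p.2 from hQ.measurable)
  symm x y hx hy h := by rw [hQ.symm x y hx hy h, mul_comm x y]
  nonneg x y hx hy h := mul_nonneg (mul_nonneg hx.le hy.le) (hQ.nonneg x y hx hy h)

theorem IsRate.mul_add_mul {Q : ℝ → ℝ → ℝ} (hQ : IsRate Q) {θ : ℝ} (hθ : 0 ≤ θ) :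
    IsRate fun x y => θ * (x + y) * Q x y where
  measurable := (measurable_const.mul (measurable_fst.add measurable_snd)).mul
    (show Measurable fun p : ℝ × ℝ => Q p.1 p.2 from hQ.measurable)
  symm x y hx hy h := by rw [hQ.symm x y hx hy h, add_comm x y]
  nonneg x y hx hy h :=
    mul_nonneg (mul_nonneg hθ (add_nonneg hx.le hy.le)) (hQ.nonneg x y hx hy h)

/-- Dropping the constraint on the indices leaves at most `C (∑ x_i)² = C`. -/
theorem boundedCoagRate_mul_mul {Q : ℝ → ℝ → ℝ} {C : ℝ}
    (hC : ∀ x y, 0 < x → 0 < y → x + y ≤ 1 → Q x y ≤ C) :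
    BoundedCoagRate fun x y => x * y * Q x y := by
  refine ⟨C.toNNReal, fun x => ?_⟩
  have h : ∀ p : ℕ × ℕ, (if p.1 ≠ p.2 ∧ 0 < x.1 p.1 ∧ 0 < x.1 p.2 then
      ENNReal.ofReal (x.1 p.1 * x.1 p.2 * Q (x.1 p.1) (x.1 p.2)) else 0) ≤
      ENNReal.ofReal (x.1 p.1) * (ENNReal.ofReal (x.1 p.2) * ENNReal.ofReal C) := fun p => by
    split_ifs with hp
    · rw [← mul_assoc, ← ENNReal.ofReal_mul hp.2.1.le,
        ← ENNReal.ofReal_mul (mul_nonneg hp.2.1.le hp.2.2.le)]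
      exact ENNReal.ofReal_le_ofReal (mul_le_mul_of_nonneg_left
        (hC _ _ hp.2.1 hp.2.2 (add_le_one x hp.1)) (mul_nonneg hp.2.1.le hp.2.2.le))
    · exact zero_le
  refine (ENNReal.tsum_le_tsum h).trans_eq ?_
  rw [ENNReal.tsum_prod (f := fun i j =>
    ENNReal.ofReal (x.1 i) * (ENNReal.ofReal (x.1 j) * ENNReal.ofReal C))]
  simp only [ENNReal.tsum_mul_left, ENNReal.tsum_mul_right, tsum_ofReal, one_mul]
  rfl

theorem boundedFragRate_mul_add_mul {Q : ℝ → ℝ → ℝ} {C θ : ℝ} (hθ : 0 ≤ θ) (h0 : 0 ≤ C)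
    (hC : ∀ x y, 0 < x → 0 < y → x + y ≤ 1 → Q x y ≤ C) :
    BoundedFragRate fun x y => θ * (x + y) * Q x y := by
  refine ⟨(θ * C).toNNReal, fun x => ?_⟩
  have h : ∀ i, ENNReal.ofReal (x.1 i) * ∫⁻ u in Ioo (0 : ℝ) 1,
      ENNReal.ofReal (θ * (u * x.1 i + (1 - u) * x.1 i) * Q (u * x.1 i) ((1 - u) * x.1 i)) ≤
      ENNReal.ofReal (x.1 i) * ENNReal.ofReal (θ * C) := fun i => by
    rcases (x.nonneg i).eq_or_lt with hi | hi
    · simp [← hi]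
    gcongr
    have hle := le_one x i
    calc _ ≤ ∫⁻ _ in Ioo (0 : ℝ) 1, ENNReal.ofReal (θ * C) := by
          refine setLIntegral_mono measurable_const fun u hu => ENNReal.ofReal_le_ofReal ?_
          have hs : u * x.1 i + (1 - u) * x.1 i = x.1 i := by ring
          have hq := hC _ _ (mul_pos hu.1 hi) (mul_pos (sub_pos.2 hu.2) hi) (hs.trans_le hle)
          rw [hs]
          calc _ ≤ θ * x.1 i * C := mul_le_mul_of_nonneg_left hq (mul_nonneg hθ hi.le)
            _ ≤ θ * 1 * C := by gcongr
            _ = θ * C := by rw [mul_one]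
      _ = _ := by simp
  refine (ENNReal.tsum_le_tsum h).trans_eq ?_
  rw [ENNReal.tsum_mul_right, tsum_ofReal, one_mul]
  rfl

theorem reversibleWrt_PD {θ : ℝ} (hθ : 0 < θ) {Q : ℝ → ℝ → ℝ} (hQ : IsRate Q)
    (hC : ∃ C : ℝ, ∀ x y, 0 < x → 0 < y → x + y ≤ 1 → Q x y ≤ C) :
    ReversibleWrt.{u} (opQ Q θ) (PD θ) := by
  obtain ⟨C, hC⟩ := hC
  -- Only an upper bound of `Q` is given; its sign follows by evaluating at one admissible point.
  have h0 : 0 ≤ C := (hQ.nonneg (1 / 2) (1 / 2) (by norm_num) (by norm_num) (by norm_num)).trans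
    (hC _ _ (by norm_num) (by norm_num) (by norm_num))
  rw [opQ_eq_opSharp]
  exact (detailedBalance_PD hθ hQ.measurable).reversibleWrt hQ.mul_mul (hQ.mul_add_mul hθ.le)
    (boundedCoagRate_mul_mul hC) (boundedFragRate_mul_add_mul hθ.le h0 hC)

end CoagFrag

end

/-! ### The two reversibility statements -/

theorem theorem2p3 :
    -- (i)
    (∀ K₁ F₁ : ℝ → ℝ → ℝ, CoagFrag.IsRate K₁ → CoagFrag.IsRate F₁ →
      CoagFrag.BoundedCoagRate K₁ → CoagFrag.BoundedFragRate F₁ →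
      ∀ (S : Type u) [MeasurableSpace S] (P : Measure S) [IsProbabilityMeasure P]
        (X : S → CoagFrag.Omega1), Measurable X →
      ∀ (q₁ : ℝ → ℝ≥0∞) (q₂ : ℝ × ℝ → ℝ≥0∞),
      CoagFrag.IsCorrFun1 (P.map X) q₁ → CoagFrag.IsCorrFun2 (P.map X) q₂ →
      ∀ (P₁ : Kernel ℝ CoagFrag.PointConfig) [IsMarkovKernel P₁]
        (P₂ : Kernel (ℝ × ℝ) CoagFrag.PointConfig) [IsMarkovKernel P₂],
      CoagFrag.IsPalm1 (P.map X) P₁ → CoagFrag.IsPalm2 (P.map X) P₂ →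
      (∀ᵐ x : ℝ × ℝ, 0 < x.1 → 0 < x.2 → x.1 + x.2 < 1 →
        (ENNReal.ofReal (K₁ x.1 x.2) * q₂ x) • P₂ x =
          (ENNReal.ofReal (F₁ x.1 x.2) * q₁ (x.1 + x.2)) • P₁ (x.1 + x.2)) →
      CoagFrag.ReversibleWrt.{u} (CoagFrag.opSharp K₁ F₁) (P.map X)) ∧
    -- (ii)
    (∀ (θ : ℝ) (Q : ℝ → ℝ → ℝ), 0 < θ → CoagFrag.IsRate Q →
      (∃ C : ℝ, ∀ x y, 0 < x → 0 < y → x + y ≤ 1 → Q x y ≤ C) →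
      CoagFrag.ReversibleWrt.{u} (CoagFrag.opQ Q θ) (CoagFrag.PD θ)) := by
  refine ⟨?_, ?_⟩
  · intro K₁ F₁ hK hF bK bF S _ P _ X hX q₁ q₂ hq₁ hq₂ P₁ _ P₂ _ hP₁ hP₂ h
    exact (CoagFrag.detailedBalance_of_palm hK.measurable hF.measurable hq₁ hq₂ hP₁ hP₂
      h).reversibleWrt hK hF bK bF
  · exact fun θ Q hθ hQ hC => CoagFrag.reversibleWrt_PD hθ hQ hC
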